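/- **Proposition (Coxeter cover).** Let $(M,g)$ be a connected (not necessarily complete) smooth Riemannian manifold without boundary, Hausdorff and second countable. A *reflection* of $M$ is an isometry $r$ of order $2$ whose fixed point set has a connected component of codimension one; every such component is called a *mirror* of $r$. Let $\mathsf W\subset \mathrm{Isom}(M)$ be a *reflection group*: a subgroup of the isometry group that is discrete and closed (for the compact-open topology) and is generated by the reflections it contains. An *open chamber* of $\mathsf W$ is a connected component of the complement in $M$ of the union of all mirrors of all reflections in $\mathsf W$; for an open chamber $c$ let $\mathsf W_c=\{w\in \mathsf W : w(c)=c\}$. The action of a reflection group is called *Coxeter* if $\mathsf W_c$ is trivial for every open chamber $c$. Then there exist a connected smooth Riemannian manifold $(M',g')$, a regular covering $p:M'\to M$ that is smooth and satisfies $p^*g=g'$ (regular meaning that the group $\Gamma'$ of deck transformations of $p$ acts transitively on every fibre of $p$), and an injective homomorphism $\rho:\mathsf W\to \mathrm{Isom}(M',g')$ such that: 1. $\Gamma'\cong \mathsf W_c$ as groups, for every open chamber $c\subset M$; 2. $\rho$ lifts the action of $\mathsf W$: $p(\rho(w)x)=w\,p(x)$ for all $w\in\mathsf W$, $x\in M'$;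 3. the lifted action commutes with $\Gamma'$: $\rho(w)\gamma=\gamma\rho(w)$ for all $w\in\mathsf W$, $\gamma\in\Gamma'$; 4. $\rho(\mathsf W)$ is a reflection group of $M'$ whose action is Coxeter, and $\mathsf W$ acts via $\rho$ simply transitively on the set of open chambers of $\rho(\mathsf W)$: for any two open chambers $c',c''$ of $M'$ there is exactly one $w\in \mathsf W$ with $\rho(w)(c')=c''$. -/

import Mathlib

open scoped Manifold ContDiff

universe u v

noncomputable section

/-! ### Riemannian metrics and isometries -/

section Riemannian

variable {E : Type*} [NormedAddCommGroup E] [NormedSpace ℝ E]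

/-- A smooth Riemannian metric on the smooth manifold (without boundary) `M` modelled on `E`. -/
abbrev SmoothMetric (E : Type*) [NormedAddCommGroup E] [NormedSpace ℝ E]
    (M : Type*) [TopologicalSpace M] [ChartedSpace E M] [IsManifold 𝓘(ℝ, E) ∞ M] :=
  Bundle.ContMDiffRiemannianMetric 𝓘(ℝ, E) ∞ E (fun x : M => TangentSpace 𝓘(ℝ, E) x)

/-- The smooth map `f` pulls the Riemannian metric `h` back to the Riemannian metric `g`. -/
structure PreservesMetric {M N : Type*}
    [TopologicalSpace M] [ChartedSpace E M] [IsManifold 𝓘(ℝ, E) ∞ M]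
    [TopologicalSpace N] [ChartedSpace E N] [IsManifold 𝓘(ℝ, E) ∞ N]
    (g : SmoothMetric E M) (h : SmoothMetric E N) (f : M → N) : Prop where
  contMDiff : ContMDiff 𝓘(ℝ, E) 𝓘(ℝ, E) ∞ f
  inner_eq : ∀ (x : M) (v w : TangentSpace 𝓘(ℝ, E) x),
    h.inner (f x) (mfderiv 𝓘(ℝ, E) 𝓘(ℝ, E) f x v) (mfderiv 𝓘(ℝ, E) 𝓘(ℝ, E) f x w)
      = g.inner x v w

theorem PreservesMetric.id {M : Type*}
    [TopologicalSpace M] [ChartedSpace E M] [IsManifold 𝓘(ℝ, E) ∞ M] (g : SmoothMetric E M) :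
    PreservesMetric g g (fun x : M => x) where
  contMDiff := contMDiff_id
  inner_eq x v w := by
    have h : mfderiv 𝓘(ℝ, E) 𝓘(ℝ, E) (fun y : M => y) x
        = ContinuousLinearMap.id ℝ (TangentSpace 𝓘(ℝ, E) x) := mfderiv_id
    rw [h]; rfl

theorem PreservesMetric.comp {M N P : Type*}
    [TopologicalSpace M] [ChartedSpace E M] [IsManifold 𝓘(ℝ, E) ∞ M]
    [TopologicalSpace N] [ChartedSpace E N] [IsManifold 𝓘(ℝ, E) ∞ N]
    [TopologicalSpace P] [ChartedSpace E P] [IsManifold 𝓘(ℝ, E) ∞ P]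
    {g : SmoothMetric E M} {h : SmoothMetric E N} {k : SmoothMetric E P}
    {f₂ : N → P} {f₁ : M → N}
    (hf₂ : PreservesMetric h k f₂) (hf₁ : PreservesMetric g h f₁) :
    PreservesMetric g k (fun x => f₂ (f₁ x)) where
  contMDiff := hf₂.contMDiff.comp hf₁.contMDiff
  inner_eq x v w := by
    have hc : mfderiv 𝓘(ℝ, E) 𝓘(ℝ, E) (fun y => f₂ (f₁ y)) x
        = (mfderiv 𝓘(ℝ, E) 𝓘(ℝ, E) f₂ (f₁ x)).comp (mfderiv 𝓘(ℝ, E) 𝓘(ℝ, E) f₁ x) :=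
      mfderiv_comp x (hf₂.contMDiff.mdifferentiableAt (by simp))
        (hf₁.contMDiff.mdifferentiableAt (by simp))
    rw [hc, ← hf₁.inner_eq x v w]
    exact hf₂.inner_eq (f₁ x) _ _

/-- The group of isometries of the Riemannian manifold `(M, g)`: the diffeomorphisms of `M`
that preserve the metric, with composition as multiplication. -/
def isometrySubgroup {M : Type*}
    [TopologicalSpace M] [ChartedSpace E M] [IsManifold 𝓘(ℝ, E) ∞ M] (g : SmoothMetric E M) :
    Subgroup (M ≃ₜ M) where
  carrier := {f | PreservesMetric g g (fun x => f x) ∧ PreservesMetric g g (fun x => f.symm x)}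
  mul_mem' := fun ha hb => ⟨ha.1.comp hb.1, hb.2.comp ha.2⟩
  one_mem' := ⟨PreservesMetric.id g, PreservesMetric.id g⟩
  inv_mem' := fun ha => ⟨ha.2, ha.1⟩

/-- `Isom(M, g)` as a group. -/
abbrev Isom {M : Type*}
    [TopologicalSpace M] [ChartedSpace E M] [IsManifold 𝓘(ℝ, E) ∞ M] (g : SmoothMetric E M) :=
  ↥(isometrySubgroup g)

variable {M : Type*} [TopologicalSpace M] [ChartedSpace E M] [IsManifold 𝓘(ℝ, E) ∞ M]

/-- The compact-open topology on the isometry group. -/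
instance isomTopology (g : SmoothMetric E M) : TopologicalSpace (Isom g) :=
  TopologicalSpace.induced
    (fun f : Isom g => (⟨fun x => f.1 x, f.1.continuous⟩ : C(M, M)))
    ContinuousMap.compactOpen

/-! ### Reflections, mirrors, reflection groups, chambers -/

/-- `Λ` is an embedded submanifold of `M` of codimension one: near each of its points it is, in a
suitable chart of `M`, a linear hyperplane. -/
def IsHypersurface (E : Type*) [NormedAddCommGroup E] [NormedSpace ℝ E]
    {M : Type*} [TopologicalSpace M] [ChartedSpace E M] (Λ : Set M) : Prop :=
  ∀ p ∈ Λ, ∃ φ ∈ IsManifold.maximalAtlas 𝓘(ℝ, E) ∞ M, p ∈ φ.source ∧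
    ∃ F : Submodule ℝ E, Module.finrank ℝ (E ⧸ F) = 1 ∧
      ∀ x ∈ φ.source, x ∈ Λ ↔ φ x ∈ F

/-- `Λ` is a mirror for the isometry `r`: a connected component of the fixed point set of `r`
that has codimension one. -/
def IsMirror {g : SmoothMetric E M} (r : Isom g) (Λ : Set M) : Prop :=
  (∃ p ∈ {x : M | r.1 x = x}, Λ = connectedComponentIn {x : M | r.1 x = x} p) ∧
    IsHypersurface E Λ

/-- A reflection is an isometric involution that has a mirror. -/
def IsReflection {g : SmoothMetric E M} (r : Isom g) : Prop :=
  orderOf r = 2 ∧ ∃ Λ : Set M, IsMirror r Λ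

/-- A reflection group: a discrete closed subgroup of the isometry group, generated by
the reflections that it contains. -/
structure IsReflectionGroup {g : SmoothMetric E M} (W : Subgroup (Isom g)) : Prop where
  discrete : DiscreteTopology W
  closed : IsClosed (W : Set (Isom g))
  generated : Subgroup.closure {r : Isom g | r ∈ W ∧ IsReflection r} = W

/-- The union of all mirrors of all reflections in `W`. -/
def mirrorUnion {g : SmoothMetric E M} (W : Subgroup (Isom g)) : Set M :=
  {x | ∃ r ∈ W, IsReflection r ∧ ∃ Λ : Set M, IsMirror r Λ ∧ x ∈ Λ}

/-- An open chamber: a connected component of the complement of the union of all mirrors. -/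
def IsOpenChamber {g : SmoothMetric E M} (W : Subgroup (Isom g)) (c : Set M) : Prop :=
  ∃ x ∈ (mirrorUnion W)ᶜ, c = connectedComponentIn (mirrorUnion W)ᶜ x

/-- The stabilizer of `c` in `W`, that is, the group of all `w ∈ W` with `w(c) = c`. -/
def chamberStabilizer {g : SmoothMetric E M} (W : Subgroup (Isom g)) (c : Set M) :
    Subgroup W where
  carrier := {w | (fun x => w.1.1 x) '' c = c}
  mul_mem' := by
    intro a b ha hb
    change (fun x => a.1.1 (b.1.1 x)) '' c = c
    rw [← Set.image_image (fun x => a.1.1 x) (fun x => b.1.1 x) c]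
    rw [show (fun x => b.1.1 x) '' c = c from hb]
    exact ha
  one_mem' := by
    change (fun x => x) '' c = c
    exact Set.image_id' c
  inv_mem' := by
    intro a ha
    change (fun x => a.1.1.symm x) '' c = c
    conv_lhs => rw [← show (fun x => a.1.1 x) '' c = c from ha]
    rw [Set.image_image]
    simp

/-- The action of `W` on `M` is Coxeter if all chamber stabilizers are trivial. -/
def IsCoxeterAction {g : SmoothMetric E M} (W : Subgroup (Isom g)) : Prop :=
  ∀ c : Set M, IsOpenChamber W c → chamberStabilizer W c = ⊥

end Riemannian

/-! ### Regular covers -/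

/-- The group of deck transformations of `p`. -/
def deckGroup {X Y : Type*} [TopologicalSpace X] (p : X → Y) : Subgroup (X ≃ₜ X) where
  carrier := {γ | ∀ x, p (γ x) = p x}
  mul_mem' := fun {a b} ha hb x => (ha (b x)).trans (hb x)
  one_mem' := fun _ => rfl
  inv_mem' := by
    intro a ha x
    have h := ha (a.symm x)
    rw [a.apply_symm_apply] at h
    exact h.symm

/-- A regular cover: a surjective covering map with connected total space, whose deck
transformations act transitively on every fibre. -/
structure IsRegularCover {X Y : Type*} [TopologicalSpace X] [TopologicalSpace Y]
    (p : X → Y) : Prop where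
  connected : ConnectedSpace X
  isCoveringMap : IsCoveringMap p
  surjective : Function.Surjective p
  transitive : ∀ x y : X, p x = p y → ∃ γ ∈ deckGroup p, γ x = y

end

/-!
Fix an open chamber `c` of `W` and write `M°` for the complement of the mirrors. The cover `M'` is
the space of germs of *local sections* (`IsLocalSection`, `CoxeterCover`): near a point `x`, a local
section is a function `f : M → W` that is locally constant on `M°`, satisfies `y ∈ f(y) c` for
`y ∈ M°`, and satisfies `f(r y) = r f(y)` for every reflection `r` with a mirror through `x`. In
other words, `f` labels the chambers near `x` by elements of `W` carrying `c` to them, in such a way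
that crossing a mirror multiplies the label by the reflection in it. If the chamber stabilizer
`W_c` is trivial there is only one labelling; in general the labellings form the covering.

*Local sections exist.* A discrete group of isometries acts properly discontinuously
(`exists_nhds_finite_of_discrete`), so point stabilizers are finite and act linearly in a suitable
chart (`exists_linear_chart`); near `x` the mirrors become the hyperplanes of a finite family of
linear reflections, stable under conjugation (`exists_arrangement_chart`). For such a family, any
two regular points are joined by a gallery, and a closed gallery has trivial product, so there is an
equivariant label for the chambers (`ReflectionArrangement.exists_equivariant`). Two local sections
at `x` agree, up to right multiplication by one element of `W_c`, near `x`
(`IsLocalSection.exists_mul`). Hence `M' → M` is a covering on whose fibres `W_c` acts freely and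
transitively (`CoxeterCover.isCoveringMap_proj`, `CoxeterCover.exists_smul_eq`). The group `W` acts
on `M'` by transporting sections, `f ↦ w f(w⁻¹ ·)`, which commutes with right multiplication. The
smooth structure and the metric are pulled back along the local homeomorphism `M' → M`
(`IsPullbackAtlas`).

*`M'` is connected.* A reflection `r` fixes every point of `M'` above its mirror, because local
sections are `r`-equivariant there (`CoxeterCover.smul_eq_of_mem_mirrorReflections`). A component `Z`
of `M'` maps onto `M`, so it contains such fixed points and is preserved by every reflection, hence
by `W`. Off the preimage of the mirrors, the value of the section is a locally constant function on
`M'` whose level set over `w` is a homeomorphic copy of `w c`, hence connected; `W` permutes these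
level sets transitively and `Z` contains one of them, so it contains all. Their union is dense and
`Z` is closed, so `Z = M'` (`CoxeterCover.connectedSpace`).

*The lifted action is Coxeter.* The same fixed points show that the mirrors of the lifted group
are the preimages of the mirrors of `W` (`CoxeterCover.mirrorUnion_range_lift`). So the chambers
of `M'` are precisely the level sets just described (`CoxeterCover.chamber`,
`CoxeterCover.connectedComponentIn_eq_chamber`). They are indexed by
`W`, and the action of `W` on them is left translation on the index, which is simply transitive.
-/

section

open Set Filter Topology

/-! ### Finite linear reflection groups -/

/-- A finite family `T` of reflections in a group `G` acting linearly on `E` through `L`, closed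
under conjugation by its members: `t ∈ T` is an involution whose fixed space is the hyperplane
`ker (α t)`, and different members have different hyperplanes. No inner product is used. -/
structure ReflectionArrangement (G E : Type*) [Group G] [NormedAddCommGroup E]
    [NormedSpace ℝ E] where
  /-- the linear representation -/
  L : G →* (E →L[ℝ] E)
  /-- the reflections -/
  T : Set G
  /-- a linear form defining the hyperplane of a reflection -/
  α : G → E →L[ℝ] ℝ
  finite : T.Finite
  mul_self : ∀ t ∈ T, t * t = 1
  fix_iff : ∀ t ∈ T, ∀ x, L t x = x ↔ α t x = 0
  ne_zero : ∀ t ∈ T, α t ≠ 0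
  neg : ∀ t ∈ T, ∀ x, α t (L t x) = -α t x
  conj_mem : ∀ t ∈ T, ∀ s ∈ T, t * s * t ∈ T
  indep : ∀ t ∈ T, ∀ s ∈ T, s ≠ t → ∀ c : ℝ, α s ≠ c • α t

theorem pos_mul_trans {x y z : ℝ} (h₁ : 0 < x * y) (h₂ : 0 < y * z) : 0 < x * z := by
  have hy : y ≠ 0 := by rintro rfl; simp at h₁
  have h := mul_pos h₁ h₂
  have h' : x * y * (y * z) = y ^ 2 * (x * z) := by ring
  rw [h'] at h
  exact pos_of_mul_pos_right h (by positivity)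

/-- Finitely many nonzero linear forms are simultaneously nonzero on a dense set. -/
theorem dense_forall_ne_zero {E ι : Type*} [NormedAddCommGroup E] [NormedSpace ℝ E]
    {s : Set ι} (hs : s.Finite) (β : ι → E →L[ℝ] ℝ) (hβ : ∀ i ∈ s, β i ≠ 0) :
    Dense {x : E | ∀ i ∈ s, β i x ≠ 0} := by
  have h := Set.Finite.dense_sInter (s := (fun i => {x : E | β i x ≠ 0}) '' s) (hs.image _)
    (by
      rintro _ ⟨i, hi, rfl⟩
      exact isOpen_ne_fun (β i).continuous continuous_const)
    (by
      rintro _ ⟨i, hi, rfl⟩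
      exact (dense_compl_singleton (0 : ℝ)).preimage ((β i).isOpenMap_of_ne_zero (hβ i hi)))
  convert! h using 1
  ext x
  simp

namespace ReflectionArrangement

variable {G E : Type*} [Group G] [NormedAddCommGroup E] [NormedSpace ℝ E]
  (A : ReflectionArrangement G E)

/-- The point `a` lies on no hyperplane of the arrangement. -/
def Reg (a : E) : Prop := ∀ t ∈ A.T, A.α t a ≠ 0

/-- The points `a`, `b` lie on the same open side of every hyperplane of the arrangement. -/
def Same (a b : E) : Prop := ∀ t ∈ A.T, 0 < A.α t a * A.α t b

/-- No hyperplane other than that of `t` separates `a` from its mirror image under `t`. -/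
def Adj (t : G) (a : E) : Prop := ∀ s ∈ A.T, s ≠ t → 0 < A.α s a * A.α s (A.L t a)

/-- A gallery issuing from `a`: a sequence of reflections, each of which takes the chamber reached
so far to an adjacent one. The gallery leads from `a` to `A.L l.reverse.prod a`. -/
def Gallery : List G → E → Prop
  | [], _ => True
  | t :: l, a => t ∈ A.T ∧ A.Adj t a ∧ Gallery l (A.L t a)

variable {A}

theorem L_mul (g h : G) (x : E) : A.L (g * h) x = A.L g (A.L h x) := by
  rw [map_mul]; rfl

theorem L_one (x : E) : A.L 1 x = x := by
  rw [map_one]; rfl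

theorem L_L {t : G} (ht : t ∈ A.T) (x : E) : A.L t (A.L t x) = x := by
  rw [← L_mul, A.mul_self t ht, L_one]

theorem Reg.same {a : E} (h : A.Reg a) : A.Same a a := fun t ht => mul_self_pos.2 (h t ht)

theorem Same.symm {a b : E} (h : A.Same a b) : A.Same b a := fun t ht => by
  rw [mul_comm]; exact h t ht

theorem Same.trans {a b c : E} (h : A.Same a b) (h' : A.Same b c) : A.Same a c :=
  fun t ht => pos_mul_trans (h t ht) (h' t ht)

theorem Same.reg {a b : E} (h : A.Same a b) : A.Reg a := fun t ht h0 => by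
  have := h t ht
  rw [h0, zero_mul] at this
  exact lt_irrefl _ this

variable (A) in
theorem isOpen_setOf_same (a : E) : IsOpen {x | A.Same a x} := by
  have : {x | A.Same a x} = ⋂ t ∈ A.T, {x | 0 < A.α t a * A.α t x} := by
    ext; simp [Same]
  rw [this]
  exact A.finite.isOpen_biInter fun t _ =>
    isOpen_lt continuous_const (continuous_const.mul (A.α t).continuous)

variable (A) in
theorem convex_setOf_same (a : E) : Convex ℝ {x | A.Same a x} := by
  have : {x | A.Same a x} = ⋂ t ∈ A.T, (A.α t a • A.α t) ⁻¹' Set.Ioi 0 := by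
    ext; simp [Same]
  rw [this]
  exact convex_iInter₂ fun t _ => (convex_Ioi 0).linear_preimage
    ((A.α t a • A.α t : E →L[ℝ] ℝ) : E →ₗ[ℝ] ℝ)

/-- The action of a reflection permutes the hyperplanes. -/
theorem exists_alpha_apply {s t : G} (hs : s ∈ A.T) (ht : t ∈ A.T) :
    ∃ c : ℝ, c ≠ 0 ∧ ∀ x, A.α s (A.L t x) = c * A.α (t * s * t) x := by
  have hu := A.conj_mem t ht s hs
  have hker : ∀ x, A.α s (A.L t x) = 0 ↔ A.α (t * s * t) x = 0 := by
    intro x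
    rw [← A.fix_iff s hs, ← A.fix_iff _ hu, L_mul, L_mul]
    constructor
    · intro h; rw [h, L_L ht]
    · intro h
      have := congrArg (A.L t) h
      rwa [L_L ht] at this
  obtain ⟨v, hv⟩ : ∃ v, A.α (t * s * t) v ≠ 0 := by
    by_contra! h
    exact A.ne_zero _ hu (ContinuousLinearMap.ext h)
  refine ⟨A.α s (A.L t v) / A.α (t * s * t) v, div_ne_zero (fun h => hv ((hker v).1 h)) hv, ?_⟩
  intro x
  have h0 : A.α (t * s * t) (x - (A.α (t * s * t) x / A.α (t * s * t) v) • v) = 0 := by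
    simp [hv]
  have h1 := (hker _).2 h0
  simp only [map_sub, map_smul, smul_eq_mul, sub_eq_zero] at h1
  rw [h1]; ring

theorem mul_apply_pos {s t : G} (hs : s ∈ A.T) (ht : t ∈ A.T) {a b : E} :
    0 < A.α s (A.L t a) * A.α s (A.L t b) ↔
      0 < A.α (t * s * t) a * A.α (t * s * t) b := by
  obtain ⟨c, hc, h⟩ := exists_alpha_apply hs ht
  rw [h, h]
  have : c * A.α (t * s * t) a * (c * A.α (t * s * t) b)
      = c ^ 2 * (A.α (t * s * t) a * A.α (t * s * t) b) := by ring
  rw [this]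
  exact mul_pos_iff_of_pos_left (by positivity)

theorem Same.apply {a b : E} (h : A.Same a b) {t : G} (ht : t ∈ A.T) :
    A.Same (A.L t a) (A.L t b) := fun s hs =>
  (mul_apply_pos hs ht).2 (h _ (A.conj_mem t ht s hs))

theorem Reg.apply {a : E} (h : A.Reg a) {t : G} (ht : t ∈ A.T) : A.Reg (A.L t a) :=
  (h.same.apply ht).reg

theorem Adj.congr {a b : E} {t : G} (h : A.Adj t a) (ht : t ∈ A.T) (hab : A.Same a b) :
    A.Adj t b := fun s hs hst =>
  pos_mul_trans (pos_mul_trans (hab.symm s hs) (h s hs hst)) (hab.apply ht s hs)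

theorem conj_ne {s t r : G} (ht : t ∈ A.T) (h : s ≠ t * r * t) : t * s * t ≠ r := by
  rintro rfl
  apply h
  have := A.mul_self t ht
  calc s = (t * t) * s * (t * t) := by rw [this]; simp
    _ = _ := by group

theorem Adj.conj {b : E} {s t : G} (h : A.Adj s b) (ht : t ∈ A.T) :
    A.Adj (t * s * t) (A.L t b) := by
  intro r hr hrs
  have h1 : A.L (t * s * t) (A.L t b) = A.L t (A.L s b) := by
    rw [L_mul, L_L ht, L_mul]
  rw [h1, mul_apply_pos hr ht]
  exact h _ (A.conj_mem t ht r hr) (conj_ne ht hrs)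

theorem Gallery.congr : ∀ {l : List G} {a b : E}, A.Gallery l a → A.Same a b → A.Gallery l b
  | [], _, _, _, _ => trivial
  | _ :: _, _, _, h, hab =>
    ⟨h.1, h.2.1.congr h.1 hab, Gallery.congr h.2.2 (hab.apply h.1)⟩

theorem gallery_append : ∀ {l₁ l₂ : List G} {a : E},
    A.Gallery (l₁ ++ l₂) a ↔ A.Gallery l₁ a ∧ A.Gallery l₂ (A.L l₁.reverse.prod a)
  | [], _, _ => by simp [Gallery]
  | t :: l₁, l₂, a => by
    simp only [List.cons_append, Gallery, gallery_append (l₁ := l₁), List.reverse_cons,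
      List.prod_append, List.prod_cons, List.prod_nil, mul_one, L_mul, and_assoc]

theorem Gallery.same_apply : ∀ {l : List G} {a b : E}, A.Gallery l a → A.Same a b →
    A.Same (A.L l.reverse.prod a) (A.L l.reverse.prod b)
  | [], _, _, _, h => by simpa [L_one] using h
  | t :: l, a, b, hl, h => by
    have := Gallery.same_apply hl.2.2 (h.apply hl.1)
    simpa [L_mul] using this

/-- Reflecting a gallery by `t`. -/
theorem Gallery.conj {t : G} (ht : t ∈ A.T) : ∀ {l : List G} {a : E}, A.Gallery l a →
    A.Gallery (l.map fun s => t * s * t) (A.L t a)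
  | [], _, _ => trivial
  | s :: l, a, h => by
    refine ⟨A.conj_mem t ht s h.1, h.2.1.conj ht, ?_⟩
    have h1 : A.L (t * s * t) (A.L t a) = A.L t (A.L s a) := by
      rw [L_mul, L_L ht, L_mul]
    rw [h1]
    exact h.2.2.conj ht

theorem prod_map_conj {t : G} (ht : t ∈ A.T) : ∀ l : List G,
    (l.map fun s => t * s * t).reverse.prod = t * l.reverse.prod * t
  | [] => by simp [A.mul_self t ht]
  | s :: l => by
    simp only [List.map_cons, List.reverse_cons, List.prod_append, List.prod_cons, List.prod_nil,
      mul_one, prod_map_conj ht l]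
    calc t * l.reverse.prod * t * (t * s * t) = t * l.reverse.prod * (t * t) * s * t := by group
      _ = _ := by rw [A.mul_self t ht]; group

theorem Gallery.prod_reverse : ∀ {l : List G} {a : E}, A.Gallery l a →
    l.prod = l.reverse.prod⁻¹
  | [], _, _ => by simp
  | t :: l, a, h => by
    have h1 : t⁻¹ = t := inv_eq_of_mul_eq_one_left (A.mul_self t h.1)
    rw [List.prod_cons, h.2.2.prod_reverse, List.reverse_cons, List.prod_append,
      List.prod_singleton, mul_inv_rev, h1]

theorem Gallery.reverse : ∀ {l : List G} {a : E}, A.Gallery l a →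
    A.Gallery l.reverse (A.L l.reverse.prod a)
  | [], _, _ => trivial
  | t :: l, a, h => by
    have h1 := h.2.2.reverse
    rw [List.reverse_cons, gallery_append]
    have h2 : A.L (l.reverse ++ [t]).prod a = A.L l.reverse.prod (A.L t a) := by
      simp
    have h3 : A.L l.reverse.reverse.prod (A.L l.reverse.prod (A.L t a)) = A.L t a := by
      rw [← L_mul, List.reverse_reverse, h.2.2.prod_reverse]; simp
    rw [h2, h3]
    refine ⟨h1, h.1, ?_, trivial⟩
    intro s hs hst
    rw [L_L h.1, mul_comm]
    exact h.2.1 s hs hst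

/-- A gallery that does not cross the hyperplane of `t` stays on one side of it. -/
theorem Gallery.pos {t : G} (ht : t ∈ A.T) : ∀ {l : List G} {a : E}, A.Gallery l a → A.Reg a →
    t ∉ l → 0 < A.α t a * A.α t (A.L l.reverse.prod a)
  | [], a, _, ha, _ => by simpa [L_one] using ha.same t ht
  | s :: l, a, h, ha, hn => by
    have h1 := Gallery.pos ht h.2.2 (ha.apply h.1) (fun h' => hn (List.mem_cons_of_mem _ h'))
    have h2 := h.2.1 t ht (fun h' => hn (h' ▸ List.mem_cons_self))
    have := pos_mul_trans h2 h1
    simpa [L_mul] using this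

/-- A closed gallery has product `1`. It must cross back the first hyperplane it crosses; reflecting
the part in between gives a closed gallery with the same product and two reflections fewer. -/
theorem Gallery.prod_eq_one {l : List G} {a : E} (h : A.Gallery l a)
    (hc : A.Same a (A.L l.reverse.prod a)) : l.reverse.prod = 1 := by
  induction hn : l.length using Nat.strong_induction_on generalizing l a with
  | _ n ih =>
    match l, h, hc with
    | [], _, _ => simp
    | t :: l, h, hc =>
      have ht := h.1
      have hmem : t ∈ l := by
        by_contra hn
        have h1 := h.2.2.pos ht (hc.reg.apply ht) hn
        have h2 := hc t ht
        rw [A.neg t ht] at h1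
        simp only [List.reverse_cons, List.prod_append, List.prod_cons, List.prod_nil, mul_one,
          L_mul] at h2
        nlinarith
      obtain ⟨l₂, l₃, rfl⟩ := List.append_of_mem hmem
      have hprod : ((l₂.map fun s => t * s * t) ++ l₃).reverse.prod
          = (t :: (l₂ ++ t :: l₃)).reverse.prod := by
        rw [List.reverse_append, List.prod_append, prod_map_conj ht]
        simp only [List.reverse_append, List.prod_append, List.reverse_cons,
          List.prod_cons, List.prod_nil, mul_one, mul_assoc]
      have h2 := gallery_append.1 h.2.2
      have hgal : A.Gallery ((l₂.map fun s => t * s * t) ++ l₃) a := by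
        rw [gallery_append]
        constructor
        · have := h2.1.conj ht
          rwa [L_L ht] at this
        · have := h2.2.2.2
          rw [prod_map_conj ht, L_mul, L_mul]
          exact this
      rw [← hprod] at hc ⊢
      refine ih _ ?_ hgal hc rfl
      rw [← hn]
      simp

/-- Two galleries with the same starting chamber and the same final chamber have the same
product. -/
theorem Gallery.prod_eq {l l' : List G} {a b : E} (h : A.Gallery l a) (h' : A.Gallery l' a)
    (hb : A.Same (A.L l.reverse.prod a) b) (hb' : A.Same (A.L l'.reverse.prod a) b) :
    l.reverse.prod = l'.reverse.prod := by
  have h1 : A.Gallery (l ++ l'.reverse) a :=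
    gallery_append.2 ⟨h, h'.reverse.congr (hb'.trans hb.symm)⟩
  have h2 : (l ++ l'.reverse).reverse.prod = l'.reverse.prod⁻¹ * l.reverse.prod := by
    simp [h'.prod_reverse]
  have h3 : A.Same a (A.L (l ++ l'.reverse).reverse.prod a) := by
    have h4 := h'.reverse.same_apply (hb'.trans hb.symm)
    rw [← L_mul, List.reverse_reverse, h'.prod_reverse, inv_mul_cancel, L_one] at h4
    rw [h2, L_mul]
    exact h4
  have h5 := h1.prod_eq_one h3
  rw [h2, inv_mul_eq_one] at h5
  exact h5.symm

/-- If some hyperplane separates `a` and `b`, then one that separates them is a wall of the chamber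
of `a`: the first one on a generic segment from `a` to the chamber of `b`. -/
theorem exists_wall {a b : E} (ha : A.Reg a) (hb : A.Reg b) (hab : ¬ A.Same a b) :
    ∃ t ∈ A.T, A.Adj t a ∧ A.α t a * A.α t b < 0 := by
  -- a point `b'` in the chamber of `b` such that the segment meets the hyperplanes one at a time
  obtain ⟨b', hbb', hgen⟩ : ∃ b', A.Same b b' ∧ ∀ s ∈ A.T, ∀ t ∈ A.T, s ≠ t →
      A.α s a * A.α t b' ≠ A.α t a * A.α s b' := by
    have hfin : {p : G × G | p.1 ∈ A.T ∧ p.2 ∈ A.T ∧ p.1 ≠ p.2}.Finite :=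
      (A.finite.prod A.finite).subset fun p hp => ⟨hp.1, hp.2.1⟩
    have hd := dense_forall_ne_zero hfin
      (fun p => A.α p.1 a • A.α p.2 - A.α p.2 a • A.α p.1) (by
        rintro ⟨s, t⟩ ⟨hs, ht, hst⟩ h0
        refine A.indep s hs t ht (Ne.symm hst) ((A.α s a)⁻¹ * A.α t a) ?_
        rw [mul_smul, ← sub_eq_zero.1 h0, smul_smul, inv_mul_cancel₀ (ha s hs), one_smul])
    obtain ⟨b', h1, h2⟩ := hd.inter_open_nonempty _ (A.isOpen_setOf_same b) ⟨b, hb.same⟩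
    refine ⟨b', h1, fun s hs t ht hst h => h2 (s, t) ⟨hs, ht, hst⟩ ?_⟩
    simp [h]
  -- crossing parameter on the segment, among the separating hyperplanes
  have hsep : ({t ∈ A.T | A.α t a * A.α t b' < 0}).Nonempty := by
    by_contra h
    rw [Set.not_nonempty_iff_eq_empty] at h
    refine hab (Same.trans (fun t ht => ?_) hbb'.symm)
    have h1 : ¬ A.α t a * A.α t b' < 0 := fun h' =>
      (h ▸ (⟨ht, h'⟩ : t ∈ {t ∈ A.T | _}) : t ∈ (∅ : Set G))
    exact lt_of_le_of_ne (not_lt.1 h1) (mul_ne_zero (ha t ht) (hbb'.symm.reg t ht)).symm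
  let τ : G → ℝ := fun t => A.α t a / (A.α t a - A.α t b')
  obtain ⟨t, ⟨ht, htneg⟩, htmin⟩ :=
    Set.exists_min_image _ τ (A.finite.subset (Set.sep_subset _ _)) hsep
  have htneg' : A.α t a * A.α t b < 0 := by
    have h1 := hbb' t ht
    by_contra h
    have h2 : 0 < A.α t a * A.α t b :=
      lt_of_le_of_ne (not_lt.1 h) (mul_ne_zero (ha t ht) (hb t ht)).symm
    exact absurd (pos_mul_trans h2 h1) (not_lt.2 htneg.le)
  refine ⟨t, ht, ?_, htneg'⟩
  have hden : ∀ {x y : ℝ}, x * y < 0 → x - y ≠ 0 ∧ 0 < x / (x - y) ∧ x / (x - y) < 1 := by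
    intro x y hxy
    have hne : x - y ≠ 0 := by
      intro h
      rw [sub_eq_zero.1 h] at hxy
      nlinarith
    have hsq : 0 < (x - y) ^ 2 := by positivity
    refine ⟨hne, ?_, ?_⟩
    · have : x / (x - y) = x * (x - y) / (x - y) ^ 2 := by field_simp
      rw [this]
      exact div_pos (by nlinarith) hsq
    · have : x / (x - y) = x * (x - y) / (x - y) ^ 2 := by field_simp
      rw [this, div_lt_one hsq]
      nlinarith
  obtain ⟨hd0, hτ0, hτ1⟩ := hden htneg
  -- `z` is the point where the segment meets the hyperplane of `t`
  set z := a + τ t • (b' - a) with hz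
  have hzα : ∀ s, A.α s z = A.α s a + τ t * (A.α s b' - A.α s a) := by
    intro s; simp [hz]
  have hzt : A.α t z = 0 := by
    rw [hzα]; simp only [τ]; field_simp; ring
  have hzs : ∀ s ∈ A.T, s ≠ t → 0 < A.α s a * A.α s z := by
    intro s hs hst
    have has := mul_self_pos.2 (ha s hs)
    rw [hzα]
    rcases lt_trichotomy (A.α s a * A.α s b') 0 with h | h | h
    · obtain ⟨hs0, hs1, hs2⟩ := hden h
      have hle := htmin s ⟨hs, h⟩
      have hne : τ t ≠ τ s := by
        intro he
        simp only [τ] at he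
        rw [div_eq_div_iff hd0 hs0] at he
        apply hgen s hs t ht hst
        linarith
      have hlt : τ t < τ s := lt_of_le_of_ne hle hne
      have hpos : 0 < A.α s a * (A.α s a - A.α s b') := by nlinarith
      have h5 : τ s * (A.α s a * (A.α s a - A.α s b')) = A.α s a * A.α s a := by
        simp only [τ]; field_simp
      nlinarith [mul_lt_mul_of_pos_right hlt hpos]
    · exact absurd h (mul_ne_zero (ha s hs) (hbb'.symm.reg s hs))
    · have e : A.α s a * (A.α s a + τ t * (A.α s b' - A.α s a))
          = (1 - τ t) * (A.α s a * A.α s a) + τ t * (A.α s a * A.α s b') := by ring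
      rw [e]
      have := mul_pos (sub_pos.2 hτ1) has
      have := mul_pos hτ0 h
      linarith
  intro s hs hst
  have hzfix : A.L t z = z := (A.fix_iff t ht z).2 hzt
  have h6 : 0 < A.α s (A.L t a) * A.α s (A.L t z) := by
    rw [mul_apply_pos hs ht]
    refine hzs _ (A.conj_mem t ht s hs) fun h => hst ?_
    have h7 := A.mul_self t ht
    calc s = (t * t) * s * (t * t) := by rw [h7]; simp
      _ = t * (t * s * t) * t := by group
      _ = t := by rw [h, h7, one_mul]
  rw [hzfix, mul_comm] at h6
  exact pos_mul_trans (hzs s hs hst) h6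

/-- Any two regular points are joined by a gallery: as long as some hyperplane separates the current
chamber from the target, one of them is a wall of the current chamber, and crossing it leaves one
separating hyperplane fewer. -/
theorem exists_gallery {a b : E} (ha : A.Reg a) (hb : A.Reg b) :
    ∃ l, A.Gallery l a ∧ A.Same (A.L l.reverse.prod a) b := by
  induction hn : {t ∈ A.T | A.α t a * A.α t b < 0}.ncard using Nat.strong_induction_on
    generalizing a with
  | _ n ih =>
    by_cases hab : A.Same a b
    · exact ⟨[], trivial, by simpa [L_one] using hab⟩
    · obtain ⟨t, ht, hadj, hneg⟩ := exists_wall ha hb hab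
      obtain ⟨l, hl, hl'⟩ := ih {s ∈ A.T | A.α s (A.L t a) * A.α s b < 0}.ncard (by
        rw [← hn]
        refine Set.ncard_lt_ncard ⟨fun s hs => ⟨hs.1, ?_⟩, fun h => ?_⟩
          (A.finite.subset (Set.sep_subset _ _))
        · have h1 := hs.2
          by_cases hst : s = t
          · subst hst
            rw [A.neg s ht] at h1
            nlinarith
          · by_contra h2
            have h3 : 0 < A.α s a * A.α s b :=
              lt_of_le_of_ne (not_lt.1 h2) (mul_ne_zero (ha s hs.1) (hb s hs.1)).symm
            have h4 := hadj s hs.1 hst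
            rw [mul_comm] at h4
            exact absurd (pos_mul_trans h4 h3) (not_lt.2 h1.le)
        · have h1 := (h ⟨ht, hneg⟩).2
          rw [A.neg t ht] at h1
          nlinarith) (ha.apply ht) rfl
      exact ⟨t :: l, ⟨ht, hadj, hl⟩, by simpa [L_mul] using hl'⟩

/-- Every reflection of the arrangement is the product of a gallery: go to its hyperplane, cross it,
and return along the mirror image of the way there. -/
theorem exists_gallery_reflection {a : E} (ha : A.Reg a) {t : G} (ht : t ∈ A.T) :
    ∃ l, A.Gallery l a ∧ l.reverse.prod = t := by
  obtain ⟨l, hl, hl'⟩ := exists_gallery ha (ha.apply ht)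
  have hmem : t ∈ l := by
    by_contra hn
    have h1 := hl.pos ht ha hn
    have h2 := hl' t ht
    rw [A.neg t ht] at h2
    have := mul_self_pos.2 (ha t ht)
    have h3 := pos_mul_trans h1 h2
    nlinarith
  obtain ⟨l₁, l₂, rfl⟩ := List.append_of_mem hmem
  have h := gallery_append.1 hl
  have hrev := (h.1.reverse).conj ht
  refine ⟨l₁ ++ t :: (l₁.reverse.map fun s => t * s * t), ?_, ?_⟩
  · rw [gallery_append]
    exact ⟨h.1, ht, h.2.2.1, hrev⟩
  · have h7 := A.mul_self t ht
    rw [List.reverse_append, List.prod_append, List.reverse_cons, List.prod_append,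
      prod_map_conj ht, List.reverse_reverse, h.1.prod_reverse]
    simp only [List.prod_cons, List.prod_nil, mul_one]
    calc t * l₁.reverse.prod⁻¹ * t * t * l₁.reverse.prod
        = t * l₁.reverse.prod⁻¹ * (t * t) * l₁.reverse.prod := by group
      _ = t := by rw [h7]; group

variable (A) in
/-- The group element that leads from a fixed chamber to the chamber of a given point: a
`T`-equivariant function, constant on chambers. Its existence is the freeness of the action of the
group generated by `T` on the chambers. -/
theorem exists_equivariant : ∃ f : E → G, (∀ x y, A.Same x y → f x = f y) ∧
    (∀ t ∈ A.T, ∀ x, A.Reg x → f (A.L t x) = t * f x) := by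
  classical
  by_cases hne : ∃ a, A.Reg a
  · obtain ⟨a, ha⟩ := hne
    have key : ∀ x, ∃ g : G, A.Reg x → ∃ l, A.Gallery l a ∧ A.Same (A.L l.reverse.prod a) x ∧
        l.reverse.prod = g := by
      intro x
      by_cases hx : A.Reg x
      · obtain ⟨l, h, h'⟩ := exists_gallery ha hx
        exact ⟨_, fun _ => ⟨l, h, h', rfl⟩⟩
      · exact ⟨1, fun h => absurd h hx⟩
    choose f hf using key
    refine ⟨f, fun x y hxy => ?_, fun t ht x hx => ?_⟩
    · obtain ⟨l, h1, h2, h3⟩ := hf x hxy.reg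
      obtain ⟨l', h1', h2', h3'⟩ := hf y hxy.symm.reg
      rw [← h3, ← h3']
      exact h1.prod_eq h1' (h2.trans hxy) h2'
    · obtain ⟨l, h1, h2, h3⟩ := hf x hx
      obtain ⟨l', h1', h2', h3'⟩ := hf _ (hx.apply ht)
      obtain ⟨m, hm, hm'⟩ := exists_gallery_reflection ha ht
      have h7 := A.mul_self t ht
      have hp : (m ++ l.map fun s => t * s * t).reverse.prod = t * f x := by
        rw [List.reverse_append, List.prod_append, prod_map_conj ht, hm', mul_assoc, h7, h3,
          mul_one]
      have hg : A.Gallery (m ++ l.map fun s => t * s * t) a := by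
        rw [gallery_append, hm']
        exact ⟨hm, h1.conj ht⟩
      rw [← hp, ← h3']
      refine h1'.prod_eq hg h2' ?_
      rw [hp, L_mul, ← h3]
      exact h2.apply ht
  · push Not at hne
    exact ⟨fun _ => 1, fun _ _ _ => rfl, fun t _ x hx => absurd hx (hne x)⟩

/-- A function on the regular points of an invariant set that is constant on chambers and
`T`-invariant is constant. -/
theorem eq_of_invariant {X : Type*} {B : Set E} (hB : ∀ t ∈ A.T, ∀ x ∈ B, A.L t x ∈ B)
    {h : E → X} (hsame : ∀ x ∈ B, ∀ y ∈ B, A.Same x y → h x = h y)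
    (hinv : ∀ t ∈ A.T, ∀ x ∈ B, A.Reg x → h (A.L t x) = h x)
    {a b : E} (haB : a ∈ B) (hbB : b ∈ B) (ha : A.Reg a) (hb : A.Reg b) : h a = h b := by
  obtain ⟨l, hl, hl'⟩ := exists_gallery ha hb
  have key : ∀ (l : List G) (a : E), A.Gallery l a → A.Reg a → a ∈ B →
      A.L l.reverse.prod a ∈ B ∧ h (A.L l.reverse.prod a) = h a := by
    intro l
    induction l with
    | nil => intro a _ _ haB; simpa [L_one] using haB
    | cons t l ih =>
      intro a hl ha haB
      have := ih _ hl.2.2 (ha.apply hl.1) (hB t hl.1 a haB)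
      simp only [List.reverse_cons, List.prod_append, List.prod_cons, List.prod_nil, mul_one,
        L_mul]
      exact ⟨this.1, this.2.trans (hinv t hl.1 a haB ha)⟩
  obtain ⟨h1, h2⟩ := key l a hl ha haB
  rw [← h2]
  exact hsame _ h1 _ hbB hl'

end ReflectionArrangement

/-! ### Discrete groups of isometries act properly discontinuously -/

/-- A group of isometries of a connected locally compact space that is discrete for uniform
convergence on compact sets has locally finite orbits. If `g • x` stays in a compact set along an
ultrafilter on the group, then by connectedness `g • z` converges along the ultrafilter for every
`z`; by equicontinuity `g⁻¹ * h` is then eventually as close to `1` as desired on a given compact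
set, so the ultrafilter is principal. -/
theorem exists_finite_setOf_edist_smul_lt {X G : Type*} [EMetricSpace X] [LocallyCompactSpace X]
    [PreconnectedSpace X] [Group G] [MulAction G X]
    (hiso : ∀ (g : G) (x y : X), edist (g • x) (g • y) = edist x y)
    {K : Set X} (hK : IsCompact K) {ε : ENNReal} (hε : 0 < ε)
    (hdisc : ∀ g : G, (∀ x ∈ K, edist (g • x) x < ε) → g = 1) (x y : X) :
    ∃ δ > 0, {g : G | edist (g • x) y < δ}.Finite := by
  have hball : ∀ z : X, ∃ δ > 0, ∃ C, IsCompact C ∧ Metric.eball z δ ⊆ C := by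
    intro z
    obtain ⟨C, hC, hz⟩ := exists_compact_mem_nhds z
    obtain ⟨δ, h1, h2⟩ := EMetric.mem_nhds_iff.1 hz
    exact ⟨δ, h1, C, hC, h2⟩
  have hcont : ∀ g : G, Continuous fun x : X => g • x := fun g =>
    (show Isometry (fun x : X => g • x) from hiso g).continuous
  have hquarter : ∀ δ : ENNReal, δ / 2 / 2 + δ / 2 / 2 + (δ / 2 / 2 + δ / 2 / 2) = δ := by
    intro δ; rw [ENNReal.add_halves, ENNReal.add_halves]
  have hqpos : ∀ {δ : ENNReal}, 0 < δ → 0 < δ / 2 / 2 := fun h =>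
    ENNReal.half_pos (ENNReal.half_pos h.ne').ne'
  -- an ultrafilter along which some orbit converges is principal
  have key : ∀ (𝓤 : Ultrafilter G) (x y : X), Tendsto (fun g : G => g • x) 𝓤 (𝓝 y) →
      ∃ g : G, {g} ∈ 𝓤 := by
    intro 𝓤 x y hxy
    have hstep : ∀ (z z' y' : X) (δ : ENNReal) (C : Set X), IsCompact C → Metric.eball z δ ⊆ C →
        edist z z' < δ / 2 / 2 → Tendsto (fun g : G => g • z') 𝓤 (𝓝 y') →
        ∃ y, Tendsto (fun g : G => g • z) 𝓤 (𝓝 y) := by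
      intro z z' y' δ C hC hδC hzz' ht
      have hδ : 0 < δ / 2 / 2 := lt_of_le_of_lt (zero_le) hzz'
      have hev : ∀ᶠ g : G in 𝓤, edist (g • z') y' < δ / 2 / 2 :=
        ht (Metric.eball_mem_nhds y' hδ)
      obtain ⟨g₀, hg₀⟩ := hev.exists
      have hev' : ∀ᶠ g : G in 𝓤, g • z ∈ (fun x => g₀ • x) '' C := by
        filter_upwards [hev] with g hg
        refine ⟨g₀⁻¹ • g • z, hδC ?_, smul_inv_smul g₀ _⟩
        rw [Metric.mem_eball, ← hiso g₀, smul_inv_smul, ← hquarter δ]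
        calc edist (g • z) (g₀ • z)
            ≤ edist (g • z) (g • z') + edist (g • z') y'
              + (edist y' (g₀ • z') + edist (g₀ • z') (g₀ • z)) := by
              refine (edist_triangle _ y' _).trans ?_
              gcongr <;> exact edist_triangle _ _ _
          _ < _ := by
              rw [hiso, hiso, edist_comm y', edist_comm z' z]
              exact ENNReal.add_lt_add (ENNReal.add_lt_add hzz' hg) (ENNReal.add_lt_add hg₀ hzz')
      obtain ⟨y, -, hy⟩ := (hC.image (hcont g₀)).ultrafilter_le_nhds (𝓤.map fun g => g • z)
        (le_principal_iff.2 hev')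
      exact ⟨y, hy⟩
    have hall : ∀ z : X, ∃ y, Tendsto (fun g : G => g • z) 𝓤 (𝓝 y) := by
      have hcl : IsClopen {z : X | ∃ y, Tendsto (fun g : G => g • z) 𝓤 (𝓝 y)} := by
        constructor
        · refine isClosed_of_closure_subset fun z hz => ?_
          obtain ⟨δ, hδ, C, hC, hδC⟩ := hball z
          obtain ⟨z', hz', y', hy'⟩ := mem_closure_iff_nhds.1 hz _
            (Metric.eball_mem_nhds z (hqpos hδ))
          exact hstep z z' y' δ C hC hδC (by rwa [edist_comm]) hy'
        · rw [isOpen_iff_mem_nhds]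
          rintro z ⟨y, hy⟩
          obtain ⟨δ, hδ, C, hC, hδC⟩ := hball y
          filter_upwards [Metric.eball_mem_nhds z (hqpos hδ)] with z' hz'
          have hev : ∀ᶠ g : G in 𝓤, g • z' ∈ C := by
            filter_upwards [hy (Metric.eball_mem_nhds y (hqpos hδ))] with g hg
            apply hδC
            rw [Metric.mem_eball, ← hquarter δ]
            calc edist (g • z') y ≤ edist (g • z') (g • z) + edist (g • z) y :=
                  edist_triangle _ _ _
              _ < δ / 2 / 2 + δ / 2 / 2 := by
                  rw [hiso]; exact ENNReal.add_lt_add hz' hg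
              _ ≤ _ := le_self_add
          obtain ⟨y', -, hy'⟩ := hC.ultrafilter_le_nhds (𝓤.map fun g => g • z')
            (le_principal_iff.2 hev)
          exact ⟨y', hy'⟩
      have := hcl.eq_univ ⟨x, y, hxy⟩
      intro z
      exact this.ge (mem_univ z)
    choose f hf using hall
    obtain ⟨t, -, htK⟩ := hK.elim_nhds_subcover (fun z => Metric.eball z (ε / 2 / 2 / 2))
      (fun z _ => Metric.eball_mem_nhds z (ENNReal.half_pos (hqpos hε).ne'))
    have hS : ∀ᶠ g : G in 𝓤, ∀ z ∈ t, edist (g • z) (f z) < ε / 2 / 2 / 2 := by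
      rw [eventually_all_finset]
      intro z _
      exact hf z (Metric.eball_mem_nhds _ (ENNReal.half_pos (hqpos hε).ne'))
    have hclose : ∀ᶠ g : G in 𝓤, ∀ x ∈ K, ∃ z ∈ t, edist (g • x) (f z) < ε / 2 / 2 ∧
        ∀ h : G, edist (h • z) (f z) < ε / 2 / 2 / 2 → edist (h • x) (f z) < ε / 2 / 2 := by
      filter_upwards [hS] with g hg x hx
      obtain ⟨z, hz, hxz⟩ := mem_iUnion₂.1 (htK hx)
      have : ∀ h : G, edist (h • z) (f z) < ε / 2 / 2 / 2 → edist (h • x) (f z) < ε / 2 / 2 := by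
        intro h hh
        calc edist (h • x) (f z) ≤ edist (h • x) (h • z) + edist (h • z) (f z) :=
              edist_triangle _ _ _
          _ < ε / 2 / 2 / 2 + ε / 2 / 2 / 2 := by
              rw [hiso]; exact ENNReal.add_lt_add hxz hh
          _ = _ := ENNReal.add_halves _
      exact ⟨z, hz, this g (hg z hz), this⟩
    obtain ⟨g, hg1, hg2⟩ := (hclose.and hS).exists
    refine ⟨g, ?_⟩
    filter_upwards [hS] with h hh
    have : g⁻¹ * h = 1 := by
      apply hdisc
      intro x hx
      obtain ⟨z, hz, h1, h2⟩ := hg1 x hx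
      rw [← hiso g, mul_smul, smul_inv_smul, ← hquarter ε]
      calc edist (h • x) (g • x) ≤ edist (h • x) (f z) + edist (f z) (g • x) :=
            edist_triangle _ _ _
        _ < ε / 2 / 2 + ε / 2 / 2 := by
            rw [edist_comm (f z)]
            exact ENNReal.add_lt_add (h2 h (hh z hz)) h1
        _ ≤ _ := le_self_add
    exact (inv_mul_eq_one.1 this).symm
  obtain ⟨δ, hδ, C, hC, hδC⟩ := hball y
  refine ⟨δ, hδ, ?_⟩
  by_contra hinf
  have hne := Set.Infinite.cofinite_inf_principal_neBot hinf
  obtain ⟨y', -, hy'⟩ := hC.ultrafilter_le_nhds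
    ((Ultrafilter.of (cofinite ⊓ 𝓟 {g : G | edist (g • x) y < δ})).map fun g => g • x)
    (le_principal_iff.2 (by
      have : {g : G | edist (g • x) y < δ} ∈
          Ultrafilter.of (cofinite ⊓ 𝓟 {g : G | edist (g • x) y < δ}) :=
        Ultrafilter.of_le _ (mem_inf_of_right (mem_principal_self _))
      exact mem_of_superset this fun g hg => hδC hg))
  obtain ⟨g, hg⟩ := key _ _ _ hy'
  have hg' : ({g} : Set G)ᶜ ∈ Ultrafilter.of (cofinite ⊓ 𝓟 {g : G | edist (g • x) y < δ}) :=
    Ultrafilter.of_le _ (mem_inf_of_left (by simp))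
  exact Ultrafilter.compl_notMem_iff.2 hg hg'

section

variable {E : Type*} [NormedAddCommGroup E] [NormedSpace ℝ E]
  {M : Type*} [TopologicalSpace M] [ChartedSpace E M] [IsManifold 𝓘(ℝ, E) ∞ M]

open Manifold Bundle in
/-- A map that preserves the metric does not increase the Riemannian distance. -/
theorem PreservesMetric.riemannianEDist_le {g : SmoothMetric E M} {f : M → M}
    (hf : PreservesMetric g g f) (x y : M) :
    letI : Bundle.RiemannianBundle (fun x : M => TangentSpace 𝓘(ℝ, E) x) := ⟨g.toRiemannianMetric⟩
    riemannianEDist 𝓘(ℝ, E) (f x) (f y) ≤ riemannianEDist 𝓘(ℝ, E) x y := by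
  let : Bundle.RiemannianBundle (fun x : M => TangentSpace 𝓘(ℝ, E) x) := ⟨g.toRiemannianMetric⟩
  have hnorm : ∀ (z : M) (v : TangentSpace 𝓘(ℝ, E) z),
      ‖mfderiv 𝓘(ℝ, E) 𝓘(ℝ, E) f z v‖ₑ = ‖v‖ₑ := by
    intro z v
    have h := hf.inner_eq z v v
    have h1 : ∀ (z : M) (v : TangentSpace 𝓘(ℝ, E) z), g.inner z v v = ‖v‖ ^ 2 := fun z v =>
      real_inner_self_eq_norm_sq v
    rw [h1, h1] at h
    have h2 := (pow_left_inj₀ (norm_nonneg _) (norm_nonneg _) two_ne_zero).1 h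
    rw [← ofReal_norm, ← ofReal_norm, h2]
  refine le_of_forall_gt fun r hr => ?_
  obtain ⟨γ, h0, h1, hγ, hlen⟩ := exists_lt_of_riemannianEDist_lt hr
  refine lt_of_le_of_lt (riemannianEDist_le_pathELength (γ := f ∘ γ) (a := 0) (b := 1)
    ?_ (by simp [h0]) (by simp [h1]) zero_le_one) ?_
  · exact (hf.contMDiff.of_le (by simp)).comp_contMDiffOn hγ
  · convert hlen using 1
    rw [pathELength_eq_lintegral_mfderivWithin_Icc, pathELength_eq_lintegral_mfderivWithin_Icc]
    refine MeasureTheory.setLIntegral_congr_fun measurableSet_Icc fun t ht => ?_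
    have hc : mfderivWithin 𝓘(ℝ, ℝ) 𝓘(ℝ, E) (f ∘ γ) (Icc 0 1) t
        = (mfderiv 𝓘(ℝ, E) 𝓘(ℝ, E) f (γ t)).comp
          (mfderivWithin 𝓘(ℝ, ℝ) 𝓘(ℝ, E) γ (Icc 0 1) t) := by
      refine mfderiv_comp_mfderivWithin t (hf.contMDiff.mdifferentiableAt (by simp))
        (hγ.mdifferentiableOn (by simp) t ht) ?_
      exact (uniqueDiffOn_Icc zero_lt_one t ht).uniqueMDiffWithinAt
    simp only [hc]
    exact hnorm _ _

open scoped Bundle in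
/-- A discrete group of isometries of a connected Riemannian manifold acts properly
discontinuously. -/
theorem exists_nhds_finite_of_discrete [FiniteDimensional ℝ E] [T2Space M] [ConnectedSpace M]
    {g : SmoothMetric E M} {W : Subgroup (Isom g)} (hW : DiscreteTopology W) (x y : M) :
    ∃ U ∈ 𝓝 x, ∃ V ∈ 𝓝 y, {w : W | ∃ z ∈ U, w.1.1 z ∈ V}.Finite := by
  let : Bundle.RiemannianBundle (fun x : M => TangentSpace 𝓘(ℝ, E) x) := ⟨g.toRiemannianMetric⟩
  have : IsContinuousRiemannianBundle E (fun x : M => TangentSpace 𝓘(ℝ, E) x) :=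
    ⟨⟨g.inner, g.contMDiff.continuous, fun _ _ _ => rfl⟩⟩
  have : IsManifold 𝓘(ℝ, E) 1 M := IsManifold.of_le (n := ∞) (by simp)
  have : LocallyCompactSpace M := Manifold.locallyCompact_of_finiteDimensional 𝓘(ℝ, E)
  let : EMetricSpace M := EMetricSpace.ofRiemannianMetric 𝓘(ℝ, E) M
  let : MulAction W M :=
    { smul := fun w x => w.1.1 x
      one_smul := fun _ => rfl
      mul_smul := fun _ _ _ => rfl }
  have hle : ∀ (w : W) (x y : M), edist (w • x) (w • y) ≤ edist x y := fun w x y =>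
    w.1.2.1.riemannianEDist_le x y
  have hiso : ∀ (w : W) (x y : M), edist (w • x) (w • y) = edist x y := by
    intro w x y
    refine le_antisymm (hle w x y) ?_
    conv_lhs => rw [← inv_smul_smul w x, ← inv_smul_smul w y]
    exact hle _ _ _
  obtain ⟨K, hK, ε, hε, hdisc⟩ : ∃ K : Set M, IsCompact K ∧ ∃ ε > (0 : ENNReal),
      ∀ w : W, (∀ x ∈ K, edist (w • x) x < ε) → w = 1 := by
    have h1 : IsOpen ({1} : Set W) := isOpen_discrete _
    obtain ⟨S, hS, hS1⟩ := isOpen_induced_iff.1 h1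
    obtain ⟨S', hS', rfl⟩ := isOpen_induced_iff.1 hS
    have hmem : S' ∈ 𝓝 (⟨fun x => (1 : Isom g).1 x, (1 : Isom g).1.continuous⟩ : C(M, M)) := by
      refine hS'.mem_nhds ?_
      have : (1 : W) ∈ ({1} : Set W) := rfl
      rw [← hS1] at this
      exact this
    obtain ⟨⟨K, V⟩, ⟨hK, hV⟩, hKV⟩ :=
      (nhds_basis_uniformity ContinuousMap.hasBasis_compactConvergenceUniformity).mem_iff.1 hmem
    obtain ⟨ε, hε, hεV⟩ := mem_uniformity_edist.1 hV
    refine ⟨K, hK, ε, hε, fun w hw => ?_⟩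
    have : w ∈ ({1} : Set W) := by
      rw [← hS1]
      exact hKV fun x hx => hεV (hw x hx)
    exact this
  obtain ⟨δ, hδ, hfin⟩ := exists_finite_setOf_edist_smul_lt hiso hK hε hdisc x y
  refine ⟨Metric.eball x (δ / 2), Metric.eball_mem_nhds x (ENNReal.half_pos hδ.ne'),
    Metric.eball y (δ / 2), Metric.eball_mem_nhds y (ENNReal.half_pos hδ.ne'), hfin.subset ?_⟩
  rintro w ⟨z, hz, hwz⟩
  calc edist (w • x) y ≤ edist (w • x) (w • z) + edist (w • z) y := edist_triangle _ _ _
    _ < δ / 2 + δ / 2 := by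
      rw [hiso, edist_comm x z]
      exact ENNReal.add_lt_add hz hwz
    _ = δ := ENNReal.add_halves δ

end

section

variable {E : Type*} [NormedAddCommGroup E] [NormedSpace ℝ E]
  {M : Type*} [TopologicalSpace M] [ChartedSpace E M]

/-! ### Linearization of finite group actions -/

theorem mem_contDiffGroupoid_of_contDiffOn {e : OpenPartialHomeomorph E E}
    (h : ContDiffOn ℝ ∞ e e.source) (h' : ContDiffOn ℝ ∞ e.symm e.target) :
    e ∈ contDiffGroupoid ∞ 𝓘(ℝ, E) := by
  rw [contDiffGroupoid, mem_groupoid_of_pregroupoid]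
  constructor
  · simpa [contDiffPregroupoid] using h
  · simpa [contDiffPregroupoid] using h'

/-- A local homeomorphism to the model space is a chart if it is smooth in both directions. -/
theorem mem_maximalAtlas_of_contMDiffOn [IsManifold 𝓘(ℝ, E) ∞ M] {e : OpenPartialHomeomorph M E}
    (h : ContMDiffOn 𝓘(ℝ, E) 𝓘(ℝ, E) ∞ e e.source)
    (h' : ContMDiffOn 𝓘(ℝ, E) 𝓘(ℝ, E) ∞ e.symm e.target) :
    e ∈ IsManifold.maximalAtlas 𝓘(ℝ, E) ∞ M := by
  intro f hf
  have hf' := IsManifold.subset_maximalAtlas (I := 𝓘(ℝ, E)) (n := ∞) hf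
  have h1 := contMDiffOn_of_mem_maximalAtlas hf'
  have h2 := contMDiffOn_symm_of_mem_maximalAtlas hf'
  have a : ContDiffOn ℝ ∞ (e.symm ≫ₕ f) (e.symm ≫ₕ f).source := by
    rw [← contMDiffOn_iff_contDiffOn]
    exact (h1.comp (h'.mono (by intro y hy; exact hy.1)) (by intro y hy; exact hy.2))
  have b : ContDiffOn ℝ ∞ (f.symm ≫ₕ e) (f.symm ≫ₕ e).source := by
    rw [← contMDiffOn_iff_contDiffOn]
    exact (h.comp (h2.mono (by intro y hy; exact hy.1)) (by intro y hy; exact hy.2))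
  have hs : (e.symm ≫ₕ f).symm = f.symm ≫ₕ e := by
    rw [OpenPartialHomeomorph.trans_symm_eq_symm_trans_symm, OpenPartialHomeomorph.symm_symm]
  have hs' : (f.symm ≫ₕ e).symm = e.symm ≫ₕ f := by
    rw [OpenPartialHomeomorph.trans_symm_eq_symm_trans_symm, OpenPartialHomeomorph.symm_symm]
  constructor
  · refine mem_contDiffGroupoid_of_contDiffOn a ?_
    rw [hs]
    convert b using 1
    rw [← hs]; rfl
  · refine mem_contDiffGroupoid_of_contDiffOn b ?_
    rw [hs']
    convert a using 1
    rw [← hs']; rfl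

/-- Near a fixed point of a finite group of diffeomorphisms there are arbitrarily small invariant
charts, with convex image, in which the group acts linearly (Bochner). The chart is the average
`y ↦ |G|⁻¹ ∑ g, (A g)⁻¹ (ψ (g y) - ψ x)` of the translates of a chart `ψ`, where `A g` is the
derivative of `g` at `x` read in `ψ`. -/
theorem exists_linear_chart [CompleteSpace E] [IsManifold 𝓘(ℝ, E) ∞ M]
    {G : Type*} [Group G] [Finite G] (θ : G →* (M ≃ₜ M))
    (hθ : ∀ g, ContMDiff 𝓘(ℝ, E) 𝓘(ℝ, E) ∞ fun y => θ g y) {x : M} (hx : ∀ g, θ g x = x)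
    {O : Set M} (hO : O ∈ 𝓝 x) :
    ∃ φ ∈ IsManifold.maximalAtlas 𝓘(ℝ, E) ∞ M, ∃ L : G →* (E →L[ℝ] E),
      x ∈ φ.source ∧ φ.source ⊆ O ∧ φ x = 0 ∧ Convex ℝ φ.target ∧
      ∀ g, ∀ y ∈ φ.source, θ g y ∈ φ.source ∧ φ (θ g y) = L g (φ y) := by
  classical
  have := Fintype.ofFinite G
  have hmul : ∀ g h y, θ (g * h) y = θ g (θ h y) := fun g h y => by rw [map_mul]; rfl
  have hone : ∀ y, θ 1 y = y := fun y => by rw [map_one]; rfl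
  set ψ := chartAt E x with hψ
  have hxψ : x ∈ ψ.source := mem_chart_source E x
  have hψs : ContMDiffOn 𝓘(ℝ, E) 𝓘(ℝ, E) ∞ ψ ψ.source := contMDiffOn_chart
  have hψi : ContMDiffOn 𝓘(ℝ, E) 𝓘(ℝ, E) ∞ ψ.symm ψ.target := contMDiffOn_chart_symm
  -- the invariant open set on which all translates of `ψ` are defined
  have hinter : ∀ S : Set M, IsOpen S → IsOpen (⋂ g, θ g ⁻¹' S) := fun S hS =>
    isOpen_iInter_of_finite fun g => hS.preimage (θ g).continuous
  have hinv : ∀ (S : Set M) (g : G) (y : M), y ∈ ⋂ g, θ g ⁻¹' S → θ g y ∈ ⋂ g, θ g ⁻¹' S := by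
    intro S g y hy
    rw [mem_iInter] at hy ⊢
    intro h
    rw [mem_preimage, ← hmul]
    exact hy (h * g)
  have hsub : ∀ S : Set M, (⋂ g, θ g ⁻¹' S) ⊆ S := fun S y hy => by
    have := mem_iInter.1 hy 1
    rwa [mem_preimage, hone] at this
  set O₁ : Set M := ⋂ g, θ g ⁻¹' ψ.source with hO₁
  have hO₁o : IsOpen O₁ := hinter _ ψ.open_source
  have hxO₁ : x ∈ O₁ := mem_iInter.2 fun g => by rw [mem_preimage, hx]; exact hxψ
  set D : Set E := ψ.target ∩ ψ.symm ⁻¹' O₁ with hD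
  have hDo : IsOpen D := ψ.isOpen_inter_preimage_symm hO₁o
  have hxD : ψ x ∈ D := ⟨ψ.map_source hxψ, by rw [mem_preimage, ψ.left_inv hxψ]; exact hxO₁⟩
  let T : G → E → E := fun g u => ψ (θ g (ψ.symm u))
  have hT : ∀ g, ContDiffOn ℝ ∞ (T g) D := by
    intro g
    rw [← contMDiffOn_iff_contDiffOn]
    refine hψs.comp (t := ψ.source) ((hθ g).comp_contMDiffOn (hψi.mono inter_subset_left)) ?_
    intro u hu
    exact mem_iInter.1 hu.2 g
  have hTx : ∀ g, T g (ψ x) = ψ x := fun g => by simp only [T, ψ.left_inv hxψ, hx]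
  have hTat : ∀ g, HasFDerivAt (T g) (fderiv ℝ (T g) (ψ x)) (ψ x) := fun g =>
    (((hT g).contDiffAt (hDo.mem_nhds hxD)).differentiableAt (by simp)).hasFDerivAt
  let A : G →* (E →L[ℝ] E) :=
    { toFun := fun g => fderiv ℝ (T g) (ψ x)
      map_one' := by
        have : T 1 =ᶠ[𝓝 (ψ x)] id := by
          filter_upwards [hDo.mem_nhds hxD] with u hu
          simp only [T, hone, ψ.right_inv hu.1, id]
        rw [this.fderiv_eq, fderiv_id]; rfl
      map_mul' := by
        intro g h
        have h1 : T (g * h) =ᶠ[𝓝 (ψ x)] T g ∘ T h := by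
          filter_upwards [hDo.mem_nhds hxD] with u hu
          have h2 : θ h (ψ.symm u) ∈ ψ.source := mem_iInter.1 hu.2 h
          simp only [T, Function.comp, ψ.left_inv h2, hmul]
        have h2 : HasFDerivAt (T g) (fderiv ℝ (T g) (ψ x)) (T h (ψ x)) := by
          rw [hTx]; exact hTat g
        rw [h1.fderiv_eq, (h2.comp _ (hTat h)).fderiv]; rfl }
  have hA : ∀ g h v, A g (A h v) = A (g * h) v := fun g h v => by rw [map_mul]; rfl
  have hA1 : ∀ v, A 1 v = v := fun v => by rw [map_one]; rfl
  -- the averaged chart, read in `ψ`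
  let F : E → E := fun u => ((Fintype.card G : ℝ)⁻¹) • ∑ g, A g⁻¹ (T g u - ψ x)
  have hcard : (Fintype.card G : ℝ) ≠ 0 := by exact_mod_cast Fintype.card_ne_zero
  have hF : ContDiffOn ℝ ∞ F D := by
    refine contDiffOn_const.smul (ContDiffOn.sum fun g _ => ?_)
    exact (A g⁻¹).contDiff.comp_contDiffOn ((hT g).sub contDiffOn_const)
  have hFx : F (ψ x) = 0 := by simp [F, hTx]
  have hF' : HasFDerivAt F (ContinuousLinearEquiv.refl ℝ E : E →L[ℝ] E) (ψ x) := by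
    have h1 : HasFDerivAt F ((Fintype.card G : ℝ)⁻¹ • ∑ g, (A g⁻¹).comp (A g)) (ψ x) := by
      refine HasFDerivAt.const_smul (HasFDerivAt.fun_sum fun g _ => ?_) _
      exact (A g⁻¹).hasFDerivAt.comp _ ((hTat g).sub_const _)
    convert h1 using 1
    ext v
    have : ∀ g, A g⁻¹ (A g v) = v := fun g => by rw [hA, inv_mul_cancel, hA1]
    simp [this, hcard, Finset.card_univ, ← Nat.cast_smul_eq_nsmul ℝ, smul_smul]
  have hFat : ContDiffAt ℝ ∞ F (ψ x) := hF.contDiffAt (hDo.mem_nhds hxD)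
  let e := hFat.toOpenPartialHomeomorph F hF' (by simp)
  have hecoe : ∀ u, e u = F u := fun u => rfl
  have hex : ψ x ∈ e.source := hFat.mem_toOpenPartialHomeomorph_source hF' (by simp)
  -- the open set on which the derivative of the averaged chart is invertible
  let D' : Set E := D ∩ fderiv ℝ F ⁻¹' range ((↑) : (E ≃L[ℝ] E) → E →L[ℝ] E)
  have hD'o : IsOpen D' := by
    refine (hF.continuousOn_fderiv_of_isOpen hDo (by simp)).isOpen_inter_preimage hDo ?_
    exact ContinuousLinearEquiv.isOpen
  have hxD' : ψ x ∈ D' := ⟨hxD, ⟨ContinuousLinearEquiv.refl ℝ E, hF'.fderiv.symm⟩⟩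
  let e' := e.restrOpen D' hD'o
  have he's : e'.source = e.source ∩ D' := e.restrOpen_source D' hD'o
  have he'inv : ContDiffOn ℝ ∞ e'.symm e'.target := by
    intro v hv
    have hu := e'.map_target hv
    obtain ⟨f', hf'⟩ := (he's ▸ hu).2.2
    refine (OpenPartialHomeomorph.contDiffAt_symm e' (f₀' := f') hv ?_ ?_).contDiffWithinAt
    · rw [hf']
      exact ((hF.contDiffAt (hDo.mem_nhds (he's ▸ hu).2.1)).differentiableAt (by simp)).hasFDerivAt
    · exact hF.contDiffAt (hDo.mem_nhds (he's ▸ hu).2.1)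
  let φ₀ := ψ ≫ₕ e'
  have hφ₀s : φ₀.source = ψ.source ∩ ψ ⁻¹' (e.source ∩ D') := by
    rw [OpenPartialHomeomorph.trans_source, he's]
  have hφ₀ : ∀ y, φ₀ y = F (ψ y) := fun y => rfl
  have hxφ₀ : x ∈ φ₀.source := by rw [hφ₀s]; exact ⟨hxψ, hex, hxD'⟩
  have hφ₀O₁ : φ₀.source ⊆ O₁ := by
    intro y hy
    rw [hφ₀s] at hy
    have := hy.2.2.1.2
    rwa [mem_preimage, ψ.left_inv hy.1] at this
  have hequiv : ∀ h, ∀ y ∈ O₁, F (ψ (θ h y)) = A h (F (ψ y)) := by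
    intro h y hy
    simp only [F, map_smul, map_sum]
    congr 1
    rw [← Equiv.sum_comp (Equiv.mulRight h) (fun g => A h (A g⁻¹ (T g (ψ y) - ψ x)))]
    refine Finset.sum_congr rfl fun g _ => ?_
    rw [Equiv.coe_mulRight, hA]
    simp only [T]
    rw [ψ.left_inv (hsub _ hy), ψ.left_inv (mem_iInter.1 hy h), hmul]
    congr 2
    simp
  have hφ₀smooth : ContMDiffOn 𝓘(ℝ, E) 𝓘(ℝ, E) ∞ φ₀ φ₀.source := by
    refine (contMDiffOn_iff_contDiffOn.2 hF).comp (t := D) (hψs.mono ?_) ?_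
    · rw [hφ₀s]; exact inter_subset_left
    · intro y hy
      rw [hφ₀s] at hy
      exact hy.2.2.1
  have hφ₀inv : ContMDiffOn 𝓘(ℝ, E) 𝓘(ℝ, E) ∞ φ₀.symm φ₀.target := by
    refine hψi.comp (t := ψ.target) ((contMDiffOn_iff_contDiffOn.2 he'inv).mono ?_) ?_
    · intro v hv; exact hv.1
    · intro v hv; exact hv.2
  -- shrink to an invariant convex set
  set N₁ : Set M := ⋂ g, θ g ⁻¹' (φ₀.source ∩ interior O) with hN₁
  have hN₁o : IsOpen N₁ := hinter _ (φ₀.open_source.inter isOpen_interior)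
  have hxN₁ : x ∈ N₁ := mem_iInter.2 fun g => by
    rw [mem_preimage, hx]; exact ⟨hxφ₀, mem_interior_iff_mem_nhds.2 hO⟩
  have hN₁s : N₁ ⊆ φ₀.source := fun y hy => (hsub _ hy).1
  have himo : IsOpen (φ₀ '' N₁) := φ₀.isOpen_image_of_subset_source hN₁o hN₁s
  have h0 : φ₀ x = 0 := hFx
  obtain ⟨r, hr, hball⟩ := Metric.isOpen_iff.1 himo 0 ⟨x, hxN₁, h0⟩
  let B : Set E := ⋂ g, A g ⁻¹' Metric.ball 0 r
  have hBo : IsOpen B := isOpen_iInter_of_finite fun g =>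
    Metric.isOpen_ball.preimage (A g).continuous
  have hBinv : ∀ g, ∀ v ∈ B, A g v ∈ B := by
    intro g v hv
    rw [mem_iInter] at hv ⊢
    intro h
    rw [mem_preimage, hA]
    exact hv _
  have hBN : B ⊆ φ₀ '' N₁ := fun v hv => hball (by
    have := mem_iInter.1 hv 1
    rwa [mem_preimage, hA1] at this)
  have hBc : Convex ℝ B := convex_iInter fun g =>
    (convex_ball 0 r).linear_preimage (A g : E →ₗ[ℝ] E)
  have h0B : (0 : E) ∈ B := mem_iInter.2 fun g => by simp [hr]
  let φ := φ₀ ≫ₕ OpenPartialHomeomorph.ofSet B hBo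
  have hφs : φ.source = φ₀.source ∩ φ₀ ⁻¹' B := by
    simp [φ]
  have hφt : φ.target = B := by
    have : φ.target = B ∩ φ₀.target := by simp [φ]
    rw [this]
    refine inter_eq_left.2 fun v hv => ?_
    obtain ⟨y, hy, rfl⟩ := hBN hv
    exact φ₀.map_source (hN₁s hy)
  have hφN : φ.source ⊆ N₁ := by
    intro y hy
    rw [hφs] at hy
    obtain ⟨y', hy', he⟩ := hBN hy.2
    rwa [← φ₀.injOn (hN₁s hy') hy.1 he]
  refine ⟨φ, mem_maximalAtlas_of_contMDiffOn ?_ ?_, A, ?_, ?_, h0, ?_, ?_⟩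
  · exact hφ₀smooth.mono (by rw [hφs]; exact inter_subset_left)
  · refine hφ₀inv.mono ?_
    rw [hφt]
    intro v hv
    obtain ⟨y, hy, rfl⟩ := hBN hv
    exact φ₀.map_source (hN₁s hy)
  · rw [hφs]
    refine ⟨hxφ₀, ?_⟩
    rw [mem_preimage, h0]
    exact h0B
  · intro y hy
    exact interior_subset (hsub _ (hφN hy)).2
  · rw [hφt]; exact hBc
  · intro g y hy
    have h1 : φ₀ (θ g y) = A g (φ₀ y) := hequiv g y (hφ₀O₁ (hN₁s (hφN hy)))
    refine ⟨?_, h1⟩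
    rw [hφs]
    refine ⟨hN₁s (hinv _ g y (hφN hy)), ?_⟩
    rw [mem_preimage, h1]
    exact hBinv g _ (by rw [hφs] at hy; exact hy.2)

end

section

variable {E : Type*} [NormedAddCommGroup E] [NormedSpace ℝ E]
  {M : Type*} [TopologicalSpace M] [ChartedSpace E M]

/-! ### Mirrors of involutions -/

/-- The set `S` is a hypersurface near the point `y`: in some chart at `y` it is a linear
hyperplane. -/
def IsHypersurfaceAt (E : Type*) [NormedAddCommGroup E] [NormedSpace ℝ E]
    {M : Type*} [TopologicalSpace M] [ChartedSpace E M] (S : Set M) (y : M) : Prop :=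
  ∃ φ ∈ IsManifold.maximalAtlas 𝓘(ℝ, E) ∞ M, y ∈ φ.source ∧
    ∃ F : Submodule ℝ E, Module.finrank ℝ (E ⧸ F) = 1 ∧ ∀ x ∈ φ.source, x ∈ S ↔ φ x ∈ F

theorem IsHypersurfaceAt.congr {S S' : Set M} {y : M} (h : IsHypersurfaceAt E S y)
    (hS : ∀ᶠ z in 𝓝 y, z ∈ S ↔ z ∈ S') : IsHypersurfaceAt E S' y := by
  obtain ⟨φ, hφ, hy, F, hF, hφF⟩ := h
  obtain ⟨O, hO, hOo, hyO⟩ := eventually_nhds_iff.1 hS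
  refine ⟨φ.restr O, restr_mem_maximalAtlas _ hφ hOo, ?_, F, hF, ?_⟩
  · rw [φ.restr_source' O hOo]; exact ⟨hy, hyO⟩
  · intro x hx
    rw [φ.restr_source' O hOo] at hx
    rw [← hO x hx.2]
    exact hφF x hx.1

theorem HasDerivAt.mem_submodule [FiniteDimensional ℝ E] {F : Submodule ℝ E} {c : ℝ → E} {c' : E}
    (hc : HasDerivAt c c' 0) (h : ∀ᶠ t in 𝓝 (0 : ℝ), c t ∈ F) : c' ∈ F := by
  refine F.closed_of_finiteDimensional.mem_of_tendsto (hasDerivAt_iff_tendsto_slope.1 hc) ?_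
  filter_upwards [h.filter_mono nhdsWithin_le_nhds] with t ht
  rw [slope_def_module]
  exact F.smul_mem _ (F.sub_mem ht h.self_of_nhds)

variable [FiniteDimensional ℝ E]

/-- The dimension of a subset that is a linear subspace in a chart does not depend on the chart. -/
theorem finrank_le_of_charts {φ φ' : OpenPartialHomeomorph M E}
    (hφ : φ ∈ IsManifold.maximalAtlas 𝓘(ℝ, E) ∞ M)
    (hφ' : φ' ∈ IsManifold.maximalAtlas 𝓘(ℝ, E) ∞ M) {y : M} (hy : y ∈ φ.source)
    (hy' : y ∈ φ'.source) {S : Set M} (hyS : y ∈ S) {F F' : Submodule ℝ E}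
    (hF : ∀ x ∈ φ.source, x ∈ S ↔ φ x ∈ F) (hF' : ∀ x ∈ φ'.source, x ∈ S ↔ φ' x ∈ F') :
    Module.finrank ℝ F ≤ Module.finrank ℝ F' := by
  have hsm : ∀ {φ φ' : OpenPartialHomeomorph M E},
      φ ∈ IsManifold.maximalAtlas 𝓘(ℝ, E) ∞ M → φ' ∈ IsManifold.maximalAtlas 𝓘(ℝ, E) ∞ M →
      y ∈ φ.source → y ∈ φ'.source → DifferentiableAt ℝ (fun v => φ' (φ.symm v)) (φ y) := by
    intro φ φ' hφ hφ' hy hy'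
    have h1 := contMDiffAt_symm_of_mem_maximalAtlas hφ (φ.map_source hy)
    have h2 : ContMDiffAt 𝓘(ℝ, E) 𝓘(ℝ, E) ∞ φ' (φ.symm (φ y)) := by
      rw [φ.left_inv hy]; exact contMDiffAt_of_mem_maximalAtlas hφ' hy'
    exact ((contMDiffAt_iff_contDiffAt.1 (h2.comp _ h1)).differentiableAt (by simp))
  have hd := (hsm hφ hφ' hy hy').hasFDerivAt
  have hd' := (hsm hφ' hφ hy' hy).hasFDerivAt
  set D := fderiv ℝ (fun v => φ' (φ.symm v)) (φ y)
  set D' := fderiv ℝ (fun v => φ (φ'.symm v)) (φ' y)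
  have hev : ∀ᶠ v in 𝓝 (φ y), v ∈ φ.target ∧ φ.symm v ∈ φ'.source := by
    refine Filter.Eventually.and (φ.open_target.mem_nhds (φ.map_source hy)) ?_
    refine (φ.continuousAt_symm (φ.map_source hy)).eventually ?_
    rw [φ.left_inv hy]
    exact φ'.open_source.mem_nhds hy'
  have hDD : ∀ v, D' (D v) = v := by
    have h1 : HasFDerivAt (fun v => φ (φ'.symm v)) D' (φ' (φ.symm (φ y))) := by
      rw [φ.left_inv hy]; exact hd'
    have h2 := h1.comp (φ y) hd
    have h3 : (fun v => φ (φ'.symm v)) ∘ (fun v => φ' (φ.symm v)) =ᶠ[𝓝 (φ y)] id := by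
      filter_upwards [hev] with v hv
      simp only [Function.comp, φ'.left_inv hv.2, φ.right_inv hv.1, id]
    have h4 := h2.unique ((hasFDerivAt_id _).congr_of_eventuallyEq h3)
    intro v
    exact congrArg (fun f : E →L[ℝ] E => f v) h4
  have hmap : ∀ v ∈ F, D v ∈ F' := by
    intro v hv
    have hline : HasDerivAt (fun t : ℝ => φ y + t • v) v 0 := by
      simpa using ((hasDerivAt_id (0 : ℝ)).smul_const v).const_add (φ y)
    have hd0 : HasFDerivAt (fun v => φ' (φ.symm v)) D (φ y + (0 : ℝ) • v) := by simpa using hd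
    refine HasDerivAt.mem_submodule (hd0.comp_hasDerivAt (0 : ℝ) hline) ?_
    have hc : Tendsto (fun t : ℝ => φ y + t • v) (𝓝 0) (𝓝 (φ y)) := by
      simpa using hline.continuousAt.tendsto
    filter_upwards [hc.eventually hev] with t ht
    have h1 : φ (φ.symm (φ y + t • v)) ∈ F := by
      rw [φ.right_inv ht.1]
      exact F.add_mem ((hF y hy).1 hyS) (F.smul_mem t hv)
    exact (hF' _ ht.2).1 ((hF _ (φ.map_target ht.1)).2 h1)
  refine LinearMap.finrank_le_finrank_of_injective
    (f := ((D : E →ₗ[ℝ] E).restrict hmap)) ?_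
  intro v w hvw
  have h1 : D v = D w := congrArg Subtype.val hvw
  apply Subtype.ext
  rw [← hDD v, ← hDD w, h1]

theorem finrank_quotient_eq_of_charts {φ φ' : OpenPartialHomeomorph M E}
    (hφ : φ ∈ IsManifold.maximalAtlas 𝓘(ℝ, E) ∞ M)
    (hφ' : φ' ∈ IsManifold.maximalAtlas 𝓘(ℝ, E) ∞ M) {y : M} (hy : y ∈ φ.source)
    (hy' : y ∈ φ'.source) {S : Set M} (hyS : y ∈ S) {F F' : Submodule ℝ E}
    (hF : ∀ x ∈ φ.source, x ∈ S ↔ φ x ∈ F) (hF' : ∀ x ∈ φ'.source, x ∈ S ↔ φ' x ∈ F') :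
    Module.finrank ℝ (E ⧸ F) = Module.finrank ℝ (E ⧸ F') := by
  have h1 := finrank_le_of_charts hφ hφ' hy hy' hyS hF hF'
  have h2 := finrank_le_of_charts hφ' hφ hy' hy hyS hF' hF
  have h3 := F.finrank_quotient_add_finrank
  have h4 := F'.finrank_quotient_add_finrank
  omega

theorem IsHypersurfaceAt.finrank_eq_one {S : Set M} {y : M} (h : IsHypersurfaceAt E S y)
    (hyS : y ∈ S) {φ : OpenPartialHomeomorph M E}
    (hφ : φ ∈ IsManifold.maximalAtlas 𝓘(ℝ, E) ∞ M) (hy : y ∈ φ.source) {F : Submodule ℝ E}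
    (hF : ∀ x ∈ φ.source, x ∈ S ↔ φ x ∈ F) : Module.finrank ℝ (E ⧸ F) = 1 := by
  obtain ⟨φ', hφ', hy', F', hF1, hF'⟩ := h
  rw [← hF1]
  exact finrank_quotient_eq_of_charts hφ hφ' hy hy' hyS hF hF'

variable [IsManifold 𝓘(ℝ, E) ∞ M]

/-- The fixed point set of a smooth involution is a linear subspace in suitable charts. -/
theorem exists_chart_fixedPoints {r : M ≃ₜ M} (hr : r * r = 1)
    (hs : ContMDiff 𝓘(ℝ, E) 𝓘(ℝ, E) ∞ fun y => r y) {x : M} (hx : r x = x) :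
    ∃ φ ∈ IsManifold.maximalAtlas 𝓘(ℝ, E) ∞ M, x ∈ φ.source ∧ Convex ℝ φ.target ∧
      ∃ F : Submodule ℝ E, ∀ y ∈ φ.source, y ∈ {y | r y = y} ↔ φ y ∈ F := by
  have hpow : ∀ s ∈ Subgroup.zpowers r, s = 1 ∨ s = r := by
    rintro s ⟨n, rfl⟩
    have h2 : r ^ (2 : ℤ) = 1 := by rw [zpow_two, hr]
    rcases Int.even_or_odd' n with ⟨k, rfl | rfl⟩
    · left; simp only [zpow_mul, h2, one_zpow]
    · right; simp only [zpow_add, zpow_mul, h2, one_zpow, one_mul, zpow_one]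
  have : Finite (Subgroup.zpowers r) :=
    ((Set.toFinite {1, r}).subset fun s hs => hpow s hs).to_subtype
  obtain ⟨φ, hφ, L, hxφ, -, h0, hconv, hL⟩ := exists_linear_chart (E := E)
    (θ := (Subgroup.zpowers r).subtype) (x := x) (by
      rintro ⟨s, hs'⟩
      rcases hpow s hs' with rfl | rfl
      · exact contMDiff_id
      · exact hs) (by
      rintro ⟨s, hs'⟩
      rcases hpow s hs' with rfl | rfl
      · rfl
      · exact hx) univ_mem
  refine ⟨φ, hφ, hxφ, hconv,
    ((L ⟨r, Subgroup.mem_zpowers r⟩ : E →L[ℝ] E) - ContinuousLinearMap.id ℝ E : E →L[ℝ] E).ker, ?_⟩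
  intro y hy
  obtain ⟨h1, h2⟩ := hL ⟨r, Subgroup.mem_zpowers r⟩ y hy
  have h3 : φ (r y) = L ⟨r, Subgroup.mem_zpowers r⟩ (φ y) := h2
  rw [LinearMap.mem_ker]
  change r y = y ↔ L ⟨r, Subgroup.mem_zpowers r⟩ (φ y) - φ y = 0
  rw [← h3, sub_eq_zero]
  exact ⟨fun h => by rw [h], fun h => φ.injOn h1 hy h⟩

/-- For an involution, having codimension one is a property of the connected components of the fixed
point set. -/
theorem isHypersurface_connectedComponentIn_iff {r : M ≃ₜ M} (hr : r * r = 1)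
    (hs : ContMDiff 𝓘(ℝ, E) 𝓘(ℝ, E) ∞ fun y => r y) {x : M} (hx : r x = x) :
    IsHypersurface E (connectedComponentIn {y | r y = y} x) ↔
      IsHypersurfaceAt E {y | r y = y} x := by
  set S := {y | r y = y} with hS
  -- near each of its points the component coincides with the fixed point set
  have hloc : ∀ z ∈ connectedComponentIn S x,
      ∀ᶠ y in 𝓝 z, y ∈ connectedComponentIn S x ↔ y ∈ S := by
    intro z hz
    have hzS : r z = z := connectedComponentIn_subset S x hz
    obtain ⟨φ, hφ, hzφ, hconv, F, hF⟩ := exists_chart_fixedPoints (E := E) hr hs hzS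
    have hpre : IsPreconnected (φ.symm '' (φ.target ∩ F)) :=
      (hconv.inter F.convex).isPreconnected.image _ (φ.continuousOn_symm.mono inter_subset_left)
    have hsub : φ.symm '' (φ.target ∩ F) ⊆ S := by
      rintro _ ⟨v, hv, rfl⟩
      refine (hF _ (φ.map_target hv.1)).2 ?_
      rw [φ.right_inv hv.1]
      exact hv.2
    have hmem : ∀ y ∈ φ.source, y ∈ S → y ∈ φ.symm '' (φ.target ∩ F) := fun y hy hyS =>
      ⟨φ y, ⟨φ.map_source hy, (hF y hy).1 hyS⟩, φ.left_inv hy⟩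
    filter_upwards [φ.open_source.mem_nhds hzφ] with y hy
    refine ⟨fun h => connectedComponentIn_subset S x h, fun hyS => ?_⟩
    rw [connectedComponentIn_eq hz]
    exact hpre.subset_connectedComponentIn (hmem z hzφ hzS) hsub (hmem y hy hyS)
  constructor
  · intro h
    have hxc : x ∈ connectedComponentIn S x := mem_connectedComponentIn hx
    exact IsHypersurfaceAt.congr (h x hxc) (hloc x hxc)
  · intro h
    -- having codimension one is an open and closed condition on the fixed point set
    let U : Set M := {z | ∃ φ ∈ IsManifold.maximalAtlas 𝓘(ℝ, E) ∞ M, z ∈ φ.source ∧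
      ∃ F : Submodule ℝ E, Module.finrank ℝ (E ⧸ F) = 1 ∧ ∀ y ∈ φ.source, y ∈ S ↔ φ y ∈ F}
    let V : Set M := {z | ∃ φ ∈ IsManifold.maximalAtlas 𝓘(ℝ, E) ∞ M, z ∈ φ.source ∧
      ∃ F : Submodule ℝ E, Module.finrank ℝ (E ⧸ F) ≠ 1 ∧ ∀ y ∈ φ.source, y ∈ S ↔ φ y ∈ F}
    have hUo : IsOpen U := by
      rw [isOpen_iff_mem_nhds]
      rintro z ⟨φ, hφ, hz, h⟩
      filter_upwards [φ.open_source.mem_nhds hz] with y hy using ⟨φ, hφ, hy, h⟩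
    have hVo : IsOpen V := by
      rw [isOpen_iff_mem_nhds]
      rintro z ⟨φ, hφ, hz, h⟩
      filter_upwards [φ.open_source.mem_nhds hz] with y hy using ⟨φ, hφ, hy, h⟩
    have hUV : connectedComponentIn S x ⊆ U ∪ V := by
      intro z hz
      obtain ⟨φ, hφ, hzφ, -, F, hF⟩ :=
        exists_chart_fixedPoints (E := E) hr hs (connectedComponentIn_subset S x hz)
      by_cases h1 : Module.finrank ℝ (E ⧸ F) = 1
      · exact Or.inl ⟨φ, hφ, hzφ, F, h1, hF⟩
      · exact Or.inr ⟨φ, hφ, hzφ, F, h1, hF⟩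
    have hdisj : ∀ z ∈ S, z ∈ U → z ∈ V → False := by
      rintro z hzS hzU ⟨φ, hφ, hzφ, F, h1, hF⟩
      exact h1 (IsHypersurfaceAt.finrank_eq_one hzU hzS hφ hzφ hF)
    intro z hz
    have hzU : z ∈ U := by
      rcases hUV hz with h' | h'
      · exact h'
      · obtain ⟨y, hy, hyU, hyV⟩ := isPreconnected_connectedComponentIn U V hUo hVo hUV
          ⟨x, mem_connectedComponentIn hx, h⟩ ⟨z, hz, h'⟩
        exact (hdisj y (connectedComponentIn_subset S x hy) hyU hyV).elim
    exact IsHypersurfaceAt.congr hzU ((hloc z hz).mono fun y hy => hy.symm)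

/-- The points of the mirrors of an involutive isometry. -/
theorem exists_isMirror_iff {g : SmoothMetric E M} {r : Isom g} (hr : r * r = 1) {x : M} :
    (∃ Λ, IsMirror r Λ ∧ x ∈ Λ) ↔ r.1 x = x ∧ IsHypersurfaceAt E {y | r.1 y = y} x := by
  have hr' : r.1 * r.1 = 1 := congrArg Subtype.val hr
  constructor
  · rintro ⟨Λ, ⟨⟨p, hp, rfl⟩, hΛ⟩, hx⟩
    have hxS : r.1 x = x := connectedComponentIn_subset {x : M | r.1 x = x} p hx
    rw [connectedComponentIn_eq hx] at hΛ
    exact ⟨hxS, (isHypersurface_connectedComponentIn_iff hr' r.2.1.contMDiff hxS).1 hΛ⟩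
  · rintro ⟨hx, h⟩
    exact ⟨_, ⟨⟨x, hx, rfl⟩,
      (isHypersurface_connectedComponentIn_iff hr' r.2.1.contMDiff hx).2 h⟩,
      mem_connectedComponentIn hx⟩

/-- The mirrors in terms of germs: a point lies on a mirror if and only if it is fixed by some
element of order two whose fixed point set is a hypersurface near it. -/
theorem mem_mirrorUnion_iff {g : SmoothMetric E M} {W : Subgroup (Isom g)} {x : M} :
    x ∈ mirrorUnion W ↔ ∃ r ∈ W, orderOf r = 2 ∧ r.1 x = x ∧
      IsHypersurfaceAt E {y | r.1 y = y} x := by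
  constructor
  · rintro ⟨r, hr, ⟨ho, -⟩, Λ, hΛ, hx⟩
    have h2 : r * r = 1 := by rw [← sq, ← ho, pow_orderOf_eq_one]
    exact ⟨r, hr, ho, (exists_isMirror_iff h2).1 ⟨Λ, hΛ, hx⟩⟩
  · rintro ⟨r, hr, ho, h⟩
    have h2 : r * r = 1 := by rw [← sq, ← ho, pow_orderOf_eq_one]
    obtain ⟨Λ, hΛ, hx⟩ := (exists_isMirror_iff h2).2 h
    exact ⟨r, hr, ⟨ho, Λ, hΛ⟩, Λ, hΛ, hx⟩

theorem isReflection_iff {g : SmoothMetric E M} {r : Isom g} :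
    IsReflection r ↔ orderOf r = 2 ∧ ∃ x, r.1 x = x ∧ IsHypersurfaceAt E {y | r.1 y = y} x := by
  constructor
  · rintro ⟨ho, Λ, hΛ⟩
    have h2 : r * r = 1 := by rw [← sq, ← ho, pow_orderOf_eq_one]
    obtain ⟨⟨p, hp, rfl⟩, -⟩ := id hΛ
    exact ⟨ho, p, (exists_isMirror_iff h2).1 ⟨_, hΛ, mem_connectedComponentIn hp⟩⟩
  · rintro ⟨ho, x, h⟩
    have h2 : r * r = 1 := by rw [← sq, ← ho, pow_orderOf_eq_one]
    obtain ⟨Λ, hΛ, -⟩ := (exists_isMirror_iff h2).2 h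
    exact ⟨ho, Λ, hΛ⟩

end

section

variable {E : Type*} [NormedAddCommGroup E] [NormedSpace ℝ E]
  {M : Type*} [TopologicalSpace M] [ChartedSpace E M] [IsManifold 𝓘(ℝ, E) ∞ M]
  {g : SmoothMetric E M}

/-! ### Local structure of a reflection group -/

/-- The tautological action of the isometry group. Subgroups of it act through it. -/
instance isomAction : MulAction (Isom g) M where
  smul f x := f.1 x
  one_smul _ := rfl
  mul_smul _ _ _ := rfl

instance isomSubgroupAction_continuousConstSMul (W : Subgroup (Isom g)) :
    ContinuousConstSMul W M :=
  ⟨fun w => w.1.1.continuous⟩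

theorem eq_one_of_forall_smul_eq {W : Subgroup (Isom g)} {w : W} (h : ∀ x : M, w • x = x) :
    w = 1 :=
  Subtype.ext (Subtype.ext (Homeomorph.ext h))

theorem contMDiff_smul (f : Isom g) : ContMDiff 𝓘(ℝ, E) 𝓘(ℝ, E) ∞ fun x : M => f • x :=
  f.2.1.contMDiff

theorem IsHypersurfaceAt.smul {S : Set M} {x : M} (h : IsHypersurfaceAt E S x) (f : Isom g) :
    IsHypersurfaceAt E {y | f⁻¹ • y ∈ S} (f • x) := by
  obtain ⟨φ, hφ, hx, F, hF, hφF⟩ := h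
  let e : OpenPartialHomeomorph M M := f⁻¹.1.toOpenPartialHomeomorph
  have hs : (e ≫ₕ φ).source = {y | f⁻¹ • y ∈ φ.source} := by
    ext y; simp [e]; rfl
  refine ⟨e ≫ₕ φ, mem_maximalAtlas_of_contMDiffOn ?_ ?_, ?_, F, hF, ?_⟩
  · refine (contMDiffOn_of_mem_maximalAtlas hφ).comp (contMDiff_smul f⁻¹).contMDiffOn ?_
    rw [hs]; exact fun y hy => hy
  · refine (contMDiff_smul f).comp_contMDiffOn
      ((contMDiffOn_symm_of_mem_maximalAtlas hφ).mono ?_)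
    intro v hv
    exact hv.1
  · rw [hs]
    change f⁻¹ • f • x ∈ φ.source
    rwa [inv_smul_smul]
  · intro y hy
    rw [hs] at hy
    exact hφF _ hy

/-- The reflections in `W` that have a mirror through `x`. -/
def mirrorReflections (W : Subgroup (Isom g)) (x : M) : Set W :=
  {r | orderOf r = 2 ∧ r • x = x ∧ IsHypersurfaceAt E {y | r • y = y} x}

variable {W : Subgroup (Isom g)}

theorem mul_self_of_mem_mirrorReflections {x : M} {r : W} (h : r ∈ mirrorReflections W x) :
    r * r = 1 := by
  rw [← sq, ← h.1, pow_orderOf_eq_one]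

theorem conj_mem_mirrorReflections {x : M} {r : W} (h : r ∈ mirrorReflections W x) (w : W) :
    w * r * w⁻¹ ∈ mirrorReflections W (w • x) := by
  refine ⟨?_, ?_, ?_⟩
  · rw [← MulAut.conj_apply, MulEquiv.orderOf_eq, h.1]
  · simp [mul_smul, h.2.1]
  · refine (h.2.2.smul w.1).congr (Eventually.of_forall fun y => ?_)
    change r • w⁻¹ • y = w⁻¹ • y ↔ (w * r * w⁻¹) • y = y
    rw [mul_smul, mul_smul, smul_eq_iff_eq_inv_smul w]

variable [FiniteDimensional ℝ E]

theorem mem_mirrorUnion_iff_nonempty {x : M} :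
    x ∈ mirrorUnion W ↔ (mirrorReflections W x).Nonempty := by
  rw [mem_mirrorUnion_iff]
  constructor
  · rintro ⟨r, hr, h1, h2⟩
    exact ⟨⟨r, hr⟩, by rw [← Subgroup.orderOf_coe]; exact h1, h2⟩
  · rintro ⟨r, h1, h2⟩
    exact ⟨r.1, r.2, by rw [Subgroup.orderOf_coe]; exact h1, h2⟩

theorem smul_mem_mirrorUnion {x : M} (h : x ∈ mirrorUnion W) (w : W) : w • x ∈ mirrorUnion W := by
  rw [mem_mirrorUnion_iff_nonempty] at h ⊢
  obtain ⟨r, hr⟩ := h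
  exact ⟨_, conj_mem_mirrorReflections hr w⟩

theorem smul_mem_mirrorUnion_iff {x : M} (w : W) : w • x ∈ mirrorUnion W ↔ x ∈ mirrorUnion W :=
  ⟨fun h => by simpa using smul_mem_mirrorUnion h w⁻¹, fun h => smul_mem_mirrorUnion h w⟩

variable [T2Space M] [ConnectedSpace M]

theorem finite_stabilizer (hW : DiscreteTopology W) (x : M) :
    Finite (MulAction.stabilizer W x) := by
  obtain ⟨U, hU, V, hV, hfin⟩ := exists_nhds_finite_of_discrete hW x x
  refine (hfin.subset fun w hw => ⟨x, mem_of_mem_nhds hU, ?_⟩ : Set.Finite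
    (MulAction.stabilizer W x : Set W)).to_subtype
  have : w • x = x := hw
  change w • x ∈ V
  rw [this]
  exact mem_of_mem_nhds hV

/-- Each point has a neighborhood that only the elements fixing the point can move to meet
itself. -/
theorem exists_nhds_forall_smul_eq (hW : DiscreteTopology W) (x : M) :
    ∃ O ∈ 𝓝 x, ∀ w : W, ∀ y ∈ O, w • y ∈ O → w • x = x := by
  obtain ⟨U, hU, V, hV, hfin⟩ := exists_nhds_finite_of_discrete hW x x
  have key : ∀ w : W, ∃ O ∈ 𝓝 x, ∀ y ∈ O, w • y ∈ O → w • x = x := by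
    intro w
    by_cases hw : w • x = x
    · exact ⟨univ, univ_mem, fun _ _ _ => hw⟩
    · obtain ⟨A, B, hA, hB, hxA, hxB, hAB⟩ := t2_separation hw
      refine ⟨B ∩ (fun y => w • y) ⁻¹' A, inter_mem (hB.mem_nhds hxB)
        ((continuous_const_smul w).continuousAt (hA.mem_nhds hxA)), fun y hy hwy => ?_⟩
      exact (disjoint_left.1 hAB hy.2 hwy.1).elim
  choose O hO hO' using key
  refine ⟨U ∩ V ∩ ⋂ w ∈ {w : W | ∃ z ∈ U, w.1.1 z ∈ V}, O w,
    inter_mem (inter_mem hU hV) ((biInter_mem hfin).2 fun w _ => hO w), fun w y hy hwy => ?_⟩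
  have hwS : w ∈ {w : W | ∃ z ∈ U, w.1.1 z ∈ V} := ⟨y, hy.1.1, hwy.1.2⟩
  exact hO' w y (mem_iInter₂.1 hy.2 w hwS) (mem_iInter₂.1 hwy.2 w hwS)

theorem exists_linear_chart_stabilizer (hW : DiscreteTopology W) (x : M) {O : Set M}
    (hO : O ∈ 𝓝 x) :
    ∃ φ ∈ IsManifold.maximalAtlas 𝓘(ℝ, E) ∞ M,
      ∃ L : MulAction.stabilizer W x →* (E →L[ℝ] E),
      x ∈ φ.source ∧ φ.source ⊆ O ∧ φ x = 0 ∧ Convex ℝ φ.target ∧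
      ∀ w, ∀ y ∈ φ.source, w • y ∈ φ.source ∧ φ (w • y) = L w (φ y) := by
  have := finite_stabilizer hW x
  let θ : MulAction.stabilizer W x →* (M ≃ₜ M) :=
    { toFun := fun w => w.1.1.1, map_one' := rfl, map_mul' := fun _ _ => rfl }
  exact exists_linear_chart θ (fun w => contMDiff_smul w.1.1) (fun w => w.2) hO

omit [FiniteDimensional ℝ E] in
theorem ContinuousLinearMap.ext_of_eventually {L L' : E →L[ℝ] E} {v : E}
    (h : ∀ᶠ u in 𝓝 v, L u = L' u) : L = L' := by
  have h1 := L.hasFDerivAt (x := v)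
  have h2 : HasFDerivAt L L' v := L'.hasFDerivAt.congr_of_eventuallyEq h
  exact h1.unique h2

/-- An element of a discrete group of isometries of a connected manifold is determined by its germ
at any point. -/
theorem eq_one_of_eventually_smul_eq (hW : DiscreteTopology W) {w : W} {x : M}
    (h : ∀ᶠ y in 𝓝 x, w • y = y) : w = 1 := by
  have hcl : IsClopen {z : M | ∀ᶠ y in 𝓝 z, w • y = y} := by
    refine ⟨isClosed_of_closure_subset fun z hz => ?_, isOpen_setOfPred_eventually_nhds⟩
    have hfix : IsClosed {z : M | w • z = z} := isClosed_eq (continuous_const_smul w) continuous_id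
    have hzw : w • z = z := by
      refine hfix.closure_subset_iff.2 (fun y hy => ?_) hz
      exact Eventually.self_of_nhds hy
    obtain ⟨φ, hφ, L, hzφ, -, -, -, hL⟩ := exists_linear_chart_stabilizer hW z univ_mem
    obtain ⟨y, hy, hyw⟩ := mem_closure_iff_nhds.1 hz _ (φ.open_source.mem_nhds hzφ)
    have hL1 : L ⟨w, hzw⟩ = ContinuousLinearMap.id ℝ E := by
      refine ContinuousLinearMap.ext_of_eventually (v := φ y) ?_
      have h1 : ∀ᶠ v in 𝓝 (φ y), w • φ.symm v = φ.symm v := by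
        have hc := φ.continuousAt_symm (φ.map_source hy)
        rw [ContinuousAt, φ.left_inv hy] at hc
        exact hc.eventually (show ∀ᶠ z in 𝓝 y, w • z = z from hyw)
      filter_upwards [h1, φ.open_target.mem_nhds (φ.map_source hy)] with v hv hvt
      have h2 := (hL ⟨w, hzw⟩ _ (φ.map_target hvt)).2
      have h3 : φ (w • φ.symm v) = L ⟨w, hzw⟩ (φ (φ.symm v)) := h2
      rw [hv, φ.right_inv hvt] at h3
      exact h3.symm
    change ∀ᶠ y in 𝓝 z, w • y = y
    filter_upwards [φ.open_source.mem_nhds hzφ] with y hy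
    have h2 := hL ⟨w, hzw⟩ y hy
    rw [hL1] at h2
    exact φ.injOn h2.1 hy h2.2
  have := hcl.eq_univ ⟨x, h⟩
  refine eq_one_of_forall_smul_eq fun z => ?_
  have h1 : ∀ᶠ y in 𝓝 z, w • y = y := this.ge (mem_univ z)
  exact h1.self_of_nhds

/-- Near each point a reflection group is, in a suitable chart, a finite linear group, and the
mirrors are the hyperplanes of an arrangement. -/
theorem exists_arrangement_chart (hW : DiscreteTopology W) (x : M) {O : Set M} (hO : O ∈ 𝓝 x) :
    ∃ (φ : OpenPartialHomeomorph M E) (A : ReflectionArrangement (MulAction.stabilizer W x) E),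
      x ∈ φ.source ∧ φ.source ⊆ O ∧ Convex ℝ φ.target ∧
      (∀ w, ∀ y ∈ φ.source, w • y ∈ φ.source ∧ φ (w • y) = A.L w (φ y)) ∧
      (∀ t, t ∈ A.T ↔ t.1 ∈ mirrorReflections W x) ∧
      (∀ y ∈ φ.source, mirrorReflections W y ⊆ mirrorReflections W x) ∧
      ∀ y ∈ φ.source, y ∉ mirrorUnion W ↔ A.Reg (φ y) := by
  obtain ⟨O₁, hO₁, hstab⟩ := exists_nhds_forall_smul_eq hW x
  obtain ⟨φ, hφ, L, hxφ, hφO, h0, hconv, hL⟩ :=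
    exists_linear_chart_stabilizer hW x (inter_mem hO hO₁)
  have hfin := finite_stabilizer hW x
  let fixSpace : MulAction.stabilizer W x → Submodule ℝ E := fun t =>
    (L t - ContinuousLinearMap.id ℝ E : E →L[ℝ] E).ker
  have hmemfix : ∀ t v, v ∈ fixSpace t ↔ L t v = v := fun t v => by
    change L t v - v = 0 ↔ _
    rw [sub_eq_zero]
  have hchart : ∀ t : MulAction.stabilizer W x, ∀ y ∈ φ.source,
      y ∈ {y | t.1 • y = y} ↔ φ y ∈ fixSpace t := by
    intro t y hy
    rw [hmemfix, ← (hL t y hy).2]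
    exact ⟨fun h => congrArg φ h, fun h => φ.injOn (hL t y hy).1 hy h⟩
  have hLL : ∀ s t v, L s (L t v) = L (s * t) v := fun s t v => by rw [map_mul]; rfl
  have hL1 : ∀ v, L 1 v = v := fun v => by rw [map_one]; rfl
  -- faithfulness of the linear action
  have hinj : ∀ t, (∀ v, L t v = v) → t = 1 := by
    intro t ht
    apply Subtype.ext
    refine eq_one_of_eventually_smul_eq hW (x := x) ?_
    filter_upwards [φ.open_source.mem_nhds hxφ] with y hy
    exact φ.injOn (hL t y hy).1 hy ((hL t y hy).2.trans (ht _))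
  have hcodim : ∀ t : MulAction.stabilizer W x, ∀ y ∈ φ.source, t.1 • y = y →
      (IsHypersurfaceAt E {y | t.1 • y = y} y ↔ Module.finrank ℝ (E ⧸ fixSpace t) = 1) := by
    intro t y hy hty
    exact ⟨fun h => h.finrank_eq_one hty hφ hy (hchart t),
      fun h => ⟨φ, hφ, hy, _, h, hchart t⟩⟩
  let T : Set (MulAction.stabilizer W x) := {t | t.1 ∈ mirrorReflections W x}
  -- linear forms defining the hyperplanes
  have hform : ∀ t : MulAction.stabilizer W x, ∃ α : E →L[ℝ] ℝ, t ∈ T →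
      α ≠ 0 ∧ ∀ v, L t v = v ↔ α v = 0 := by
    intro t
    by_cases ht : t ∈ T
    · have h1 := (hcodim t x hxφ ht.2.1).1 ht.2.2
      obtain ⟨e⟩ : Nonempty ((E ⧸ fixSpace t) ≃ₗ[ℝ] ℝ) :=
        ⟨LinearEquiv.ofFinrankEq _ _ (by rw [h1, Module.finrank_self])⟩
      let α : E →ₗ[ℝ] ℝ := e.toLinearMap.comp (fixSpace t).mkQ
      have hα : ∀ v, L t v = v ↔ α v = 0 := by
        intro v
        rw [← hmemfix]
        simp only [α, LinearMap.comp_apply, LinearEquiv.coe_coe, LinearEquiv.map_eq_zero_iff,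
          Submodule.mkQ_apply, Submodule.Quotient.mk_eq_zero]
      refine ⟨LinearMap.toContinuousLinearMap α, fun _ => ⟨fun h => ?_, hα⟩⟩
      have ht1 : t = 1 := hinj t fun v => (hα v).2 (congrArg (fun f : E →L[ℝ] ℝ => f v) h)
      have := ht.1
      rw [ht1] at this
      simp at this
    · exact ⟨0, fun h => absurd h ht⟩
  choose α hα using hform
  have hsq : ∀ t ∈ T, t * t = 1 := fun t ht =>
    Subtype.ext (mul_self_of_mem_mirrorReflections (show t.1 ∈ mirrorReflections W x from ht))
  have hneg : ∀ t ∈ T, ∀ v, α t (L t v) = -α t v := by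
    intro t ht v
    have h1 : α t (v + L t v) = 0 := by
      rw [← (hα t ht).2, map_add, hLL, hsq t ht, hL1, add_comm]
    rw [map_add] at h1
    linarith
  let A : ReflectionArrangement (MulAction.stabilizer W x) E :=
    { L := L
      T := T
      α := α
      finite := Set.toFinite _
      mul_self := hsq
      fix_iff := fun t ht => (hα t ht).2
      ne_zero := fun t ht => (hα t ht).1
      neg := hneg
      conj_mem := by
        intro t ht s hs
        have h1 := conj_mem_mirrorReflections (show s.1 ∈ mirrorReflections W x from hs) t.1
        rw [show t.1 • x = x from t.2] at h1
        have h2 : t⁻¹ = t := inv_eq_of_mul_eq_one_left (hsq t ht)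
        have h3 : t * s * t = t * s * t⁻¹ := by rw [h2]
        rw [h3]
        exact h1
      indep := by
        -- two reflections in the same hyperplane differ by a unipotent element of finite order
        intro t ht s hs hst c hc
        have hN : ∀ v, α s (L (s * t) v - v) = 0 := by
          intro v
          have h1 : α s (L (s * t) v) = α s v := by
            rw [← hLL, hneg s hs]
            have h2 := hneg t ht v
            rw [hc]
            simp only [_root_.smul_apply, h2, smul_neg, neg_neg]
          rw [map_sub, h1, sub_self]
        have hαt : ∀ v, α s v = 0 → α t v = 0 := by
          intro v hv
          rw [hc] at hv
          have hc0 : c ≠ 0 := by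
            rintro rfl
            exact (hα s hs).1 (by rw [hc, zero_smul])
          simpa [hc0] using hv
        have hfix : ∀ v, α s v = 0 → L (s * t) v = v := by
          intro v hv
          rw [← hLL, ((hα t ht).2 v).2 (hαt v hv), ((hα s hs).2 v).2 hv]
        have hpow : ∀ (n : ℕ) v, L ((s * t) ^ n) v = v + n • (L (s * t) v - v) := by
          intro n v
          induction n with
          | zero => simp
          | succ n ih =>
            rw [pow_succ', ← hLL, ih, map_add, map_nsmul, hfix _ (hN v), succ_nsmul]
            abel
        have hone : s * t = 1 := by
          apply hinj
          intro v
          have h1 := hpow (orderOf (s * t)) v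
          rw [pow_orderOf_eq_one, hL1, left_eq_add, ← Nat.cast_smul_eq_nsmul ℝ, smul_eq_zero,
            Nat.cast_eq_zero] at h1
          rcases h1 with h1 | h1
          · exact absurd h1 (orderOf_pos (s * t)).ne'
          · exact sub_eq_zero.1 h1
        apply hst
        rw [mul_eq_one_iff_eq_inv] at hone
        rw [hone]
        exact inv_eq_of_mul_eq_one_left (hsq t ht) }
  have hsub : ∀ y ∈ φ.source, mirrorReflections W y ⊆ mirrorReflections W x := by
    rintro y hy r ⟨hr1, hr2, hr3⟩
    have hyO := (hφO hy).2
    have hrx : r • x = x := hstab r y hyO (by rw [hr2]; exact hyO)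
    exact ⟨hr1, hrx, (hcodim ⟨r, hrx⟩ x hxφ hrx).2 ((hcodim ⟨r, hrx⟩ y hy hr2).1 hr3)⟩
  refine ⟨φ, A, hxφ, hφO.trans inter_subset_left, hconv, hL, fun t => Iff.rfl, hsub,
    fun y hy => ?_⟩
  rw [not_iff_comm]
  have hreg : ¬ A.Reg (φ y) ↔ ∃ t ∈ T, α t (φ y) = 0 := by
    simp only [ReflectionArrangement.Reg, not_forall, not_not, exists_prop]
    rfl
  rw [hreg, mem_mirrorUnion_iff_nonempty]
  constructor
  · rintro ⟨t, ht, h⟩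
    have h1 : t.1 • y = y := (hchart t y hy).2 ((hmemfix t _).2 (((hα t ht).2 _).2 h))
    exact ⟨t.1, ht.1, h1, (hcodim t y hy h1).2 ((hcodim t x hxφ ht.2.1).1 ht.2.2)⟩
  · rintro ⟨r, hr⟩
    have hrx := hsub y hy hr
    have hrT : (⟨r, hrx.2.1⟩ : MulAction.stabilizer W x) ∈ T := hrx
    exact ⟨_, hrT, ((hα _ hrT).2 _).1 ((hmemfix _ _).1 ((hchart ⟨r, hrx.2.1⟩ y hy).1 hr.2.1))⟩

end

section

variable {E : Type*} [NormedAddCommGroup E] [NormedSpace ℝ E] [FiniteDimensional ℝ E]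
  {M : Type*} [TopologicalSpace M] [ChartedSpace E M] [IsManifold 𝓘(ℝ, E) ∞ M]
  [T2Space M] [ConnectedSpace M] {g : SmoothMetric E M} {W : Subgroup (Isom g)} {c : Set M}

/-! ### Chambers and local sections -/

theorem dense_compl_mirrorUnion (hW : DiscreteTopology W) : Dense (mirrorUnion W)ᶜ := by
  rw [dense_iff_inter_open]
  rintro O hO ⟨x, hx⟩
  obtain ⟨φ, A, hxφ, hφO, -, -, -, -, hreg⟩ := exists_arrangement_chart hW x (hO.mem_nhds hx)
  obtain ⟨v, hv, hvr⟩ := (dense_forall_ne_zero A.finite A.α A.ne_zero).inter_open_nonempty _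
    φ.open_target ⟨φ x, φ.map_source hxφ⟩
  have hs := φ.map_target hv
  refine ⟨φ.symm v, hφO hs, (hreg _ hs).2 ?_⟩
  rw [φ.right_inv hv]
  exact hvr

theorem isOpen_compl_mirrorUnion (hW : DiscreteTopology W) : IsOpen (mirrorUnion W)ᶜ := by
  rw [isOpen_iff_mem_nhds]
  intro x hx
  obtain ⟨φ, A, hxφ, -, -, -, -, -, hreg⟩ := exists_arrangement_chart hW x univ_mem
  have h1 := (hreg x hxφ).1 hx
  have h2 := (φ.continuousAt hxφ).eventually
    ((A.isOpen_setOf_same (φ x)).mem_nhds (show A.Same (φ x) (φ x) from h1.same))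
  filter_upwards [h2, φ.open_source.mem_nhds hxφ] with y hy hys
  exact (hreg y hys).2 (ReflectionArrangement.Same.symm hy).reg

theorem nhdsWithin_compl_mirrorUnion_neBot (hW : DiscreteTopology W) (x : M) :
    (𝓝[(mirrorUnion W)ᶜ] x).NeBot :=
  mem_closure_iff_nhdsWithin_neBot.1 (dense_compl_mirrorUnion hW x)

theorem eventually_mirrorReflections_subset (hW : DiscreteTopology W) (x : M) :
    ∀ᶠ y in 𝓝 x, mirrorReflections W y ⊆ mirrorReflections W x := by
  obtain ⟨φ, A, hxφ, -, -, -, -, h, -⟩ := exists_arrangement_chart hW x univ_mem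
  filter_upwards [φ.open_source.mem_nhds hxφ] with y hy using h y hy

omit [T2Space M] [ConnectedSpace M] in
theorem tendsto_smul_nhdsWithin_compl_mirrorUnion (w : W) (x : M) :
    Tendsto (fun y : M => w • y) (𝓝[(mirrorUnion W)ᶜ] x) (𝓝[(mirrorUnion W)ᶜ] (w • x)) := by
  refine tendsto_nhdsWithin_iff.2 ⟨(continuous_const_smul w).continuousAt.tendsto.mono_left
    nhdsWithin_le_nhds, ?_⟩
  filter_upwards [self_mem_nhdsWithin] with y hy
  exact fun h => hy ((smul_mem_mirrorUnion_iff w).1 h)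

/-- A function that, off the mirrors near `x`, is locally constant and invariant under the
reflections in the mirrors through `x`, is constant off the mirrors near `x`. -/
theorem exists_eventually_eq_of_invariant (hW : DiscreteTopology W) {X : Type*} {h : M → X} {x : M}
    (hh : ∀ᶠ y in 𝓝[(mirrorUnion W)ᶜ] x,
      (∀ᶠ z in 𝓝 y, h z = h y) ∧ ∀ r ∈ mirrorReflections W x, h (r • y) = h y) :
    ∃ a, ∀ᶠ y in 𝓝[(mirrorUnion W)ᶜ] x, h y = a := by
  obtain ⟨O, hO, hxO, hOh⟩ := mem_nhdsWithin.1 hh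
  obtain ⟨φ, A, hxφ, hφO, hconv, hL, hT, -, hreg⟩ :=
    exists_arrangement_chart hW x (hO.mem_nhds hxO)
  have hP : ∀ v ∈ φ.target, A.Reg v → (∀ᶠ z in 𝓝 (φ.symm v), h z = h (φ.symm v)) ∧
      ∀ r ∈ mirrorReflections W x, h (r • φ.symm v) = h (φ.symm v) := by
    intro v hv hvr
    have hs := φ.map_target hv
    refine hOh ⟨hφO hs, (hreg _ hs).2 ?_⟩
    rwa [φ.right_inv hv]
  have hLt : ∀ t ∈ A.T, ∀ v ∈ φ.target, A.L t v ∈ φ.target ∧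
      φ.symm (A.L t v) = t.1 • φ.symm v := by
    intro t _ v hv
    have h1 := hL t _ (φ.map_target hv)
    rw [φ.right_inv hv] at h1
    rw [← h1.2]
    exact ⟨φ.map_source h1.1, φ.left_inv h1.1⟩
  have hconst : ∀ v ∈ φ.target, ∀ v' ∈ φ.target, A.Reg v → A.Reg v' →
      h (φ.symm v) = h (φ.symm v') := by
    intro v hv v' hv' hvr hvr'
    refine A.eq_of_invariant (B := φ.target) (h := fun v => h (φ.symm v))
      (fun t ht v hv => (hLt t ht v hv).1) ?_ ?_ hv hv' hvr hvr'
    · intro v hv v' hv' hvv'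
      let _ : TopologicalSpace X := ⊥
      have : DiscreteTopology X := ⟨rfl⟩
      refine (hconv.inter (A.convex_setOf_same v)).isPreconnected.constant
        (f := fun v => h (φ.symm v)) ?_ ⟨hv, hvv'.reg.same⟩ ⟨hv', hvv'⟩
      intro u hu
      have h1 := (hP u hu.1 (ReflectionArrangement.Same.symm hu.2).reg).1
      have h2 := (φ.continuousAt_symm hu.1).eventually h1
      have h3 : ContinuousAt (fun v => h (φ.symm v)) u :=
        tendsto_const_nhds.congr' (h2.mono fun _ h => h.symm)
      exact h3.continuousWithinAt
    · intro t ht v hv hvr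
      rw [(hLt t ht v hv).2]
      exact (hP v hv hvr).2 t.1 ((hT t).1 ht)
  obtain ⟨y, hy⟩ := (nhdsWithin_compl_mirrorUnion_neBot hW x).nonempty_of_mem
    (inter_mem (mem_nhdsWithin_of_mem_nhds (φ.open_source.mem_nhds hxφ)) self_mem_nhdsWithin)
  refine ⟨h y, ?_⟩
  filter_upwards [mem_nhdsWithin_of_mem_nhds (φ.open_source.mem_nhds hxφ), self_mem_nhdsWithin]
    with z hz hzN
  have := hconst (φ z) (φ.map_source hz) (φ y) (φ.map_source hy.1) ((hreg z hz).1 hzN)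
    ((hreg y hy.1).1 hy.2)
  rwa [φ.left_inv hz, φ.left_inv hy.1] at this

omit [FiniteDimensional ℝ E] [T2Space M] [ConnectedSpace M] in
theorem IsOpenChamber.subset (hc : IsOpenChamber W c) : c ⊆ (mirrorUnion W)ᶜ := by
  obtain ⟨x, -, rfl⟩ := hc
  exact connectedComponentIn_subset _ _

omit [FiniteDimensional ℝ E] [T2Space M] [ConnectedSpace M] in
theorem IsOpenChamber.eq_connectedComponentIn (hc : IsOpenChamber W c) {y : M} (hy : y ∈ c) :
    c = connectedComponentIn (mirrorUnion W)ᶜ y := by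
  obtain ⟨x, -, rfl⟩ := hc
  exact connectedComponentIn_eq hy

omit [FiniteDimensional ℝ E] [T2Space M] [ConnectedSpace M] in
theorem IsOpenChamber.nonempty (hc : IsOpenChamber W c) : c.Nonempty := by
  obtain ⟨x, hx, rfl⟩ := hc
  exact ⟨x, mem_connectedComponentIn hx⟩

theorem IsOpenChamber.isOpen (hW : DiscreteTopology W) (hc : IsOpenChamber W c) : IsOpen c := by
  have := ChartedSpace.locallyConnectedSpace E M
  obtain ⟨x, -, rfl⟩ := hc
  exact (isOpen_compl_mirrorUnion hW).connectedComponentIn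

omit [T2Space M] [ConnectedSpace M] in
theorem smul_connectedComponentIn_compl_mirrorUnion {x : M} (hx : x ∈ (mirrorUnion W)ᶜ) (w : W) :
    (fun y => w • y) '' connectedComponentIn (mirrorUnion W)ᶜ x
      = connectedComponentIn (mirrorUnion W)ᶜ (w • x) := by
  have h1 : w.1.1 '' connectedComponentIn (mirrorUnion W)ᶜ x
      = connectedComponentIn (w.1.1 '' (mirrorUnion W)ᶜ) (w.1.1 x) :=
    w.1.1.image_connectedComponentIn hx
  have h2 : w.1.1 '' (mirrorUnion W)ᶜ = (mirrorUnion W)ᶜ := by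
    ext y
    constructor
    · rintro ⟨z, hz, rfl⟩
      exact fun h => hz ((smul_mem_mirrorUnion_iff w).1 h)
    · intro hy
      exact ⟨w⁻¹ • y, fun h => hy ((smul_mem_mirrorUnion_iff w⁻¹).1 h), smul_inv_smul w y⟩
  rw [h2] at h1
  exact h1

omit [T2Space M] [ConnectedSpace M] in
theorem IsOpenChamber.smul (hc : IsOpenChamber W c) (w : W) :
    IsOpenChamber W ((fun y => w • y) '' c) := by
  obtain ⟨x, hx, rfl⟩ := hc
  exact ⟨w • x, fun h => hx ((smul_mem_mirrorUnion_iff w).1 h),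
    smul_connectedComponentIn_compl_mirrorUnion hx w⟩

omit [T2Space M] [ConnectedSpace M] in
theorem IsOpenChamber.mem_chamberStabilizer (hc : IsOpenChamber W c) {y : M} (hy : y ∈ c) {w : W}
    (hwy : w • y ∈ c) : w ∈ chamberStabilizer W c := by
  change (fun y => w • y) '' c = c
  rw [(hc.smul w).eq_connectedComponentIn (mem_image_of_mem _ hy), ← hc.eq_connectedComponentIn hwy]

omit [FiniteDimensional ℝ E] [T2Space M] [ConnectedSpace M] in
theorem smul_mem_of_mem_chamberStabilizer {y : M} (hy : y ∈ c) {w : W}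
    (hw : w ∈ chamberStabilizer W c) : w • y ∈ c := by
  have h : (fun y => w • y) '' c = c := hw
  rw [← h]
  exact mem_image_of_mem _ hy

/-- Chamber membership is locally constant off the mirrors. -/
theorem IsOpenChamber.eventually_smul_mem_iff (hW : DiscreteTopology W) (hc : IsOpenChamber W c)
    {y : M} (hy : y ∈ (mirrorUnion W)ᶜ) : ∀ᶠ z in 𝓝 y, ∀ w : W, w • z ∈ c ↔ w • y ∈ c := by
  have := ChartedSpace.locallyConnectedSpace E M
  filter_upwards [(isOpen_compl_mirrorUnion hW).connectedComponentIn.mem_nhds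
    (mem_connectedComponentIn hy)] with z hz w
  have h1 := mem_image_of_mem (fun y => w • y) hz
  have h2 := mem_image_of_mem (fun y => w • y) (mem_connectedComponentIn hy)
  rw [smul_connectedComponentIn_compl_mirrorUnion hy] at h1 h2
  constructor
  · intro h
    rw [hc.eq_connectedComponentIn h, ← connectedComponentIn_eq h1]
    exact h2
  · intro h
    rw [hc.eq_connectedComponentIn h]
    exact h1

/-- A reflection group acts transitively on its chambers. -/
theorem IsOpenChamber.exists_inv_smul_mem (hW : DiscreteTopology W) (hc : IsOpenChamber W c)
    {y : M} (hy : y ∈ (mirrorUnion W)ᶜ) : ∃ w : W, w⁻¹ • y ∈ c := by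
  have hloc : ∀ x : M, ∃ a : Prop, ∀ᶠ y in 𝓝[(mirrorUnion W)ᶜ] x, (∃ w : W, w⁻¹ • y ∈ c) = a := by
    intro x
    refine exists_eventually_eq_of_invariant hW ?_
    filter_upwards [self_mem_nhdsWithin] with y hy
    constructor
    · filter_upwards [hc.eventually_smul_mem_iff hW hy] with z hz
      simp only [hz]
    · intro r _
      refine propext ⟨?_, ?_⟩
      · rintro ⟨w, hw⟩
        exact ⟨r⁻¹ * w, by simpa [mul_smul] using hw⟩
      · rintro ⟨w, hw⟩
        exact ⟨r * w, by simpa [mul_smul] using hw⟩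
  have hcl : IsClopen {x : M | ∀ᶠ y in 𝓝[(mirrorUnion W)ᶜ] x, ∃ w : W, w⁻¹ • y ∈ c} := by
    have hopen : ∀ p : M → Prop, IsOpen {x : M | ∀ᶠ y in 𝓝[(mirrorUnion W)ᶜ] x, p y} := by
      intro p
      simp only [eventually_nhdsWithin_iff]
      exact isOpen_setOfPred_eventually_nhds
    refine ⟨⟨?_⟩, hopen _⟩
    convert! hopen (fun y => ¬ ∃ w : W, w⁻¹ • y ∈ c) using 1
    ext x
    obtain ⟨a, ha⟩ := hloc x
    have := nhdsWithin_compl_mirrorUnion_neBot hW x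
    constructor
    · intro hx
      filter_upwards [ha] with z hz hz'
      refine hx ?_
      change ∀ᶠ y in 𝓝[(mirrorUnion W)ᶜ] x, ∃ w : W, w⁻¹ • y ∈ c
      filter_upwards [ha] with z' hz''
      rw [hz'', ← hz]
      exact hz'
    · intro hx hx'
      have h1 : ∀ᶠ y in 𝓝[(mirrorUnion W)ᶜ] x, ¬ ∃ w : W, w⁻¹ • y ∈ c := hx
      have h2 : ∀ᶠ y in 𝓝[(mirrorUnion W)ᶜ] x, ∃ w : W, w⁻¹ • y ∈ c := hx'
      obtain ⟨z, hz, hz'⟩ := (h1.and h2).exists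
      exact hz hz'
  obtain ⟨x, hx⟩ := hc.nonempty
  have huniv := hcl.eq_univ ⟨x, by
    change ∀ᶠ y in 𝓝[(mirrorUnion W)ᶜ] x, ∃ w : W, w⁻¹ • y ∈ c
    filter_upwards [mem_nhdsWithin_of_mem_nhds ((hc.isOpen hW).mem_nhds hx)] with y hy
    exact ⟨1, by simpa using hy⟩⟩
  have h1 : ∀ᶠ z in 𝓝[(mirrorUnion W)ᶜ] y, ∃ w : W, w⁻¹ • z ∈ c := huniv.ge (mem_univ y)
  exact h1.self_of_nhdsWithin hy

/-- The function `f : M → W` is a local section at `x` of the Coxeter cover: off the mirrors near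
`x` it is locally constant, takes `y` to some `w` with `y ∈ w c`, and is equivariant under the
reflections in the mirrors through `x`. -/
def IsLocalSection (W : Subgroup (Isom g)) (c : Set M) (f : M → W) (x : M) : Prop :=
  ∀ᶠ y in 𝓝[(mirrorUnion W)ᶜ] x, (f y)⁻¹ • y ∈ c ∧ (∀ᶠ z in 𝓝 y, f z = f y) ∧
    ∀ r ∈ mirrorReflections W x, f (r • y) = r * f y

/-- The condition of being a local section depends only on the germ of `f` off the mirrors. -/
theorem IsLocalSection.congr (hW : DiscreteTopology W) {f f' : M → W} {x : M}
    (h : IsLocalSection W c f x) (hff' : ∀ᶠ y in 𝓝[(mirrorUnion W)ᶜ] x, f y = f' y) :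
    IsLocalSection W c f' x := by
  have hNo := isOpen_compl_mirrorUnion hW
  have h2 : ∀ᶠ y in 𝓝[(mirrorUnion W)ᶜ] x, ∀ r ∈ mirrorReflections W x, f (r • y) = f' (r • y) := by
    have hfin : (mirrorReflections W x).Finite := by
      have := finite_stabilizer hW x
      exact (Set.toFinite (MulAction.stabilizer W x : Set W)).subset fun r hr => hr.2.1
    rw [eventually_all_finite hfin]
    intro r hr
    have ht := tendsto_smul_nhdsWithin_compl_mirrorUnion r x
    rw [hr.2.1] at ht
    exact ht.eventually hff'
  filter_upwards [h, hff', h2, eventually_eventually_nhdsWithin.2 hff', self_mem_nhdsWithin]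
    with y hy hyy hyr hyl hyN
  rw [hNo.nhdsWithin_eq hyN] at hyl
  refine ⟨by rw [← hyy]; exact hy.1, ?_, ?_⟩
  · filter_upwards [hy.2.1, hyl] with z hz hz'
    rw [← hz', hz, hyy]
  · intro r hr
    rw [← hyr r hr, hy.2.2 r hr, hyy]

/-- A local section at a point is one at all points near it, since fewer mirrors pass through
these. -/
theorem IsLocalSection.eventually (hW : DiscreteTopology W) {f : M → W} {x : M}
    (h : IsLocalSection W c f x) : ∀ᶠ y in 𝓝 x, IsLocalSection W c f y := by
  have h1 := eventually_eventually_nhds.2 (eventually_nhdsWithin_iff.1 h)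
  filter_upwards [h1, eventually_mirrorReflections_subset hW x] with y hy hys
  refine eventually_nhdsWithin_iff.2 (hy.mono fun z hz hzN => ?_)
  exact ⟨(hz hzN).1, (hz hzN).2.1, fun r hr => (hz hzN).2.2 r (hys hr)⟩

/-- In a chart in which the mirrors form a linear arrangement, the equivariant function of the
arrangement is a local section up to right multiplication with a constant. -/
theorem exists_isLocalSection (hW : DiscreteTopology W) (hc : IsOpenChamber W c) (x : M) :
    ∃ f : M → W, IsLocalSection W c f x := by
  obtain ⟨φ, A, hxφ, -, -, hL, hT, -, hreg⟩ := exists_arrangement_chart hW x univ_mem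
  obtain ⟨f₀, hf₀, hf₀T⟩ := A.exists_equivariant
  let f₁ : M → W := fun y => (f₀ (φ y)).1
  have hsrc := mem_nhdsWithin_of_mem_nhds (t := (mirrorUnion W)ᶜ) (φ.open_source.mem_nhds hxφ)
  have hf₁ : ∀ᶠ y in 𝓝[(mirrorUnion W)ᶜ] x, (∀ᶠ z in 𝓝 y, f₁ z = f₁ y) ∧
      ∀ r ∈ mirrorReflections W x, f₁ (r • y) = r * f₁ y := by
    filter_upwards [hsrc, self_mem_nhdsWithin] with y hy hyN
    have hyr := (hreg y hy).1 hyN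
    constructor
    · have h1 := (φ.continuousAt hy).eventually ((A.isOpen_setOf_same (φ y)).mem_nhds
        (show A.Same (φ y) (φ y) from hyr.same))
      filter_upwards [h1] with z hz
      exact congrArg Subtype.val (hf₀ _ _ hz).symm
    · intro r hr
      have ht : (⟨r, hr.2.1⟩ : MulAction.stabilizer W x) ∈ A.T := (hT _).2 hr
      have h1 := (hL ⟨r, hr.2.1⟩ y hy).2
      have h2 := hf₀T _ ht _ hyr
      rw [← h1] at h2
      exact congrArg Subtype.val h2
  -- the translates of `f₁` that are compatible with the chamber `c`
  obtain ⟨S, hS⟩ := exists_eventually_eq_of_invariant hW (x := x)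
    (h := fun y => {w : W | (f₁ y * w)⁻¹ • y ∈ c}) (by
      filter_upwards [hf₁, self_mem_nhdsWithin] with y hy hyN
      constructor
      · filter_upwards [hy.1, hc.eventually_smul_mem_iff hW hyN] with z hz hz'
        ext w
        rw [mem_ofPred_eq, mem_ofPred_eq, hz, hz']
      · intro r hr
        ext w
        rw [mem_ofPred_eq, mem_ofPred_eq, hy.2 r hr, ← mul_smul,
          show (r * f₁ y * w)⁻¹ * r = (f₁ y * w)⁻¹ by group])
  have := nhdsWithin_compl_mirrorUnion_neBot hW x
  obtain ⟨w₁, hw₁⟩ : S.Nonempty := by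
    obtain ⟨y, hy, hyN⟩ := (hS.and self_mem_nhdsWithin).exists
    obtain ⟨w, hw⟩ := hc.exists_inv_smul_mem hW hyN
    refine ⟨(f₁ y)⁻¹ * w, ?_⟩
    rw [← hy]
    simpa using hw
  refine ⟨fun y => f₁ y * w₁, ?_⟩
  filter_upwards [hf₁, hS] with y hy hyS
  refine ⟨?_, ?_, ?_⟩
  · rw [← hyS] at hw₁
    exact hw₁
  · filter_upwards [hy.1] with z hz
    rw [hz]
  · intro r hr
    rw [hy.2 r hr, mul_assoc]

/-- Two local sections differ by right multiplication with a constant in the stabilizer of the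
chamber. -/
theorem IsLocalSection.exists_mul (hW : DiscreteTopology W) (hc : IsOpenChamber W c)
    {f f' : M → W} {x : M} (h : IsLocalSection W c f x) (h' : IsLocalSection W c f' x) :
    ∃ γ ∈ chamberStabilizer W c, ∀ᶠ y in 𝓝[(mirrorUnion W)ᶜ] x, f' y = f y * γ := by
  obtain ⟨γ, hγ⟩ := exists_eventually_eq_of_invariant hW (x := x)
    (h := fun y => (f y)⁻¹ * f' y) (by
      filter_upwards [h, h'] with y hy hy'
      constructor
      · filter_upwards [hy.2.1, hy'.2.1] with z hz hz'
        rw [hz, hz']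
      · intro r hr
        rw [hy.2.2 r hr, hy'.2.2 r hr]
        group)
  have := nhdsWithin_compl_mirrorUnion_neBot hW x
  refine ⟨γ, ?_, hγ.mono fun y hy => by rw [← hy]; group⟩
  obtain ⟨y, hy, hyf, hyf'⟩ := (hγ.and (h.and h')).exists
  refine hc.mem_chamberStabilizer hyf'.1 ?_
  rw [← hy, ← mul_smul]
  simpa using hyf.1

omit [FiniteDimensional ℝ E] [T2Space M] [ConnectedSpace M] in
theorem IsLocalSection.mul_right {f : M → W} {x : M} (h : IsLocalSection W c f x) {γ : W}
    (hγ : γ ∈ chamberStabilizer W c) : IsLocalSection W c (fun y => f y * γ) x := by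
  filter_upwards [h] with y hy
  refine ⟨?_, ?_, ?_⟩
  · rw [mul_inv_rev, mul_smul]
    exact smul_mem_of_mem_chamberStabilizer hy.1 (inv_mem hγ)
  · filter_upwards [hy.2.1] with z hz
    rw [hz]
  · intro r hr
    rw [hy.2.2 r hr, mul_assoc]

omit [T2Space M] [ConnectedSpace M] in
theorem IsLocalSection.smul {f : M → W} {x : M} (h : IsLocalSection W c f x) (w : W) :
    IsLocalSection W c (fun y => w * f (w⁻¹ • y)) (w • x) := by
  have ht := tendsto_smul_nhdsWithin_compl_mirrorUnion w⁻¹ (w • x)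
  rw [inv_smul_smul] at ht
  filter_upwards [ht.eventually h] with y hy
  refine ⟨?_, ?_, ?_⟩
  · rw [mul_inv_rev, mul_smul]
    exact hy.1
  · have h4 := ((continuous_const_smul w⁻¹).continuousAt (x := y)).eventually hy.2.1
    filter_upwards [h4] with z hz
    rw [hz]
  · intro r hr
    have h5 : w⁻¹ * r * w ∈ mirrorReflections W x := by
      have := conj_mem_mirrorReflections hr w⁻¹
      rwa [inv_smul_smul, inv_inv] at this
    have h6 := hy.2.2 _ h5
    have h7 : (w⁻¹ * r * w) • w⁻¹ • y = w⁻¹ • r • y := by simp [mul_smul]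
    rw [h7] at h6
    rw [h6]
    group

end

/-! ### Smooth and Riemannian structures on the source of a local homeomorphism -/

section

variable {E : Type*} [NormedAddCommGroup E]
  {X M : Type*} [TopologicalSpace X] [TopologicalSpace M] [ChartedSpace E M]

/-- The preferred charts of `X` are the compositions of local inverses of `p : X → M` with the
preferred charts of `M`. This makes all the structure of `X` near `x` literally equal, in
coordinates, to that of `M` near `p x`. -/
structure IsPullbackAtlas [ChartedSpace E X] (p : X → M) : Prop where
  atlas_eq : atlas E X = range fun x : X => chartAt E x
  chartAt_eq : ∀ x : X, ∃ e : OpenPartialHomeomorph X M, ⇑e = p ∧ x ∈ e.source ∧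
    chartAt E x = e ≫ₕ chartAt E (p x)

/-- The source of a local homeomorphism to `M` inherits an atlas. The charted space structure is
existentially quantified, with its description in terms of that of `M` in `IsPullbackAtlas`. -/
theorem IsLocalHomeomorph.exists_isPullbackAtlas {p : X → M} (hp : IsLocalHomeomorph p) :
    ∃ _ : ChartedSpace E X, IsPullbackAtlas (E := E) p := by
  choose e hx he using hp
  have h (x : X) : e x x = p x := by rw [← he x]
  let _ : ChartedSpace E X :=
    { atlas := range fun x => e x ≫ₕ chartAt E (p x)
      chartAt := fun x => e x ≫ₕ chartAt E (p x)
      mem_chart_source := fun x => by simp [hx x, h]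
      chart_mem_atlas := fun x => mem_range_self x }
  exact ⟨_, rfl, fun x => ⟨e x, (he x).symm, hx x, rfl⟩⟩

namespace IsPullbackAtlas

variable [ChartedSpace E X] {p : X → M}

theorem continuous (hp : IsPullbackAtlas (E := E) p) : Continuous p := by
  refine continuous_iff_continuousAt.2 fun x => ?_
  obtain ⟨e, he, hx, -⟩ := hp.chartAt_eq x
  exact he ▸ e.continuousAt hx

theorem chartAt_apply (hp : IsPullbackAtlas (E := E) p) (x y : X) :
    chartAt E x y = chartAt E (p x) (p y) := by
  obtain ⟨e, he, hx, h⟩ := hp.chartAt_eq x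
  rw [h, ← he]; rfl

theorem mem_source (hp : IsPullbackAtlas (E := E) p) {x y : X} (hy : y ∈ (chartAt E x).source) :
    p y ∈ (chartAt E (p x)).source := by
  obtain ⟨e, he, hx, h⟩ := hp.chartAt_eq x
  rw [h] at hy
  rw [← he] at hy ⊢
  exact (by simpa using hy : _ ∧ _).2

theorem map_symm (hp : IsPullbackAtlas (E := E) p) {x : X} {z : E}
    (hz : z ∈ (chartAt E x).target) :
    p ((chartAt E x).symm z) = (chartAt E (p x)).symm z := by
  rw [(chartAt E (p x)).eq_symm_apply (hp.mem_source ((chartAt E x).map_target hz)) ?_,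
    ← hp.chartAt_apply, (chartAt E x).right_inv hz]
  rw [← (chartAt E x).right_inv hz, hp.chartAt_apply]
  exact (chartAt E (p x)).map_source (hp.mem_source ((chartAt E x).map_target hz))

variable [NormedSpace ℝ E]

theorem isManifold (hp : IsPullbackAtlas (E := E) p) [IsManifold 𝓘(ℝ, E) ∞ M] :
    IsManifold 𝓘(ℝ, E) ∞ X := by
  refine isManifold_of_contDiffOn _ _ _ fun e e' he he' => ?_
  rw [hp.atlas_eq] at he he'
  obtain ⟨x, rfl⟩ := he
  obtain ⟨x', rfl⟩ := he'
  have h := (contDiffGroupoid ∞ 𝓘(ℝ, E)).compatible (chart_mem_atlas E (p x))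
    (chart_mem_atlas E (p x'))
  rw [contDiffGroupoid, mem_groupoid_of_pregroupoid] at h
  replace h : ContDiffOn ℝ ∞ (𝓘(ℝ, E) ∘ _ ∘ 𝓘(ℝ, E).symm) _ := h.1
  simp only [modelWithCornersSelf_coe, modelWithCornersSelf_coe_symm, range_id, inter_univ,
    preimage_id_eq, id_eq, Function.id_comp, Function.comp_id,
    OpenPartialHomeomorph.coe_trans] at h ⊢
  have hs : ∀ z ∈ ((chartAt E x).symm ≫ₕ chartAt E x').source,
      p ((chartAt E x).symm z) = (chartAt E (p x)).symm z := fun z hz =>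
    hp.map_symm (by simpa using hz.1)
  refine (h.mono fun z hz => ?_).congr fun z hz => ?_
  · rw [OpenPartialHomeomorph.trans_source]
    refine ⟨?_, ?_⟩
    · have hz1 : z ∈ (chartAt E x).target := hz.1
      have := hp.mem_source ((chartAt E x).map_target hz1)
      rw [← (chartAt E x).right_inv hz1, hp.chartAt_apply]
      exact (chartAt E (p x)).map_source this
    · change (chartAt E (p x)).symm z ∈ (chartAt E (p x')).source
      rw [← hs z hz]
      exact hp.mem_source hz.2
  · change chartAt E x' ((chartAt E x).symm z) = chartAt E (p x') ((chartAt E (p x)).symm z)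
    rw [hp.chartAt_apply, hs z hz]

/-- A continuous lift of a smooth map is smooth. -/
theorem contMDiffOn_of_comp (hp : IsPullbackAtlas (E := E) p) {N : Type*} [TopologicalSpace N]
    [ChartedSpace E N] {h : N → X} {s : Set N} (hc : ContinuousOn h s)
    (hs : ContMDiffOn 𝓘(ℝ, E) 𝓘(ℝ, E) ∞ (fun y => p (h y)) s) :
    ContMDiffOn 𝓘(ℝ, E) 𝓘(ℝ, E) ∞ h s := by
  intro y hy
  refine contMDiffWithinAt_iff_target.2 ⟨hc y hy, ?_⟩
  convert (contMDiffWithinAt_iff_target.1 (hs y hy)).2 using 1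
  ext z
  simp [hp.chartAt_apply]

theorem contMDiff_of_comp (hp : IsPullbackAtlas (E := E) p) {N : Type*} [TopologicalSpace N]
    [ChartedSpace E N] {h : N → X} (hc : Continuous h)
    (hs : ContMDiff 𝓘(ℝ, E) 𝓘(ℝ, E) ∞ fun y => p (h y)) : ContMDiff 𝓘(ℝ, E) 𝓘(ℝ, E) ∞ h :=
  contMDiffOn_univ.1 (hp.contMDiffOn_of_comp hc.continuousOn hs.contMDiffOn)

variable [IsManifold 𝓘(ℝ, E) ∞ M] [IsManifold 𝓘(ℝ, E) ∞ X]

omit [IsManifold 𝓘(ℝ, E) ∞ M] [IsManifold 𝓘(ℝ, E) ∞ X] in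
theorem contMDiff (hp : IsPullbackAtlas (E := E) p) : ContMDiff 𝓘(ℝ, E) 𝓘(ℝ, E) ∞ p := by
  intro x
  refine contMDiffAt_iff_target.2 ⟨hp.continuous.continuousAt, ?_⟩
  convert (contMDiffAt_iff_target.1 (contMDiffAt_id (I := 𝓘(ℝ, E)) (n := ∞) (x := x))).2 using 1
  ext z
  simp [hp.chartAt_apply]

omit [IsManifold 𝓘(ℝ, E) ∞ M] [IsManifold 𝓘(ℝ, E) ∞ X] in
theorem mfderiv_eq (hp : IsPullbackAtlas (E := E) p) (x : X) :
    mfderiv 𝓘(ℝ, E) 𝓘(ℝ, E) p x = ContinuousLinearMap.id ℝ E := by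
  refine HasMFDerivAt.mfderiv ⟨hp.continuous.continuousAt, ?_⟩
  have : writtenInExtChartAt 𝓘(ℝ, E) 𝓘(ℝ, E) x p =ᶠ[𝓝 (extChartAt 𝓘(ℝ, E) x x)] id := by
    filter_upwards [extChartAt_target_mem_nhds x] with z hz
    have hz' : z ∈ (chartAt E x).target := by simpa using hz
    change chartAt E (p x) (p ((chartAt E x).symm z)) = z
    rw [← hp.chartAt_apply, (chartAt E x).right_inv hz']
  exact ((hasFDerivAt_id _).congr_of_eventuallyEq this).hasFDerivWithinAt

theorem tangentCoordChange_eq (hp : IsPullbackAtlas (E := E) p) {x y : X}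
    (hy : y ∈ (chartAt E x).source) :
    tangentCoordChange 𝓘(ℝ, E) x y y = tangentCoordChange 𝓘(ℝ, E) (p x) (p y) (p y) := by
  rw [tangentCoordChange_def, tangentCoordChange_def]
  simp only [modelWithCornersSelf_coe, range_id, fderivWithin_univ]
  have h : extChartAt 𝓘(ℝ, E) x y = extChartAt 𝓘(ℝ, E) (p x) (p y) := by
    simp [hp.chartAt_apply]
  rw [← h]
  refine Filter.EventuallyEq.fderiv_eq ?_
  have ht : (chartAt E x).target ∈ 𝓝 (extChartAt 𝓘(ℝ, E) x y) := by
    refine (chartAt E x).open_target.mem_nhds ?_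
    simpa using (chartAt E x).map_source hy
  filter_upwards [ht] with z hz
  simp [hp.chartAt_apply, hp.map_symm hz]

theorem isHypersurfaceAt_preimage_iff (hp : IsPullbackAtlas (E := E) p) {S : Set M} {x : X} :
    IsHypersurfaceAt E (p ⁻¹' S) x ↔ IsHypersurfaceAt E S (p x) := by
  obtain ⟨e, he, hx, -⟩ := hp.chartAt_eq x
  have he1 : ContMDiffOn 𝓘(ℝ, E) 𝓘(ℝ, E) ∞ e e.source := he ▸ hp.contMDiff.contMDiffOn
  have he2 : ContMDiffOn 𝓘(ℝ, E) 𝓘(ℝ, E) ∞ e.symm e.target := by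
    refine hp.contMDiffOn_of_comp e.continuousOn_symm ?_
    exact contMDiffOn_id.congr fun y hy => by rw [← he, e.right_inv hy]; rfl
  constructor
  · rintro ⟨φ, hφ, hxφ, F, hF, h⟩
    have h1 := contMDiffOn_of_mem_maximalAtlas hφ
    have h2 := contMDiffOn_symm_of_mem_maximalAtlas hφ
    refine ⟨e.symm ≫ₕ φ, mem_maximalAtlas_of_contMDiffOn
      (h1.comp (he2.mono fun y hy => hy.1) fun y hy => hy.2)
      (he1.comp (h2.mono fun y hy => hy.1) fun y hy => hy.2), ?_, F, hF, fun y hy => ?_⟩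
    · rw [← he]
      exact ⟨e.map_source hx, by simpa [e.left_inv hx] using hxφ⟩
    · refine Iff.trans ?_ (h (e.symm y) hy.2)
      rw [mem_preimage, ← he, e.right_inv hy.1]
  · rintro ⟨φ, hφ, hxφ, F, hF, h⟩
    have h1 := contMDiffOn_of_mem_maximalAtlas hφ
    have h2 := contMDiffOn_symm_of_mem_maximalAtlas hφ
    refine ⟨e ≫ₕ φ, mem_maximalAtlas_of_contMDiffOn
      (h1.comp (he1.mono fun y hy => hy.1) fun y hy => hy.2)
      (he2.comp (h2.mono fun y hy => hy.1) fun y hy => hy.2), ⟨hx, he.symm ▸ hxφ⟩, F, hF,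
      fun y hy => ?_⟩
    rw [mem_preimage, ← he]
    exact h (e y) hy.2

/-- The pullback of a Riemannian metric, as a family of bilinear maps. The tangent spaces of `X`
and `M` are all equal to `E`, and the derivative of `p` is the identity. -/
def pullbackInner (p : X → M) (g : SmoothMetric E M) (x : X) :
    TangentSpace 𝓘(ℝ, E) x →L[ℝ] TangentSpace 𝓘(ℝ, E) x →L[ℝ] ℝ :=
  g.inner (p x)

theorem contMDiff_pullbackInner (hp : IsPullbackAtlas (E := E) p) (g : SmoothMetric E M) :
    ContMDiff 𝓘(ℝ, E) (𝓘(ℝ, E).prod 𝓘(ℝ, E →L[ℝ] E →L[ℝ] ℝ)) ∞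
      (fun x : X => Bundle.TotalSpace.mk' (E →L[ℝ] E →L[ℝ] ℝ)
        (E := fun x : X => TangentSpace 𝓘(ℝ, E) x →L[ℝ] TangentSpace 𝓘(ℝ, E) x →L[ℝ] ℝ)
        x (pullbackInner p g x)) := by
  intro x
  rw [Bundle.contMDiffAt_section]
  have h := (Bundle.contMDiffAt_section _).1 (g.contMDiff (p x))
  have h2 := h.comp x hp.contMDiff.contMDiffAt
  refine h2.congr_of_eventuallyEq ?_
  filter_upwards [(chartAt E x).open_source.mem_nhds (mem_chart_source E x)] with y hy
  have hy' := hp.mem_source hy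
  simp only [hom_trivializationAt_apply, Function.comp]
  ext v w
  rw [inCoordinates_apply_eq₂, inCoordinates_apply_eq₂]
  · have hb : y ∈ (trivializationAt E (TangentSpace 𝓘(ℝ, E)) x).baseSet := hy
    have hb' : p y ∈ (trivializationAt E (TangentSpace 𝓘(ℝ, E)) (p x)).baseSet := hy'
    have hs : ∀ v : E, ((trivializationAt E (TangentSpace 𝓘(ℝ, E)) x).symmL ℝ y v : E)
        = (trivializationAt E (TangentSpace 𝓘(ℝ, E)) (p x)).symmL ℝ (p y) v := fun v =>
      (congrArg (fun A : E →L[ℝ] E => A v) (TangentBundle.symmL_trivializationAt_eq_core hy)).trans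
      ((congrArg (fun A : E →L[ℝ] E => A v) (hp.tangentCoordChange_eq hy)).trans
      (congrArg (fun A : E →L[ℝ] E => A v)
        (TangentBundle.symmL_trivializationAt_eq_core hy')).symm)
    have ht (b : ℝ) : (trivializationAt ℝ (Bundle.Trivial X ℝ) x).linearMapAt ℝ y b = b := by
      simp
    have ht' (b : ℝ) :
        (trivializationAt ℝ (Bundle.Trivial M ℝ) (p x)).linearMapAt ℝ (p y) b = b := by
      simp
    refine (ht _).trans (.trans ?_ (ht' _).symm)
    rw [← Bundle.Trivialization.symmL_apply (R := ℝ) _ hb,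
      ← Bundle.Trivialization.symmL_apply (R := ℝ) _ hb,
      ← Bundle.Trivialization.symmL_apply (R := ℝ) _ hb',
      ← Bundle.Trivialization.symmL_apply (R := ℝ) _ hb']
    exact congrArg₂ (fun a b : E => (g.inner (p y) : E →L[ℝ] E →L[ℝ] ℝ) a b) (hs v) (hs w)
  all_goals first | exact hy | exact hy' | exact mem_univ _

/-- The pullback of a Riemannian metric along `p`. -/
def pullbackMetric (hp : IsPullbackAtlas (E := E) p) (g : SmoothMetric E M) : SmoothMetric E X where
  inner := pullbackInner p g
  symm x := g.symm (p x)
  pos x := g.pos (p x)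
  isVonNBounded x := g.isVonNBounded (p x)
  contMDiff := hp.contMDiff_pullbackInner g

theorem preservesMetric (hp : IsPullbackAtlas (E := E) p) (g : SmoothMetric E M) :
    PreservesMetric (hp.pullbackMetric g) g p where
  contMDiff := hp.contMDiff
  inner_eq x v w := by
    rw [hp.mfderiv_eq]; rfl

/-- A continuous lift of a local isometry is a local isometry. -/
theorem preservesMetric_of_comp (hp : IsPullbackAtlas (E := E) p) {g : SmoothMetric E M}
    {h : X → X} {w : M → M} (hc : Continuous h) (hw : PreservesMetric g g w)
    (hl : ∀ x, p (h x) = w (p x)) :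
    PreservesMetric (hp.pullbackMetric g) (hp.pullbackMetric g) h := by
  have hs : ContMDiff 𝓘(ℝ, E) 𝓘(ℝ, E) ∞ h := by
    refine hp.contMDiff_of_comp hc ?_
    simp only [hl]
    exact hw.contMDiff.comp hp.contMDiff
  refine ⟨hs, fun x v v' => ?_⟩
  have h1 := (hw.comp (hp.preservesMetric g)).inner_eq x v v'
  have h2 : mfderiv 𝓘(ℝ, E) 𝓘(ℝ, E) (fun y => p (h y)) x
      = (mfderiv 𝓘(ℝ, E) 𝓘(ℝ, E) p (h x)).comp (mfderiv 𝓘(ℝ, E) 𝓘(ℝ, E) h x) :=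
    mfderiv_comp x (hp.contMDiff.mdifferentiableAt (by simp)) (hs.mdifferentiableAt (by simp))
  have h3 : PreservesMetric (hp.pullbackMetric g) g fun x => p (h x) := by
    simp only [hl]
    exact hw.comp (hp.preservesMetric g)
  rw [← h3.inner_eq x v v', h2, ← (hp.preservesMetric g).inner_eq]
  rfl

end IsPullbackAtlas

end

/-! ### The Coxeter cover -/

section

variable {E : Type*} [NormedAddCommGroup E] [NormedSpace ℝ E]
  {M : Type u} [TopologicalSpace M] [ChartedSpace E M] [IsManifold 𝓘(ℝ, E) ∞ M]
  {g : SmoothMetric E M}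

/-- Two pairs of a point and a local section at it are equivalent if the points agree and the
sections agree off the mirrors near the point. -/
def coxeterCoverSetoid (W : Subgroup (Isom g)) (c : Set M) :
    Setoid {q : M × (M → W) // IsLocalSection W c q.2 q.1} where
  r q q' := q.1.1 = q'.1.1 ∧ ∀ᶠ y in 𝓝[(mirrorUnion W)ᶜ] q.1.1, q.1.2 y = q'.1.2 y
  iseqv :=
    { refl := fun q => ⟨rfl, .of_forall fun _ => rfl⟩
      symm := fun {q q'} h => ⟨h.1.symm, h.1 ▸ h.2.mono fun _ => Eq.symm⟩
      trans := fun {q q' q''} h h' => ⟨h.1.trans h'.1, by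
        filter_upwards [h.2, h.1 ▸ h'.2] with y hy hy' using hy.trans hy'⟩ }

/-- The Coxeter cover of `M`: the space of germs, off the mirrors, of local sections. -/
def CoxeterCover (W : Subgroup (Isom g)) (c : Set M) : Type u :=
  Quotient (coxeterCoverSetoid W c)

namespace CoxeterCover

variable {W : Subgroup (Isom g)} {c : Set M}

/-- The germ at `x` of the local section `f`. -/
def mk (x : M) (f : M → W) (h : IsLocalSection W c f x) : CoxeterCover W c :=
  Quotient.mk (coxeterCoverSetoid W c) ⟨(x, f), h⟩

/-- The projection of the Coxeter cover. -/
def proj : CoxeterCover W c → M :=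
  Quotient.lift (fun q => q.1.1) fun _ _ h => h.1

theorem exists_rep (q : CoxeterCover W c) : ∃ x f, ∃ h : IsLocalSection W c f x, q = mk x f h := by
  obtain ⟨⟨⟨x, f⟩, h⟩, rfl⟩ := Quotient.exists_rep q
  exact ⟨x, f, h, rfl⟩

theorem mk_eq_mk_iff {x x' : M} {f f' : M → W} {h : IsLocalSection W c f x}
    {h' : IsLocalSection W c f' x'} :
    mk x f h = mk x' f' h' ↔ x = x' ∧ ∀ᶠ y in 𝓝[(mirrorUnion W)ᶜ] x, f y = f' y :=
  Quotient.eq (r := coxeterCoverSetoid W c)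

/-- A set of germs is open if with the germ of `f` at `x` it contains the germs of `f` at all
points near `x`. -/
instance : TopologicalSpace (CoxeterCover W c) where
  IsOpen s := ∀ x f, ∀ h : IsLocalSection W c f x, mk x f h ∈ s →
    ∀ᶠ y in 𝓝 x, ∀ h' : IsLocalSection W c f y, mk y f h' ∈ s
  isOpen_univ := fun _ _ _ _ => .of_forall fun _ _ => mem_univ _
  isOpen_inter := fun s t hs ht x f h hx => by
    filter_upwards [hs x f h hx.1, ht x f h hx.2] with y h1 h2 h' using ⟨h1 h', h2 h'⟩
  isOpen_sUnion := fun S hS x f h ⟨s, hs, hx⟩ =>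
    (hS s hs x f h hx).mono fun y hy h' => ⟨s, hs, hy h'⟩

theorem isOpen_iff {s : Set (CoxeterCover W c)} :
    IsOpen s ↔ ∀ x f, ∀ h : IsLocalSection W c f x, mk x f h ∈ s →
      ∀ᶠ y in 𝓝 x, ∀ h' : IsLocalSection W c f y, mk y f h' ∈ s := Iff.rfl

theorem continuous_proj : Continuous (proj : CoxeterCover W c → M) := by
  refine continuous_def.2 fun U hU => isOpen_iff.2 fun x f h hx => ?_
  filter_upwards [hU.mem_nhds hx] with y hy _ using hy

/-- The image of the function `f` as a section, where it is one. -/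
def sheet (c : Set M) (f : M → W) : Set (CoxeterCover W c) :=
  {q | ∃ h : IsLocalSection W c f (proj q), q = mk (proj q) f h}

theorem mk_mem_sheet {x : M} {f : M → W} (h : IsLocalSection W c f x) : mk x f h ∈ sheet c f :=
  ⟨h, rfl⟩

theorem mk_mem_sheet_iff {x : M} {f f' : M → W} {h : IsLocalSection W c f x}
    (h' : IsLocalSection W c f' x) :
    mk x f h ∈ sheet c f' ↔ ∀ᶠ y in 𝓝[(mirrorUnion W)ᶜ] x, f y = f' y :=
  ⟨fun ⟨_, hq⟩ => (mk_eq_mk_iff.1 hq).2, fun hq => ⟨h', mk_eq_mk_iff.2 ⟨rfl, hq⟩⟩⟩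

theorem injOn_proj_sheet (f : M → W) : InjOn proj (sheet c f) := by
  rintro q ⟨h, hq⟩ q' ⟨h', hq'⟩ he
  rw [hq, hq', mk_eq_mk_iff]
  exact ⟨he, .of_forall fun _ => rfl⟩

variable [FiniteDimensional ℝ E]

/-- The action of `W × W_c` on germs of sections: `W` by translation and `W_c` by right
multiplication. -/
instance : SMul (W × chamberStabilizer W c) (CoxeterCover W c) where
  smul a := Quotient.lift
    (fun q => mk (a.1 • q.1.1) (fun y => a.1 * q.1.2 (a.1⁻¹ • y) * (a.2 : W)⁻¹)
      ((q.2.smul a.1).mul_right (inv_mem a.2.2))) fun q q' hq => by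
    obtain ⟨⟨⟨x, f⟩, h⟩, ⟨⟨x', f'⟩, h'⟩⟩ := q, q'
    obtain ⟨rfl, he⟩ : x = x' ∧ ∀ᶠ y in 𝓝[(mirrorUnion W)ᶜ] x, f y = f' y := hq
    refine mk_eq_mk_iff.2 ⟨rfl, ?_⟩
    have ht := tendsto_smul_nhdsWithin_compl_mirrorUnion a.1⁻¹ (a.1 • x)
    rw [inv_smul_smul] at ht
    filter_upwards [ht.eventually he] with y hy
    simp only [hy]

theorem smul_mk (a : W × chamberStabilizer W c) {x : M} {f : M → W} (h : IsLocalSection W c f x) :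
    a • mk x f h = mk (a.1 • x) (fun y => a.1 * f (a.1⁻¹ • y) * (a.2 : W)⁻¹)
      ((h.smul a.1).mul_right (inv_mem a.2.2)) := rfl

instance : MulAction (W × chamberStabilizer W c) (CoxeterCover W c) where
  one_smul q := by
    obtain ⟨x, f, h, rfl⟩ := exists_rep q
    rw [smul_mk, mk_eq_mk_iff]
    exact ⟨one_smul _ _, .of_forall fun y => by simp⟩
  mul_smul a b q := by
    obtain ⟨x, f, h, rfl⟩ := exists_rep q
    rw [smul_mk, smul_mk, smul_mk, mk_eq_mk_iff]
    exact ⟨mul_smul _ _ _, .of_forall fun y => by simp [mul_smul, mul_assoc]⟩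

@[simp]
theorem proj_smul (a : W × chamberStabilizer W c) (q : CoxeterCover W c) :
    proj (a • q) = a.1 • proj q := by
  obtain ⟨x, f, h, rfl⟩ := exists_rep q
  rfl

instance : ContinuousConstSMul (W × chamberStabilizer W c) (CoxeterCover W c) where
  continuous_const_smul a := by
    refine continuous_def.2 fun s hs => isOpen_iff.2 fun x f h hx => ?_
    have hx' : mk _ _ _ ∈ s := hx
    have h1 := (continuous_const_smul a.1).continuousAt.tendsto.eventually
      (isOpen_iff.1 hs _ _ _ hx')
    filter_upwards [h1] with y hy h' using hy _

variable [T2Space M] [ConnectedSpace M]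

theorem isOpen_sheet (hW : DiscreteTopology W) (f : M → W) : IsOpen (sheet c f) := by
  refine isOpen_iff.2 fun x f' h hx => ?_
  obtain ⟨h1, h2⟩ := hx
  have h2 := (mk_eq_mk_iff.1 h2).2
  filter_upwards [h1.eventually hW, eventually_nhds_nhdsWithin.2 h2] with y h1y h2y h'
  exact (mk_mem_sheet_iff h1y).2 h2y

theorem isOpenMap_proj (hW : DiscreteTopology W) : IsOpenMap (proj : CoxeterCover W c → M) := by
  intro s hs
  refine isOpen_iff_mem_nhds.2 ?_
  rintro _ ⟨q, hq, rfl⟩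
  obtain ⟨x, f, h, rfl⟩ := exists_rep q
  filter_upwards [isOpen_iff.1 hs x f h hq, h.eventually hW] with y hy hy'
  exact ⟨_, hy hy', rfl⟩

theorem isLocalHomeomorph_proj (hW : DiscreteTopology W) :
    IsLocalHomeomorph (proj : CoxeterCover W c → M) := by
  refine isLocalHomeomorph_iff_isOpenEmbedding_restrict.2 fun q => ?_
  obtain ⟨x, f, h, rfl⟩ := exists_rep q
  refine ⟨sheet c f, (isOpen_sheet hW f).mem_nhds (mk_mem_sheet h), ?_⟩
  refine .of_continuous_injective_isOpenMap (continuous_proj.comp continuous_subtype_val)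
    (injOn_iff_injective.1 (injOn_proj_sheet f))
    ((isOpenMap_proj hW).comp (isOpen_sheet hW f).isOpenMap_subtype_val)

theorem surjective_proj (hW : DiscreteTopology W) (hc : IsOpenChamber W c) :
    Function.Surjective (proj : CoxeterCover W c → M) := fun x => by
  obtain ⟨f, hf⟩ := exists_isLocalSection hW hc x
  exact ⟨mk x f hf, rfl⟩

/-- The stabilizer of the base chamber acts transitively on the fibres. -/
theorem exists_smul_eq (hW : DiscreteTopology W) (hc : IsOpenChamber W c) {q q' : CoxeterCover W c}
    (h : proj q = proj q') : ∃ γ : chamberStabilizer W c, ((1, γ) : W × _) • q = q' := by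
  obtain ⟨x, f, hf, rfl⟩ := exists_rep q
  obtain ⟨x', f', hf', rfl⟩ := exists_rep q'
  obtain rfl : x = x' := h
  obtain ⟨γ, hγ, he⟩ := hf.exists_mul hW hc hf'
  refine ⟨⟨γ, hγ⟩⁻¹, ?_⟩
  rw [smul_mk, mk_eq_mk_iff]
  refine ⟨one_smul _ _, ?_⟩
  simp only [one_smul]
  filter_upwards [he] with y hy
  simp [hy]

/-- The stabilizer of the base chamber acts freely on the Coxeter cover, even locally. -/
theorem eq_one_of_smul_mem_sheet (hW : DiscreteTopology W) {f : M → W} {q : CoxeterCover W c}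
    {γ : chamberStabilizer W c} (hq : q ∈ sheet c f) (hq' : ((1, γ) : W × _) • q ∈ sheet c f) :
    γ = 1 := by
  obtain ⟨h, hq⟩ := hq
  rw [hq, smul_mk] at hq'
  have := (mk_mem_sheet_iff (by simpa using h)).1 hq'
  have hne := nhdsWithin_compl_mirrorUnion_neBot hW (proj q)
  simp only [one_smul] at this
  obtain ⟨y, hy⟩ := this.exists
  simpa using hy

theorem isCoveringMap_proj (hW : DiscreteTopology W) (hc : IsOpenChamber W c) :
    IsCoveringMap (proj : CoxeterCover W c → M) := by
  let φ : chamberStabilizer W c →* W × chamberStabilizer W c := MonoidHom.inr _ _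
  let _ : MulAction (chamberStabilizer W c) (CoxeterCover W c) := MulAction.compHom _ φ
  have : IsQuotientCoveringMap (proj : CoxeterCover W c → M) (chamberStabilizer W c) :=
    { toIsQuotientMap := (isOpenMap_proj hW).isQuotientMap continuous_proj (surjective_proj hW hc)
      continuous_const_smul := fun γ =>
        continuous_const_smul (T := CoxeterCover W c) ((1, γ) : W × chamberStabilizer W c)
      apply_eq_iff_mem_orbit := fun {q q'} => by
        constructor
        · intro h
          exact exists_smul_eq hW hc h.symm
        · rintro ⟨γ, rfl⟩
          exact (proj_smul ((1, γ) : W × chamberStabilizer W c) q').trans (one_smul _ _)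
      disjoint := fun q => by
        obtain ⟨x, f, h, rfl⟩ := exists_rep q
        refine ⟨sheet c f, (isOpen_sheet hW f).mem_nhds (mk_mem_sheet h), ?_⟩
        rintro γ ⟨_, ⟨q, hq, rfl⟩, hq'⟩
        exact eq_one_of_smul_mem_sheet hW hq hq' }
  exact this.isCoveringMap

theorem t2Space (hW : DiscreteTopology W) (hc : IsOpenChamber W c) :
    T2Space (CoxeterCover W c) := by
  refine ⟨fun q q' hne => ?_⟩
  by_cases h : proj q = proj q'
  · exact (isCoveringMap_proj hW hc).isSeparatedMap q q' h hne
  · obtain ⟨U, V, hU, hV, hq, hq', hUV⟩ := t2_separation h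
    exact ⟨_, _, hU.preimage continuous_proj, hV.preimage continuous_proj, hq, hq',
      hUV.preimage _⟩

/-- A discrete group of isometries is countable, as its orbits are locally finite. -/
theorem _root_.countable_of_discreteTopology [SecondCountableTopology M]
    (hW : DiscreteTopology W) : Countable W := by
  obtain ⟨x⟩ := (inferInstance : Nonempty M)
  have h : ∀ y : M, ∃ V ∈ 𝓝 y, {w : W | w • x ∈ V}.Finite := fun y => by
    obtain ⟨U, hU, V, hV, hf⟩ := exists_nhds_finite_of_discrete hW x y
    exact ⟨V, hV, hf.subset fun w hw => ⟨x, mem_of_mem_nhds hU, hw⟩⟩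
  choose V hV hf using h
  obtain ⟨s, hs, hsU⟩ := TopologicalSpace.countable_cover_nhds hV
  refine countable_univ_iff.1 ((hs.biUnion fun y _ => (hf y).countable).mono fun w _ => ?_)
  have := hsU.ge (mem_univ (w • x))
  simpa using this

theorem secondCountableTopology [SecondCountableTopology M] (hW : DiscreteTopology W)
    (hc : IsOpenChamber W c) : SecondCountableTopology (CoxeterCover W c) := by
  have := countable_of_discreteTopology hW
  choose f hf using exists_isLocalSection hW hc
  obtain ⟨s, hs, hsU⟩ := TopologicalSpace.countable_cover_nhds fun x => (hf x).eventually hW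
  have := hs.to_subtype
  have hsec : ∀ f : M → W, SecondCountableTopology (sheet c f) := fun f =>
    (IsOpenEmbedding.of_continuous_injective_isOpenMap
      (continuous_proj.comp continuous_subtype_val) (injOn_iff_injective.1 (injOn_proj_sheet f))
      ((isOpenMap_proj hW).comp (isOpen_sheet hW f).isOpenMap_subtype_val)
      |>.isInducing.secondCountableTopology)
  refine TopologicalSpace.secondCountableTopology_of_countable_cover
    (U := fun i : s × W => sheet c fun y => f i.1 y * i.2) (fun i => isOpen_sheet hW _) ?_
  refine eq_univ_of_forall fun q => ?_
  obtain ⟨x, f', h, rfl⟩ := exists_rep q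
  obtain ⟨z, hz, hx⟩ := mem_iUnion₂.1 (hsU.ge (mem_univ x))
  obtain ⟨γ, hγ, he⟩ := IsLocalSection.exists_mul hW hc hx h
  exact mem_iUnion.2 ⟨(⟨z, hz⟩, γ), (mk_mem_sheet_iff (hx.mul_right hγ)).2 he⟩

end CoxeterCover

end

/-! ### Chambers and connectedness of the Coxeter cover -/

section

variable {E : Type*} [NormedAddCommGroup E] [NormedSpace ℝ E] [FiniteDimensional ℝ E]
  {M : Type u} [TopologicalSpace M] [ChartedSpace E M] [IsManifold 𝓘(ℝ, E) ∞ M]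
  [T2Space M] [ConnectedSpace M] {g : SmoothMetric E M} {W : Subgroup (Isom g)} {c : Set M}

omit [FiniteDimensional ℝ E] [T2Space M] [ConnectedSpace M] in
/-- A property of the elements of `W` that defines a subgroup holds for all of them if it holds
for the reflections. -/
theorem IsReflectionGroup.eq_top_of_forall_mem (hW : IsReflectionGroup W) {H : Subgroup W}
    (h : ∀ r : W, IsReflection r.1 → r ∈ H) : H = ⊤ := by
  have h1 : W ≤ H.map W.subtype := by
    conv_lhs => rw [← hW.generated]
    refine (Subgroup.closure_le _).2 ?_
    rintro r ⟨hr, hr'⟩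
    exact ⟨⟨r, hr⟩, h _ hr', rfl⟩
  refine (Subgroup.eq_top_iff' H).2 fun w => ?_
  obtain ⟨w', hw', he⟩ := h1 w.2
  rwa [← Subtype.ext he]

namespace CoxeterCover

theorem isLocalSection_const_iff (hW : DiscreteTopology W) (hc : IsOpenChamber W c) {x : M}
    (hx : x ∈ (mirrorUnion W)ᶜ) {w : W} : IsLocalSection W c (fun _ => w) x ↔ w⁻¹ • x ∈ c := by
  have h1 := hc.eventually_smul_mem_iff hW hx
  have h2 : mirrorReflections W x = ∅ := by
    rw [← not_nonempty_iff_eq_empty, ← mem_mirrorUnion_iff_nonempty]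
    exact hx
  rw [IsLocalSection, (isOpen_compl_mirrorUnion hW).nhdsWithin_eq hx]
  constructor
  · intro h
    exact h.self_of_nhds.1
  · intro h
    filter_upwards [h1] with y hy
    exact ⟨(hy _).2 h, .of_forall fun _ => rfl, by simp [h2]⟩

/-- The open chamber of the Coxeter cover of all germs of the constant section `w`. -/
def chamber (c : Set M) (w : W) : Set (CoxeterCover W c) :=
  sheet c (fun _ => w) ∩ proj ⁻¹' (mirrorUnion W)ᶜ

theorem isOpen_chamber (hW : DiscreteTopology W) (w : W) : IsOpen (chamber c w) :=
  (isOpen_sheet hW _).inter ((isOpen_compl_mirrorUnion hW).preimage continuous_proj)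

theorem mk_mem_chamber (hW : DiscreteTopology W) {x : M} {f : M → W}
    (h : IsLocalSection W c f x) (hx : x ∈ (mirrorUnion W)ᶜ) : mk x f h ∈ chamber c (f x) := by
  have he : ∀ᶠ y in 𝓝[(mirrorUnion W)ᶜ] x, f y = f x := by
    have h' := h
    rw [IsLocalSection, (isOpen_compl_mirrorUnion hW).nhdsWithin_eq hx] at h'
    exact nhdsWithin_le_nhds h'.self_of_nhds.2.1
  exact ⟨(mk_mem_sheet_iff (h.congr hW he)).2 he, hx⟩

theorem exists_mem_chamber (hW : DiscreteTopology W) {q : CoxeterCover W c}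
    (hq : proj q ∈ (mirrorUnion W)ᶜ) : ∃ w, q ∈ chamber c w := by
  obtain ⟨x, f, h, rfl⟩ := exists_rep q
  exact ⟨_, mk_mem_chamber hW h hq⟩

theorem iUnion_chamber (hW : DiscreteTopology W) :
    ⋃ w : W, chamber c w = proj ⁻¹' (mirrorUnion W)ᶜ := by
  refine Subset.antisymm (iUnion_subset fun w => inter_subset_right) fun q hq => ?_
  exact mem_iUnion.2 (exists_mem_chamber hW hq)

theorem eq_of_mem_chamber (hW : DiscreteTopology W) {q : CoxeterCover W c} {w w' : W}
    (h : q ∈ chamber c w) (h' : q ∈ chamber c w') : w = w' := by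
  obtain ⟨⟨h1, hq⟩, -⟩ := h
  obtain ⟨⟨h1', hq'⟩, -⟩ := h'
  have hne := nhdsWithin_compl_mirrorUnion_neBot hW (proj q)
  obtain ⟨y, hy⟩ := (mk_eq_mk_iff.1 (hq.symm.trans hq')).2.exists
  exact hy

omit [T2Space M] [ConnectedSpace M] in
theorem smul_mem_chamber {q : CoxeterCover W c} {w : W} (h : q ∈ chamber c w)
    (v : W) : ((v, 1) : W × chamberStabilizer W c) • q ∈ chamber c (v * w) := by
  obtain ⟨⟨h1, hq⟩, h2⟩ := h
  constructor
  · rw [hq, smul_mk]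
    refine (mk_mem_sheet_iff (h1.smul v)).2 (.of_forall fun y => by simp)
  · rw [mem_preimage, proj_smul]
    exact fun h => h2 ((smul_mem_mirrorUnion_iff v).1 h)

omit [T2Space M] [ConnectedSpace M] in
theorem image_smul_chamber (v w : W) :
    (fun q => ((v, 1) : W × chamberStabilizer W c) • q) '' chamber c w = chamber c (v * w) := by
  refine Subset.antisymm (image_subset_iff.2 fun q hq => smul_mem_chamber hq v) fun q hq => ?_
  refine ⟨((v⁻¹, 1) : W × chamberStabilizer W c) • q, ?_, ?_⟩
  · simpa using smul_mem_chamber hq v⁻¹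
  · simp only [smul_smul, Prod.mk_mul_mk, mul_inv_cancel, mul_one]
    exact one_smul (W × chamberStabilizer W c) q

theorem isConnected_chamber (hW : DiscreteTopology W) (hc : IsOpenChamber W c) (w : W) :
    IsConnected (chamber c w) := by
  have hc1 : IsConnected c := by
    obtain ⟨x, hx, rfl⟩ := hc
    exact isConnected_connectedComponentIn_iff.2 hx
  have hw : ∀ y : c, w • y.1 ∈ (mirrorUnion W)ᶜ := fun y h =>
    hc.subset y.2 ((smul_mem_mirrorUnion_iff w).1 h)
  have hs : ∀ y : c, IsLocalSection W c (fun _ => w) (w • y.1) := fun y =>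
    (isLocalSection_const_iff hW hc (hw y)).2 (by simp)
  let s : c → CoxeterCover W c := fun y => mk (w • y.1) (fun _ => w) (hs y)
  have hsc : Continuous s := by
    refine continuous_def.2 fun O hO => isOpen_iff_mem_nhds.2 fun y hy => ?_
    have h1 : Continuous fun z : c => w • z.1 := continuous_subtype_val.const_smul w
    filter_upwards [h1.continuousAt.tendsto.eventually (isOpen_iff.1 hO _ _ _ hy)] with z hz
      using hz _
  have hr : range s = chamber c w := by
    refine Subset.antisymm ?_ fun q hq => ?_
    · rintro _ ⟨y, rfl⟩
      exact ⟨mk_mem_sheet _, hw y⟩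
    · obtain ⟨⟨h1, hq⟩, h2⟩ := hq
      refine ⟨⟨w⁻¹ • proj q, (isLocalSection_const_iff hW hc h2).1 h1⟩, ?_⟩
      conv_rhs => rw [hq]
      exact mk_eq_mk_iff.2 ⟨by simp, .of_forall fun _ => rfl⟩
  have := isConnected_iff_connectedSpace.1 hc1
  rw [← hr]
  exact isConnected_range hsc

theorem chamber_injective (hW : DiscreteTopology W) (hc : IsOpenChamber W c) :
    Function.Injective (chamber c : W → Set (CoxeterCover W c)) := fun v w h => by
  obtain ⟨q, hq⟩ := (isConnected_chamber hW hc v).nonempty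
  exact eq_of_mem_chamber hW hq (h ▸ hq)

/-- The sets `chamber c w` are the connected components of the complement of the preimage of the
mirrors. -/
theorem connectedComponentIn_eq_chamber (hW : DiscreteTopology W) (hc : IsOpenChamber W c)
    {q : CoxeterCover W c} {w : W} (hq : q ∈ chamber c w) :
    connectedComponentIn (proj ⁻¹' (mirrorUnion W)ᶜ) q = chamber c w := by
  refine Subset.antisymm ?_
    ((isConnected_chamber hW hc w).isPreconnected.subset_connectedComponentIn hq inter_subset_right)
  refine isPreconnected_connectedComponentIn.subset_left_of_subset_union (isOpen_chamber hW w)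
    (isOpen_iUnion fun v : {v : W // v ≠ w} => isOpen_chamber hW v.1) ?_ ?_
    ⟨q, mem_connectedComponentIn hq.2, hq⟩
  · refine disjoint_left.2 fun z hz hz' => ?_
    obtain ⟨v, hv⟩ := mem_iUnion.1 hz'
    exact v.2 (eq_of_mem_chamber hW hv hz)
  · refine (connectedComponentIn_subset _ _).trans fun z hz => ?_
    obtain ⟨v, hv⟩ := exists_mem_chamber hW hz
    by_cases hvw : v = w
    · exact Or.inl (hvw ▸ hv)
    · exact Or.inr (mem_iUnion.2 ⟨⟨v, hvw⟩, hv⟩)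

omit [T2Space M] [ConnectedSpace M] in
/-- A reflection in a mirror through `x` fixes all the points above `x`: this is what the
equivariance of local sections is for. -/
theorem smul_eq_of_mem_mirrorReflections {q : CoxeterCover W c} {r : W}
    (hr : r ∈ mirrorReflections W (proj q)) : ((r, 1) : W × chamberStabilizer W c) • q = q := by
  obtain ⟨x, f, h, rfl⟩ := exists_rep q
  have hrr : r * r = 1 := mul_self_of_mem_mirrorReflections hr
  have hri : r⁻¹ = r := inv_eq_of_mul_eq_one_left hrr
  have hx : r • x = x := hr.2.1
  rw [smul_mk, mk_eq_mk_iff]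
  refine ⟨hx, ?_⟩
  simp only [hx]
  filter_upwards [h] with y hy
  rw [hri, hy.2.2 r hr]
  simp [← mul_assoc, hrr]

theorem locallyConnectedSpace (hW : DiscreteTopology W) :
    LocallyConnectedSpace (CoxeterCover W c) := by
  obtain ⟨_, -⟩ := (isLocalHomeomorph_proj (c := c) hW).exists_isPullbackAtlas (E := E)
  exact ChartedSpace.locallyConnectedSpace E _

omit [T2Space M] [ConnectedSpace M] in
theorem connectedComponent_smul_congr (a : W × chamberStabilizer W c) {q q' : CoxeterCover W c}
    (h : connectedComponent q = connectedComponent q') :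
    connectedComponent (a • q) = connectedComponent (a • q') :=
  connectedComponent_eq ((continuous_const_smul a).image_connectedComponent_subset q
    (mem_image_of_mem _ (h ▸ mem_connectedComponent)))

/-- Since the deck transformations act transitively on the fibres, each component of the Coxeter
cover maps onto `M`. -/
theorem image_connectedComponent (hW : DiscreteTopology W) (hc : IsOpenChamber W c)
    (q₀ : CoxeterCover W c) : proj '' connectedComponent q₀ = univ := by
  have := locallyConnectedSpace (c := c) hW
  have ho : ∀ q : CoxeterCover W c, IsOpen (proj '' connectedComponent q) := fun q =>
    isOpenMap_proj hW _ isOpen_connectedComponent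
  refine IsClopen.eq_univ ⟨⟨?_⟩, ho q₀⟩ ⟨_, mem_image_of_mem _ mem_connectedComponent⟩
  refine isOpen_iff_mem_nhds.2 fun x hx => ?_
  obtain ⟨q, rfl⟩ := surjective_proj hW hc x
  filter_upwards [(ho q).mem_nhds (mem_image_of_mem _ mem_connectedComponent)]
  rintro _ ⟨q₁, hq₁, rfl⟩ ⟨q₂, hq₂, he⟩
  obtain ⟨γ, rfl⟩ := exists_smul_eq hW hc he.symm
  refine hx ⟨((1, γ) : W × _) • q, ?_, by simp⟩
  rw [connectedComponent_eq hq₂, ← connectedComponent_smul_congr _ (connectedComponent_eq hq₁)]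
  exact mem_connectedComponent

/-- The Coxeter cover is connected: its components are preserved by the reflections, hence by `W`,
and `W` permutes the chambers of the cover transitively. -/
theorem connectedSpace (hW : IsReflectionGroup W) (hc : IsOpenChamber W c) :
    ConnectedSpace (CoxeterCover W c) := by
  have hW' := hW.discrete
  obtain ⟨x₀, hx₀⟩ := hc.nonempty
  obtain ⟨q₀, hq₀⟩ := surjective_proj hW' hc x₀
  set Z := connectedComponent q₀ with hZ
  -- a reflection has a fixed point above each point of its mirrors, so it preserves `Z`
  have hst : ∀ (w : W) (q : CoxeterCover W c), q ∈ Z →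
      ((w, 1) : W × chamberStabilizer W c) • q ∈ Z := by
    let H : Subgroup W :=
      { carrier := {w | connectedComponent (((w, 1) : W × chamberStabilizer W c) • q₀) = Z}
        mul_mem' := fun {a b} ha hb => by
          have h1 := connectedComponent_smul_congr ((a, 1) : W × chamberStabilizer W c) hb
          rw [smul_smul, Prod.mk_mul_mk, one_mul] at h1
          exact h1.trans ha
        one_mem' := congrArg connectedComponent (one_smul (W × chamberStabilizer W c) q₀)
        inv_mem' := fun {a} ha => by
          have h1 := connectedComponent_smul_congr ((a⁻¹, 1) : W × chamberStabilizer W c) ha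
          rw [smul_smul, Prod.mk_mul_mk, one_mul, inv_mul_cancel] at h1
          exact h1.symm.trans (congrArg connectedComponent
            (one_smul (W × chamberStabilizer W c) q₀)) }
    have hH : H = ⊤ := hW.eq_top_of_forall_mem fun r hr => by
      obtain ⟨ho, x, hx, hS⟩ := isReflection_iff.1 hr
      obtain ⟨q, hq, rfl⟩ := (image_connectedComponent hW' hc q₀).ge (mem_univ x)
      have h1 : r ∈ mirrorReflections W (proj q) :=
        ⟨by rw [← Subgroup.orderOf_coe]; exact ho, hx, hS⟩
      have h2 := connectedComponent_smul_congr ((r, 1) : W × chamberStabilizer W c)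
        (connectedComponent_eq hq)
      rw [smul_eq_of_mem_mirrorReflections h1] at h2
      exact h2.trans (connectedComponent_eq hq).symm
    intro w q hq
    have hw : connectedComponent (((w, 1) : W × chamberStabilizer W c) • q₀) = Z :=
      hH.ge (Subgroup.mem_top w)
    rw [← hw, connectedComponent_smul_congr _ (connectedComponent_eq hq)]
    exact mem_connectedComponent
  have hone : ∃ w, chamber c w ⊆ Z := by
    obtain ⟨w, hw⟩ := exists_mem_chamber hW' (q := q₀) (hq₀ ▸ hc.subset hx₀)
    exact ⟨w, (isConnected_chamber hW' hc w).isPreconnected.subset_connectedComponent hw⟩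
  obtain ⟨w, hw⟩ := hone
  have hall : proj ⁻¹' (mirrorUnion W)ᶜ ⊆ Z := by
    rw [← iUnion_chamber hW']
    refine iUnion_subset fun v => ?_
    rw [show v = (v * w⁻¹) * w by simp, ← image_smul_chamber]
    exact image_subset_iff.2 fun q hq => hst _ _ (hw hq)
  have hd : Dense Z := ((dense_compl_mirrorUnion hW').preimage (isOpenMap_proj hW')).mono hall
  have hu : Z = univ := isClosed_connectedComponent.closure_eq.symm.trans hd.closure_eq
  exact connectedSpace_iff_connectedComponent.2 ⟨q₀, hu⟩

end CoxeterCover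

end

/-! ### The lifted reflection group -/

section

variable {E : Type*} [NormedAddCommGroup E] [NormedSpace ℝ E]

/-- A subgroup of the isometry group is closed and discrete if only finitely many of its elements
move a given point close to any other given point. -/
theorem isClosed_and_discreteTopology_of_finite {X : Type*} [TopologicalSpace X] [ChartedSpace E X]
    [IsManifold 𝓘(ℝ, E) ∞ X] [T2Space X] {g : SmoothMetric E X} {V : Subgroup (Isom g)} (x : X)
    (h : ∀ y : X, ∃ O ∈ 𝓝 y, {f ∈ (V : Set (Isom g)) | f.1 x ∈ O}.Finite) :
    IsClosed (V : Set (Isom g)) ∧ DiscreteTopology V := by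
  let ι : Isom g → C(X, X) := fun f => ⟨fun x => f.1 x, f.1.continuous⟩
  have hι : Continuous ι := continuous_induced_dom
  have hinj : Function.Injective ι := fun f f' hff =>
    Subtype.ext (Homeomorph.ext fun y => DFunLike.congr_fun hff y)
  have : T2Space (Isom g) := T2Space.of_injective_continuous hinj hι
  have hev : Continuous fun f : Isom g => f.1 x := (continuous_eval_const (F := C(X, X)) x).comp hι
  suffices IsClosed (V : Set (Isom g)) ∧ IsDiscrete (V : Set (Isom g)) from
    ⟨this.1, isDiscrete_iff_discreteTopology.1 this.2⟩
  refine isClosed_and_discrete_iff.2 fun f => ?_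
  obtain ⟨O, hO, hf⟩ := h (f.1 x)
  rw [disjoint_principal_right]
  have h1 : ({f ∈ (V : Set (Isom g)) | f.1 x ∈ O} \ {f})ᶜ ∈ 𝓝 f :=
    (hf.subset sdiff_subset).isClosed.isOpen_compl.mem_nhds fun h => h.2 rfl
  refine eventually_nhdsWithin_iff.2 ?_
  filter_upwards [h1, hev.continuousAt.tendsto.eventually hO] with f' h2 h3 h4 h5
  exact h2 ⟨⟨h5, h3⟩, h4⟩

variable [FiniteDimensional ℝ E]
  {M : Type u} [TopologicalSpace M] [ChartedSpace E M] [IsManifold 𝓘(ℝ, E) ∞ M]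
  {g : SmoothMetric E M} {W : Subgroup (Isom g)} {c : Set M}

namespace CoxeterCover

section Deck

variable [T2Space M] [ConnectedSpace M]

/-- The stabilizer of the base chamber as deck transformations of the Coxeter cover. -/
def deckHom (W : Subgroup (Isom g)) (c : Set M) :
    chamberStabilizer W c →* deckGroup (proj : CoxeterCover W c → M) where
  toFun γ := ⟨Homeomorph.smul ((1, γ) : W × chamberStabilizer W c), fun q => by
    change proj (((1, γ) : W × chamberStabilizer W c) • q) = proj q
    simp⟩
  map_one' := Subtype.ext (Homeomorph.ext fun q => one_smul (W × chamberStabilizer W c) q)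
  map_mul' γ γ' := Subtype.ext (Homeomorph.ext fun q => by
    change ((1, γ * γ') : W × chamberStabilizer W c) • q = ((1, γ) : W × chamberStabilizer W c) •
      ((1, γ') : W × chamberStabilizer W c) • q
    simp [smul_smul])

theorem bijective_deckHom (hW : IsReflectionGroup W) (hc : IsOpenChamber W c) :
    Function.Bijective (deckHom W c) := by
  have := connectedSpace hW hc
  obtain ⟨q⟩ := (inferInstance : Nonempty (CoxeterCover W c))
  constructor
  · refine (injective_iff_map_eq_one _).2 fun γ hγ => ?_
    obtain ⟨x, f, h, rfl⟩ := exists_rep q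
    refine eq_one_of_smul_mem_sheet hW.discrete (mk_mem_sheet h) ?_
    have h1 : ((1, γ) : W × chamberStabilizer W c) • mk x f h = mk x f h :=
      DFunLike.congr_fun (congrArg Subtype.val hγ) (mk x f h)
    rw [h1]
    exact mk_mem_sheet h
  · intro φ
    obtain ⟨γ, hγ⟩ := exists_smul_eq hW.discrete hc (φ.2 q).symm
    refine ⟨γ, Subtype.ext (Homeomorph.ext fun z => congrFun
      ((isCoveringMap_proj hW.discrete hc).eq_of_comp_eq
        (deckHom W c γ).1.continuous φ.1.continuous (funext fun z => ?_) q hγ) z)⟩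
    exact ((deckHom W c γ).2 z).trans (φ.2 z).symm

theorem isRegularCover (hW : IsReflectionGroup W) (hc : IsOpenChamber W c) :
    IsRegularCover (proj : CoxeterCover W c → M) where
  connected := connectedSpace hW hc
  isCoveringMap := isCoveringMap_proj hW.discrete hc
  surjective := surjective_proj hW.discrete hc
  transitive q q' h := by
    obtain ⟨γ, hγ⟩ := exists_smul_eq hW.discrete hc h
    exact ⟨_, (deckHom W c γ).2, hγ⟩

/-- Chambers are conjugate, hence so are their stabilizers. -/
theorem _root_.IsOpenChamber.nonempty_mulEquiv (hW : DiscreteTopology W) (hc : IsOpenChamber W c)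
    {c' : Set M} (hc' : IsOpenChamber W c') :
    Nonempty (chamberStabilizer W c ≃* chamberStabilizer W c') := by
  obtain ⟨y, hy⟩ := hc'.nonempty
  obtain ⟨w, hw⟩ := hc.exists_inv_smul_mem hW (hc'.subset hy)
  have he : c' = (fun y => w • y) '' c := by
    rw [hc'.eq_connectedComponentIn hy,
      (hc.smul w).eq_connectedComponentIn ⟨w⁻¹ • y, hw, smul_inv_smul w y⟩]
  have hs : (chamberStabilizer W c).map (MulAut.conj w).toMonoidHom = chamberStabilizer W c' := by
    ext v
    rw [Subgroup.mem_map_equiv]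
    have h1 : v ∈ chamberStabilizer W c' ↔ v • y ∈ c' :=
      ⟨smul_mem_of_mem_chamberStabilizer hy, hc'.mem_chamberStabilizer hy⟩
    have h2 : w⁻¹ * v * w ∈ chamberStabilizer W c ↔ (w⁻¹ * v * w) • w⁻¹ • y ∈ c :=
      ⟨smul_mem_of_mem_chamberStabilizer hw, hc.mem_chamberStabilizer hw⟩
    rw [h1, MulAut.conj_symm_apply, h2, he]
    simp only [mul_smul, smul_inv_smul]
    constructor
    · intro h
      exact ⟨_, h, smul_inv_smul _ _⟩
    · rintro ⟨z, hz, hzv⟩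
      rw [← hzv]
      simpa using hz
  exact ⟨((MulAut.conj w).subgroupMap _).trans (MulEquiv.subgroupCongr hs)⟩

end Deck

variable [ChartedSpace E (CoxeterCover W c)] [IsManifold 𝓘(ℝ, E) ∞ (CoxeterCover W c)]

/-- The action of `W` on its Coxeter cover by isometries. -/
def lift (hp : IsPullbackAtlas (E := E) (proj : CoxeterCover W c → M)) :
    W →* Isom (hp.pullbackMetric g) where
  toFun w := ⟨Homeomorph.smul ((w, 1) : W × chamberStabilizer W c),
    hp.preservesMetric_of_comp (continuous_const_smul ((w, 1) : W × chamberStabilizer W c)) w.1.2.1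
      (proj_smul _),
    hp.preservesMetric_of_comp (continuous_const_smul ((w, 1) : W × chamberStabilizer W c)⁻¹)
      w.1.2.2 (proj_smul _)⟩
  map_one' := Subtype.ext (Homeomorph.ext fun q => one_smul (W × chamberStabilizer W c) q)
  map_mul' w w' := Subtype.ext (Homeomorph.ext fun q => by
    change ((w * w', 1) : W × chamberStabilizer W c) • q = ((w, 1) : W × chamberStabilizer W c) •
      ((w', 1) : W × chamberStabilizer W c) • q
    simp [smul_smul])

variable (hp : IsPullbackAtlas (E := E) (proj : CoxeterCover W c → M))

theorem proj_lift_apply (w : W) (q : CoxeterCover W c) :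
    proj ((lift hp w).1 q) = w • proj q := proj_smul _ _

variable [T2Space M] [ConnectedSpace M]

theorem injective_lift (hW : DiscreteTopology W) (hc : IsOpenChamber W c) :
    Function.Injective (lift hp) := by
  refine (injective_iff_map_eq_one _).2 fun w hw => eq_one_of_forall_smul_eq fun x => ?_
  obtain ⟨q, rfl⟩ := surjective_proj hW hc x
  rw [← proj_lift_apply hp, hw]
  rfl

/-- Near a fixed point of a lifted isometry, its fixed point set is the preimage of that of the
isometry, because the projection is locally injective. -/
theorem isHypersurfaceAt_lift_iff (hW : DiscreteTopology W) {w : W} {q : CoxeterCover W c}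
    (hq : (lift hp w).1 q = q) :
    IsHypersurfaceAt E {z | (lift hp w).1 z = z} q ↔
      IsHypersurfaceAt E {y | w • y = y} (proj q) := by
  rw [← hp.isHypersurfaceAt_preimage_iff]
  obtain ⟨x, f, h, he⟩ := exists_rep q
  have hS : sheet c f ∈ 𝓝 q := (isOpen_sheet hW f).mem_nhds (he ▸ mk_mem_sheet h)
  have hS' : ∀ᶠ z in 𝓝 q, (lift hp w).1 z ∈ sheet c f :=
    (lift hp w).1.continuous.continuousAt.eventually (by rwa [hq])
  have hloc : ∀ᶠ z in 𝓝 q, z ∈ {z | (lift hp w).1 z = z} ↔ z ∈ proj ⁻¹' {y | w • y = y} := by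
    filter_upwards [hS, hS'] with z hz hz'
    change (lift hp w).1 z = z ↔ w • proj z = proj z
    rw [← proj_lift_apply hp]
    exact ⟨congrArg proj, fun h => injOn_proj_sheet f hz' hz h⟩
  exact ⟨fun h => h.congr hloc, fun h => h.congr (hloc.mono fun z => Iff.symm)⟩

theorem orderOf_lift (hW : DiscreteTopology W) (hc : IsOpenChamber W c) (w : W) :
    orderOf (lift hp w) = orderOf w :=
  orderOf_injective (lift hp) (injective_lift hp hW hc) w

theorem mirrorUnion_range_lift (hW : DiscreteTopology W) (hc : IsOpenChamber W c) :
    mirrorUnion (lift hp).range = proj ⁻¹' mirrorUnion W := by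
  ext q
  rw [mem_mirrorUnion_iff, mem_preimage, mem_mirrorUnion_iff_nonempty]
  constructor
  · rintro ⟨_, ⟨r, rfl⟩, ho, hq, hS⟩
    refine ⟨r, by rwa [orderOf_lift hp hW hc] at ho, ?_, (isHypersurfaceAt_lift_iff hp hW hq).1 hS⟩
    rw [← proj_lift_apply hp, hq]
  · rintro ⟨r, hr⟩
    have hq : (lift hp r).1 q = q := smul_eq_of_mem_mirrorReflections hr
    exact ⟨_, ⟨r, rfl⟩, by rw [orderOf_lift hp hW hc, hr.1], hq,
      (isHypersurfaceAt_lift_iff hp hW hq).2 hr.2.2⟩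

theorem isReflection_lift (hW : DiscreteTopology W) (hc : IsOpenChamber W c) {r : W}
    (hr : IsReflection r.1) : IsReflection (lift hp r) := by
  obtain ⟨ho, x, hx, hS⟩ := isReflection_iff.1 hr
  obtain ⟨q, rfl⟩ := surjective_proj hW hc x
  rw [Subgroup.orderOf_coe] at ho
  have hq : (lift hp r).1 q = q := smul_eq_of_mem_mirrorReflections ⟨ho, hx, hS⟩
  exact isReflection_iff.2 ⟨by rw [orderOf_lift hp hW hc, ho], q, hq,
    (isHypersurfaceAt_lift_iff hp hW hq).2 hS⟩

theorem isReflectionGroup_range_lift (hW : IsReflectionGroup W) (hc : IsOpenChamber W c) :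
    IsReflectionGroup (lift hp).range := by
  have hW' := hW.discrete
  have := t2Space hW' hc
  obtain ⟨x⟩ := (inferInstance : Nonempty M)
  obtain ⟨q₀, hq₀⟩ := surjective_proj hW' hc x
  have h := isClosed_and_discreteTopology_of_finite (V := (lift hp).range) q₀ fun q => by
    obtain ⟨U, hU, V, hV, hf⟩ := exists_nhds_finite_of_discrete hW' (proj q₀) (proj q)
    refine ⟨proj ⁻¹' V, continuous_proj.continuousAt hV, (hf.image (lift hp)).subset ?_⟩
    rintro _ ⟨⟨w, rfl⟩, hw⟩
    rw [mem_preimage, proj_lift_apply] at hw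
    exact ⟨w, ⟨proj q₀, mem_of_mem_nhds hU, hw⟩, rfl⟩
  refine ⟨h.2, h.1, le_antisymm ((Subgroup.closure_le _).2 fun r hr => hr.1) ?_⟩
  rintro _ ⟨w, rfl⟩
  have htop := hW.eq_top_of_forall_mem (H := Subgroup.comap (lift hp)
      (Subgroup.closure {r | r ∈ (lift hp).range ∧ IsReflection r})) fun r hr =>
    Subgroup.subset_closure ⟨⟨r, rfl⟩, isReflection_lift hp hW' hc hr⟩
  exact htop.ge (Subgroup.mem_top w)

theorem isOpenChamber_range_lift_iff (hW : DiscreteTopology W) (hc : IsOpenChamber W c)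
    {C : Set (CoxeterCover W c)} :
    IsOpenChamber (lift hp).range C ↔ ∃ w, C = chamber c w := by
  rw [IsOpenChamber, mirrorUnion_range_lift hp hW hc, ← preimage_compl]
  constructor
  · rintro ⟨q, hq, rfl⟩
    obtain ⟨w, hw⟩ := exists_mem_chamber hW hq
    exact ⟨w, connectedComponentIn_eq_chamber hW hc hw⟩
  · rintro ⟨w, rfl⟩
    obtain ⟨q, hq⟩ := (isConnected_chamber hW hc w).nonempty
    exact ⟨q, hq.2, (connectedComponentIn_eq_chamber hW hc hq).symm⟩

omit [T2Space M] [ConnectedSpace M] in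
theorem image_lift_chamber (v w : W) :
    (fun q => (lift hp v).1 q) '' chamber c w = chamber c (v * w) :=
  image_smul_chamber v w

theorem isCoxeterAction_range_lift (hW : DiscreteTopology W) (hc : IsOpenChamber W c) :
    IsCoxeterAction (lift hp).range := by
  intro C hC
  obtain ⟨w, rfl⟩ := (isOpenChamber_range_lift_iff hp hW hc).1 hC
  refine (Subgroup.eq_bot_iff_forall _).2 ?_
  rintro ⟨_, v, rfl⟩ hv
  have h : chamber c (v * w) = chamber c w := (image_lift_chamber hp v w).symm.trans hv
  have h1 : v = 1 := by simpa using chamber_injective hW hc h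
  subst h1
  exact Subtype.ext (map_one _)

theorem existsUnique_image_lift_eq (hW : DiscreteTopology W) (hc : IsOpenChamber W c)
    {C C' : Set (CoxeterCover W c)} (hC : IsOpenChamber (lift hp).range C)
    (hC' : IsOpenChamber (lift hp).range C') :
    ∃! w : W, (fun q => (lift hp w).1 q) '' C = C' := by
  obtain ⟨w, rfl⟩ := (isOpenChamber_range_lift_iff hp hW hc).1 hC
  obtain ⟨w', rfl⟩ := (isOpenChamber_range_lift_iff hp hW hc).1 hC'
  refine ⟨w' * w⁻¹, by
    simp only [image_lift_chamber, inv_mul_cancel_right], fun v hv => ?_⟩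
  have h : v * w = w' := chamber_injective hW hc ((image_lift_chamber hp v w).symm.trans hv)
  rw [← h, mul_inv_cancel_right]

end CoxeterCover

end

end

theorem proposition1p3
    {E : Type v} [NormedAddCommGroup E] [NormedSpace ℝ E] [FiniteDimensional ℝ E]
    {M : Type u} [TopologicalSpace M] [T2Space M] [SecondCountableTopology M] [ConnectedSpace M]
    [ChartedSpace E M] [IsManifold 𝓘(ℝ, E) ∞ M]
    (g : SmoothMetric E M) (W : Subgroup (Isom g)) (hW : IsReflectionGroup W) :
    ∃ (M' : Type u) (_ : TopologicalSpace M') (_ : T2Space M') (_ : SecondCountableTopology M')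
      (_ : ChartedSpace E M') (_ : IsManifold 𝓘(ℝ, E) ∞ M')
      (g' : SmoothMetric E M') (p : M' → M) (ρ : W →* Isom g'),
      -- `p` is a regular Riemannian cover, with deck group isomorphic to the chamber stabilizers
      IsRegularCover p ∧ PreservesMetric g' g p ∧
      (∀ c : Set M, IsOpenChamber W c → Nonempty (deckGroup p ≃* chamberStabilizer W c)) ∧
      -- `ρ` lifts the action of `W` and commutes with the deck group
      (∀ (w : W) (x : M'), p ((ρ w).1 x) = w.1.1 (p x)) ∧
      (∀ (w : W), ∀ γ ∈ deckGroup p, ∀ x : M', (ρ w).1 (γ x) = γ ((ρ w).1 x)) ∧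
      -- `W` acts on `M'` as a reflection group; the action is Coxeter, simply transitive on chambers
      Function.Injective ρ ∧ IsReflectionGroup ρ.range ∧ IsCoxeterAction ρ.range ∧
      (∀ c c' : Set M', IsOpenChamber ρ.range c → IsOpenChamber ρ.range c' →
        ∃! w : W, (fun x => (ρ w).1 x) '' c = c') := by
  have hW' := hW.discrete
  obtain ⟨x, hx⟩ := (dense_compl_mirrorUnion hW').nonempty
  obtain ⟨c, hc⟩ : ∃ c, IsOpenChamber W c := ⟨_, x, hx, rfl⟩
  obtain ⟨cs, hp⟩ :=
    (CoxeterCover.isLocalHomeomorph_proj (c := c) hW').exists_isPullbackAtlas (E := E)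
  have hm := hp.isManifold
  refine ⟨CoxeterCover W c, inferInstance, CoxeterCover.t2Space hW' hc,
    CoxeterCover.secondCountableTopology hW' hc, cs, hm, hp.pullbackMetric g, CoxeterCover.proj,
    CoxeterCover.lift hp, CoxeterCover.isRegularCover hW hc, hp.preservesMetric g, fun c' hc' => ?_,
    CoxeterCover.proj_lift_apply hp, fun w γ hγ q => ?_, CoxeterCover.injective_lift hp hW' hc,
    CoxeterCover.isReflectionGroup_range_lift hp hW hc,
    CoxeterCover.isCoxeterAction_range_lift hp hW' hc,
    fun C C' hC hC' => CoxeterCover.existsUnique_image_lift_eq hp hW' hc hC hC'⟩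
  · obtain ⟨e⟩ := hc.nonempty_mulEquiv hW' hc'
    exact ⟨(MulEquiv.ofBijective _ (CoxeterCover.bijective_deckHom hW hc)).symm.trans e⟩
  · obtain ⟨γ', h⟩ := (CoxeterCover.bijective_deckHom hW hc).2 ⟨γ, hγ⟩
    obtain rfl : (CoxeterCover.deckHom W c γ').1 = γ := congrArg Subtype.val h
    change ((w, 1) : W × chamberStabilizer W c) • ((1, γ') : W × chamberStabilizer W c) • q
      = ((1, γ') : W × chamberStabilizer W c) • ((w, 1) : W × chamberStabilizer W c) • q
    simp [smul_smul]
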